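/- **Setting.** Let $\mathcal A=\{1,\dots,K\}$, let $\mathcal X$ be a measurable space and let $D$ be a probability distribution of pairs $(x,r)\in\mathcal X\times[0,1]^K$, with marginal $D_{\mathcal X}$ on $\mathcal X$. Let $\mathcal F$ be a (finite or infinite) class of measurable predictors $f:\mathcal X\times\mathcal A\to[0,1]$ which is pointwise measurable: it has a countable subclass such that every $f\in\mathcal F$ is a pointwise limit of a sequence in that subclass (automatic if $\mathcal F$ is countable). Assume realizability: there is $f^\star\in\mathcal F$ with $\mathbb E[r(a)\mid x]=f^\star(x,a)$ for all $a$. Let $\pi^\star(x)\in\arg\max_a f^\star(x,a)$, ties being broken arbitrarily (measurably in $x$). Let $U_0(a)=\{x: f^\star(x,a)\ge f^\star(x,a')\ \forall a'\ne a\}$; the implicit exploration coefficient $L_{2,0}>0$ is the smallest positive constant such that for all $f\in\mathcal F$, $x\in\mathcal X$, $a\in\mathcal A$, $$(f(x,a)-f^\star(x,a))^2\le L_{2,0}\,\mathbb E_{x'\sim D_{\mathcal X}}\mathbb E_{a'\sim\mathrm{Unif}(\mathcal A)}\big[\mathbf 1\{x'\in U_0(a')\}(f(x',a')-f^\star(x',a'))^2\big],$$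 and it is assumed to exist (which implies that $\mathcal F\neq\{f^\star\}$). **Algorithm.** Let $T\ge2$ and $\delta\in(0,1)$. In each round $t=1,\dots,T$ a pair $(x_t,r_t)\sim D$ is drawn independently of the past, the learner sees $x_t$, chooses $a_t$ and observes $r_t(a_t)$. Let $\tau_m=2^{m-1}$; epoch $m$ consists of the rounds $\tau_m\le t<\tau_{m+1}$, and $M=\lfloor\log_2T\rfloor+1$ is the number of epochs. Let $\mathcal N_1(\mathcal G,\varepsilon,x_{1:T})$ be the smallest size of a set $V\subseteq\mathbb R^T$ such that every $g\in\mathcal G$ has some $v\in V$ with $\frac1T\sum_{t\le T}|g(x_t)-v_t|\le\varepsilon$, let $\mathcal F|_a=\{f(\cdot,a):f\in\mathcal F\}$, and let $$C'_\delta=\min\Big\{16\log\tfrac{2|\mathcal F|T^2}{\delta},\ \inf_{\varepsilon>0}\Big\{100\,\varepsilon KT+320\sum_{a\in\mathcal A}\log\tfrac{8\,\mathbb E_{x_{1:T}\sim D_{\mathcal X}^{T}}[\mathcal N_1(\mathcal F|_a,\varepsilon,x_{1:T})]\,K\,T^2\log T}{\delta}\Big\}\Big\},$$ where the first term is $+\infty$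 if $\mathcal F$ is infinite; if $\mathcal F$ is finite, one may instead take $C'_\delta=16\log(2|\mathcal F|T^2/\delta)$. Put $\beta_m=(M-m+1)C'_\delta/(\tau_m-1)$ and $\widehat{\mathcal R}_m(f)=\frac1{\tau_m-1}\sum_{s<\tau_m}(f(x_s,a_s)-r_s(a_s))^2$ for $m\ge2$. RegCB.Elimination (general class) sets $\mathcal F_1=\mathcal F$ and $\mathcal F_m=\{f\in\mathcal F:\widehat{\mathcal R}_m(f)-\inf_{\mathcal F}\widehat{\mathcal R}_m\le\beta_m\}$ for $m\ge 2$; in each round $t$ of epoch $m$ it draws $a_t$ uniformly from $$A_t=\Big\{a:\ \sup_{f\in\mathcal F_m}f(x_t,a)\ \ge\ \max_{a'}\inf_{f\in\mathcal F_m}f(x_t,a')\Big\}.$$ Let $\mathrm{Reg}_T=\sum_{t\le T}r_t(\pi^\star(x_t))-\sum_{t\le T}r_t(a_t)$. **Theorem.** There are universal constants $C>0$ and $k\in\mathbb N$ such that the following holds. 1. With probability at least $1-\delta$, $$\mathrm{Reg}_T\le C\Big(\sqrt{T\,L_{2,0}\,C'_\delta}\,\log T+\log(1/\delta)\Big).$$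 If $\mathcal F$ is finite then also, with probability at least $1-\delta$, $\mathrm{Reg}_T\le C\sqrt{T\,L_{2,0}\log|\mathcal F|}\,\big(1+\log T+\log K+\log(1/\delta)\big)^k$, that is, $\mathrm{Reg}_T=\tilde O\big(\sqrt{T L_{2,0}\log|\mathcal F|}\big)$. 2. If the Massart noise condition holds with margin $\gamma>0$, that is, $f^\star(x,\pi^\star(x))\ge f^\star(x,a)+\gamma$ for all $x$ and all $a\ne\pi^\star(x)$, and the algorithm is run with $\delta=1/T$, then $$\mathbb E[\mathrm{Reg}_T]\le C\,\frac{L_{2,0}\,C'_{1/T}\,\log^2T}{\gamma}.$$ If $\mathcal F$ is finite then also $\mathbb E[\mathrm{Reg}_T]\le C\,\frac{L_{2,0}\log|\mathcal F|}{\gamma}\,(1+\log T+\log K)^k$, that is, $\mathbb E[\mathrm{Reg}_T]=\tilde O\big(L_{2,0}\log|\mathcal F|/\gamma\big)$. -/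

import Mathlib

open MeasureTheory ProbabilityTheory

noncomputable section

namespace RegCB

/-- Predictors `f : 𝒳 × 𝒜 → ℝ`, with the action set `𝒜 = Fin K`. -/
abbrev Predictor (X : Type*) (K : ℕ) := X → Fin K → ℝ

/-! ### Assumptions on the problem -/

/-- `F` is a class of measurable predictors with values in `[0,1]`. -/
def IsPredictorClass {X : Type*} [MeasurableSpace X] {K : ℕ} (F : Set (Predictor X K)) : Prop :=
  ∀ f ∈ F, ∀ a, Measurable (fun x => f x a) ∧ ∀ x, f x a ∈ Set.Icc (0 : ℝ) 1

/-- `F` is a pointwise measurable class: some countable subclass is dense in `F` for pointwise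
convergence of sequences. This holds for every countable, in particular every finite, class. -/
def IsPointwiseMeasurable {X : Type*} {K : ℕ} (F : Set (Predictor X K)) : Prop :=
  ∃ F₀ ⊆ F, F₀.Countable ∧ ∀ f ∈ F, ∃ u : ℕ → Predictor X K, (∀ n, u n ∈ F₀) ∧
    ∀ x a, Filter.Tendsto (fun n => u n x a) Filter.atTop (nhds (f x a))

/-- Rewards lie in `[0,1]^K` almost surely. -/
def HasUnitRewards {X : Type*} [MeasurableSpace X] {K : ℕ} (D : Measure (X × (Fin K → ℝ))) : Prop :=
  ∀ᵐ p ∂D, ∀ a, p.2 a ∈ Set.Icc (0 : ℝ) 1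

/-- Realizability: `fstar` lies in the class and `fstar x a` is the conditional mean of the reward
`r a` given the context `x`, where `(x, r)` has law `D`. -/
def IsRealizedBy {X : Type*} [MeasurableSpace X] {K : ℕ} (D : Measure (X × (Fin K → ℝ)))
    (F : Set (Predictor X K)) (fstar : Predictor X K) : Prop :=
  fstar ∈ F ∧ ∀ a,
    condExp (MeasurableSpace.comap Prod.fst inferInstance) D (fun p => p.2 a)
      =ᵐ[D] fun p => fstar p.1 a

/-- `pi` is a (measurable) greedy policy of `f`; ties are broken arbitrarily. -/
def IsGreedyPolicy {X : Type*} [MeasurableSpace X] {K : ℕ} (f : Predictor X K)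
    (pi : X → Fin K) : Prop :=
  Measurable pi ∧ ∀ x a, f x a ≤ f x (pi x)

/-- The Massart noise condition with margin `γ`. -/
def Massart {X : Type*} {K : ℕ} (fstar : Predictor X K) (pistar : X → Fin K) (γ : ℝ) : Prop :=
  0 < γ ∧ ∀ x a, a ≠ pistar x → fstar x a + γ ≤ fstar x (pistar x)

/-! ### The implicit exploration coefficient -/

/-- `U_lam(a)`: the contexts where `a` is the best action by a margin of `lam`. -/
def bestRegion {X : Type*} {K : ℕ} (fstar : Predictor X K) (lam : ℝ) (a : Fin K) : Set X :=
  {x | ∀ a', a' ≠ a → fstar x a' + lam ≤ fstar x a}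

/-- `E_{x ∼ DX} E_{a ∼ Unif(𝒜)} [1{x ∈ U_lam(a)} (f(x,a) - fstar(x,a))²]`. -/
def exploredError {X : Type*} [MeasurableSpace X] {K : ℕ} (DX : Measure X)
    (fstar : Predictor X K) (lam : ℝ) (f : Predictor X K) : ℝ :=
  ∫ x, (1 / (K : ℝ)) *
    ∑ a, (bestRegion fstar lam a).indicator (fun x => (f x a - fstar x a) ^ 2) x ∂DX

/-- `L` is the implicit exploration coefficient `L_{2,lam} > 0`: the smallest positive constant in
the defining inequality. -/
def IsIEC {X : Type*} [MeasurableSpace X] {K : ℕ} (DX : Measure X)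
    (F : Set (Predictor X K)) (fstar : Predictor X K) (lam L : ℝ) : Prop :=
  IsLeast {c : ℝ | 0 < c ∧ ∀ f ∈ F, ∀ x a,
    (f x a - fstar x a) ^ 2 ≤ c * exploredError DX fstar lam f} L

/-! ### Covering numbers and the confidence constant -/

/-- `V` is an empirical `L₁`-cover at scale `ε` of the class `G` on the points `x₁, …, x_T`. -/
def IsL1Cover {X : Type*} {T : ℕ} (G : Set (X → ℝ)) (ε : ℝ) (x : Fin T → X)
    (V : Finset (Fin T → ℝ)) : Prop :=
  ∀ g ∈ G, ∃ v ∈ V, (1 / (T : ℝ)) * ∑ t, |g (x t) - v t| ≤ ε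

/-- The empirical `L₁` covering number `𝒩₁(G, ε, x_{1:T})`. -/
def coveringNumber {X : Type*} {T : ℕ} (G : Set (X → ℝ)) (ε : ℝ) (x : Fin T → X) : ℕ∞ :=
  ⨅ (V : Finset (Fin T → ℝ)) (_ : IsL1Cover G ε x V), (V.card : ℕ∞)

/-- The expected covering number `E 𝒩₁(G, ε, x_{1:T})` for i.i.d. contexts `x_t ∼ DX`. -/
def expectedCoveringNumber {X : Type*} [MeasurableSpace X] (DX : Measure X) (T : ℕ)
    (G : Set (X → ℝ)) (ε : ℝ) : ℝ :=
  (∫⁻ x, (coveringNumber G ε x : ENNReal) ∂(Measure.pi fun _ : Fin T => DX)).toReal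

/-- The class `F|_a` of the functions `x ↦ f(x,a)`, `f ∈ F`. -/
def actionClass {X : Type*} {K : ℕ} (F : Set (Predictor X K)) (a : Fin K) : Set (X → ℝ) :=
  (fun f x => f x a) '' F

/-- `16 log(2 |F| T² / δ)` (used for finite `F` only). -/
def finiteConst {X : Type*} {K : ℕ} (F : Set (Predictor X K)) (T : ℕ) (δ : ℝ) : ℝ :=
  16 * Real.log (2 * F.ncard * (T : ℝ) ^ 2 / δ)

/-- `inf_{ε > 0} {100 ε K T + 320 ∑_a log(8 E[𝒩₁(F|_a, ε, x_{1:T})] K T² log T / δ)}`. -/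
def coveringConst {X : Type*} [MeasurableSpace X] {K : ℕ} (DX : Measure X)
    (F : Set (Predictor X K)) (T : ℕ) (δ : ℝ) : ℝ :=
  ⨅ ε : Set.Ioi (0 : ℝ), (100 * (ε : ℝ) * K * T + 320 * ∑ a, Real.log
    (8 * expectedCoveringNumber DX T (actionClass F a) ε * K * (T : ℝ) ^ 2 * Real.log T / δ))

open Classical in
/-- The constant `C'_δ`: the smaller of the two constants above, the first one being infinite for
an infinite class. -/
def confidenceConst {X : Type*} [MeasurableSpace X] {K : ℕ} (DX : Measure X)
    (F : Set (Predictor X K)) (T : ℕ) (δ : ℝ) : ℝ :=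
  if F.Finite then min (finiteConst F T δ) (coveringConst DX F T δ) else coveringConst DX F T δ

/-- The two admissible choices of `C'_δ`: the general one and, for finite classes, simply
`16 log(2 |F| T² / δ)`. -/
def IsConfidenceConst {X : Type*} [MeasurableSpace X] {K : ℕ} (DX : Measure X)
    (F : Set (Predictor X K)) (T : ℕ) (δ c : ℝ) : Prop :=
  c = confidenceConst DX F T δ ∨ (F.Finite ∧ c = finiteConst F T δ)

/-! ### The algorithm RegCB.Elimination for a general class -/

/-- First round `τ_m = 2^(m-1)` of epoch `m`. -/
def epochStart (m : ℕ) : ℕ := 2 ^ (m - 1)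

/-- The number `M` of epochs needed for `T` rounds: the `M` with `τ_M ≤ T < τ_{M+1}`. -/
def numEpochs (T : ℕ) : ℕ := Nat.log 2 T + 1

/-- The tolerance `β_m = (M - m + 1) c / (τ_m - 1)`. -/
def tolerance (T : ℕ) (c : ℝ) (m : ℕ) : ℝ :=
  ((numEpochs T : ℝ) - m + 1) * c / ((epochStart m : ℝ) - 1)

/-- Empirical square loss of `f` over the rounds `s < τ_m`. -/
def empRisk {X : Type*} {K : ℕ} (x : ℕ → X) (r : ℕ → Fin K → ℝ) (a : ℕ → Fin K) (m : ℕ)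
    (f : Predictor X K) : ℝ :=
  1 / ((epochStart m : ℝ) - 1) *
    ∑ s ∈ Finset.Ico 1 (epochStart m), (f (x s) (a s) - r s (a s)) ^ 2

/-- The version space of epoch `m` with tolerance `β`; it is all of `F` in the first epoch. -/
def versionSpace {X : Type*} {K : ℕ} (F : Set (Predictor X K)) (x : ℕ → X)
    (r : ℕ → Fin K → ℝ) (a : ℕ → Fin K) (m : ℕ) (β : ℝ) : Set (Predictor X K) :=
  if m ≤ 1 then F
  else {f ∈ F | empRisk x r a m f - sInf (empRisk x r a m '' F) ≤ β}

/-- Upper reward bound. -/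
def high {X : Type*} {K : ℕ} (F : Set (Predictor X K)) (x : X) (a : Fin K) : ℝ :=
  sSup ((fun f => f x a) '' F)

/-- Lower reward bound. -/
def low {X : Type*} {K : ℕ} (F : Set (Predictor X K)) (x : X) (a : Fin K) : ℝ :=
  sInf ((fun f => f x a) '' F)

open Classical in
/-- The plausible actions `{a : High(x,a) ≥ max_{a'} Low(x,a')}`. -/
def plausible {X : Type*} {K : ℕ} (F : Set (Predictor X K)) (x : X) : Finset (Fin K) :=
  Finset.univ.filter fun a => ∀ a', low F x a' ≤ high F x a

/-- Probability of `a` under the uniform distribution on `S`. -/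
def unifProb {K : ℕ} (S : Finset (Fin K)) (a : Fin K) : ℝ :=
  if a ∈ S then 1 / (S.card : ℝ) else 0

/-- The σ-algebra generated by `(x_s, r_s, a_s)`, `1 ≤ s < t`. -/
@[reducible] def history {Ω X : Type*} [MeasurableSpace X] {K : ℕ} (x : ℕ → Ω → X)
    (r : ℕ → Ω → Fin K → ℝ) (a : ℕ → Ω → Fin K) (t : ℕ) : MeasurableSpace Ω :=
  ⨆ s ∈ Set.Ico 1 t, MeasurableSpace.comap (fun ω => (x s ω, r s ω, a s ω)) inferInstance

/-- `(x_t, r_t, a_t)`, `1 ≤ t ≤ T`, are the contexts, reward vectors and actions of a `T`-round run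
of RegCB.Elimination (general class) with tolerances `β` in an environment with law `D`: in every
round `(x_t, r_t) ∼ D` is independent of the past and, in epoch `m`, the action is drawn uniformly
from the plausible set of the version space of that epoch, given the past and `x_t` and without
access to `r_t` (the conditional law does not change if `r_t` is also given). -/
structure IsEliminationRun {Ω X : Type*} [MeasurableSpace Ω] [MeasurableSpace X] {K : ℕ}
    (μ : Measure Ω) (D : Measure (X × (Fin K → ℝ))) (F : Set (Predictor X K)) (β : ℕ → ℝ)
    (T : ℕ) (x : ℕ → Ω → X) (r : ℕ → Ω → Fin K → ℝ) (a : ℕ → Ω → Fin K) : Prop where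
  measurable_context : ∀ t, Measurable (x t)
  measurable_reward : ∀ t, Measurable (r t)
  measurable_action : ∀ t, Measurable (a t)
  env_law : ∀ t ∈ Set.Icc 1 T, μ.map (fun ω => (x t ω, r t ω)) = D
  env_indep : ∀ t ∈ Set.Icc 1 T, Indep (history x r a t)
    (MeasurableSpace.comap (fun ω => (x t ω, r t ω)) inferInstance) μ
  action_law : ∀ m ∈ Set.Icc 1 (numEpochs T),
    ∀ t ∈ Set.Ico (epochStart m) (epochStart (m + 1)), t ≤ T → ∀ b : Fin K,
      condExp (history x r a t ⊔ MeasurableSpace.comap (x t) inferInstance) μ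
          ({ω | a t ω = b}.indicator fun _ => (1 : ℝ))
        =ᵐ[μ] fun ω => unifProb (plausible (versionSpace F (fun s => x s ω) (fun s => r s ω)
          (fun s => a s ω) m (β m)) (x t ω)) b
  action_law_given_reward : ∀ m ∈ Set.Icc 1 (numEpochs T),
    ∀ t ∈ Set.Ico (epochStart m) (epochStart (m + 1)), t ≤ T → ∀ b : Fin K,
      condExp (history x r a t ⊔
          MeasurableSpace.comap (fun ω => (x t ω, r t ω)) inferInstance) μ
          ({ω | a t ω = b}.indicator fun _ => (1 : ℝ))
        =ᵐ[μ] fun ω => unifProb (plausible (versionSpace F (fun s => x s ω) (fun s => r s ω)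
          (fun s => a s ω) m (β m)) (x t ω)) b

/-- The regret `∑_{t ≤ T} r_t(pistar(x_t)) - ∑_{t ≤ T} r_t(a_t)`. -/
def regret {Ω X : Type*} {K : ℕ} (pistar : X → Fin K) (T : ℕ) (x : ℕ → Ω → X)
    (r : ℕ → Ω → Fin K → ℝ) (a : ℕ → Ω → Fin K) (ω : Ω) : ℝ :=
  ∑ t ∈ Finset.Icc 1 T, r t ω (pistar (x t ω)) - ∑ t ∈ Finset.Icc 1 T, r t ω (a t ω)

end RegCB

end

/-! The algorithm never explores deliberately. As long as `fstar` survives, however, every action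
that is optimal at the current context is plausible, so it is played with probability at least
`1/K`. Hence the squared error of `f` on the regions where actions are optimal, which is what the
implicit exploration coefficient measures, is at most the conditional squared error along the run.
Small empirical excess loss therefore forces small explored error, and `IsIEC` turns this into a
uniform bound on `f - fstar`.

Two concentration events make this rigorous. `LossesConcentrate`: given the past and the context,
Hoeffding's lemma shows that exp(-excess + condError/4) has mean at most 1, so sums of `deviation`
exceed `u` with probability at most `exp (-u)`, with no variance term. `ErrorsConcentrate`: the
population explored error is at most a constant times the empirical one plus `c/n`. For a finite
class both follow from union bounds.

For an infinite class a cover on `x₁, …, x_T` depends on future contexts, so an ordinary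
supermartingale argument does not apply to its elements. Since actions and rewards of a round are
independent of later contexts, the exponential process is still a supermartingale given all contexts
(`IsIidContexts.lintegral_prod_le`). The context space is cut into countably many measurable pieces,
each with a fixed finite family of rational vectors. A union bound on each piece is weighted by the
mass of the piece, and the masses sum to at most 1. The explored errors are handled by
symmetrization with a ghost sample taken from the same `T` contexts.

On the good event (`IsRegular.fstar_mem`, `IsRegular.sq_sub_le`, `IsRegular.sq_actionGap_le`),
`fstar` survives every epoch, survivors of epoch `m` are within order sqrt(L M c / τ_m) of it, and a
plausible action loses at most twice this. Squared gaps thus decay like `1/t`. Summing `1/√t` and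
adding a martingale fluctuation gives the first bound. Under the Massart condition a nonzero gap is
at least `γ`, so a gap is at most its square over `γ`, and the harmonic sum gives the second. The
inequality `1 ≤ L` (`IsIEC.one_le`) absorbs lower-order terms. -/

open MeasureTheory ProbabilityTheory

noncomputable section

namespace RegCB

open scoped ENNReal

/-! ### Conditioning identities for nonnegative functions -/

/-- Taking out what is known, for nonnegative functions. -/
lemma lintegral_mul_ofReal_condExp {Ω : Type*} {m m0 : MeasurableSpace Ω} {μ : Measure Ω}
    [IsFiniteMeasure μ] (hm : m ≤ m0) {f : Ω → ℝ} (hf : Integrable[m0] f μ) (h0 : 0 ≤ᵐ[μ] f)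
    {Φ : Ω → ℝ≥0∞} (hΦ : Measurable[m] Φ) :
    ∫⁻ ω, Φ ω * ENNReal.ofReal (μ[f | m] ω) ∂μ = ∫⁻ ω, Φ ω * ENNReal.ofReal (f ω) ∂μ := by
  set ν₁ : Measure Ω := μ.withDensity fun ω => ENNReal.ofReal (μ[f | m] ω)
  set ν₂ : Measure Ω := μ.withDensity fun ω => ENNReal.ofReal (f ω)
  have hf' : AEMeasurable (fun ω => ENNReal.ofReal (f ω)) μ := hf.1.aemeasurable.ennreal_ofReal
  have hc' : AEMeasurable (fun ω => ENNReal.ofReal (μ[f | m] ω)) μ :=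
    (stronglyMeasurable_condExp.measurable.mono hm le_rfl).ennreal_ofReal.aemeasurable
  have hc0 : 0 ≤ᵐ[μ] μ[f | m] := condExp_nonneg h0
  -- The defining property of the conditional expectation says that the two densities give the same
  -- mass to every set of `m`. With nonnegative `Φ` no integrability of the product is needed.
  have key : ν₁.trim hm = ν₂.trim hm := by
    refine @Measure.ext _ m _ _ fun s hs => ?_
    rw [trim_measurableSet_eq hm hs, trim_measurableSet_eq hm hs,
      withDensity_apply _ (hm s hs), withDensity_apply _ (hm s hs),
      ← ofReal_integral_eq_lintegral_ofReal integrable_condExp.integrableOn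
        (ae_restrict_of_ae hc0),
      ← ofReal_integral_eq_lintegral_ofReal hf.integrableOn (ae_restrict_of_ae h0),
      setIntegral_condExp hm hf hs]
  have hΦ' : Measurable Φ := hΦ.mono hm le_rfl
  calc ∫⁻ ω, Φ ω * ENNReal.ofReal (μ[f | m] ω) ∂μ = ∫⁻ ω, Φ ω ∂ν₁ := by
        rw [lintegral_withDensity_eq_lintegral_mul₀ hc' hΦ'.aemeasurable]
        simp [mul_comm]
    _ = ∫⁻ ω, Φ ω ∂ν₂ := by
        rw [← lintegral_trim hm hΦ, key, lintegral_trim hm hΦ]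
    _ = _ := by
        rw [lintegral_withDensity_eq_lintegral_mul₀ hf' hΦ'.aemeasurable]
        simp [mul_comm]

/-- Integrating out the second component of an independent pair `Z ∼ D` with the conditional
kernel of `D`. -/
lemma lintegral_mul_indep_prod {Ω Ω₁ X R : Type*} [MeasurableSpace Ω] [MeasurableSpace Ω₁]
    [MeasurableSpace X] [MeasurableSpace R] [StandardBorelSpace R] [Nonempty R]
    {μ : Measure Ω} [IsProbabilityMeasure μ] {D : Measure (X × R)} [IsProbabilityMeasure D]
    {H : Ω → Ω₁} {Z : Ω → X × R} (hH : Measurable H) (hZ : Measurable Z) (hD : μ.map Z = D)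
    (hind : IndepFun H Z μ) {Φ : Ω₁ × X → ℝ≥0∞} (hΦ : Measurable Φ) {ψ : X × R → ℝ≥0∞}
    (hψ : Measurable ψ) :
    ∫⁻ ω, Φ (H ω, (Z ω).1) * ψ (Z ω) ∂μ =
      ∫⁻ ω, Φ (H ω, (Z ω).1) *
        ∫⁻ r, ψ ((Z ω).1, r) ∂(condDistrib Prod.snd Prod.fst D (Z ω).1) ∂μ := by
  set κ := condDistrib (Prod.snd : X × R → R) Prod.fst D
  have hκ : Measurable fun x => ∫⁻ r, ψ (x, r) ∂(κ x) := hψ.lintegral_kernel_prod_right'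
  have hlaw : μ.map (fun ω => (H ω, Z ω)) = (μ.map H).prod D := by
    rw [(indepFun_iff_map_prod_eq_prod_map_map hH.aemeasurable hZ.aemeasurable).1 hind, hD]
  have hdis : (D.map Prod.fst) ⊗ₘ κ = D := by
    have := compProd_map_condDistrib (mβ := inferInstance) (X := (Prod.fst : X × R → X))
      (Y := Prod.snd) (μ := D) measurable_snd.aemeasurable
    simpa using this
  have inner : ∀ φ : X → ℝ≥0∞, Measurable φ →
      ∫⁻ z, φ z.1 * ψ z ∂D = ∫⁻ z, φ z.1 * ∫⁻ r, ψ (z.1, r) ∂(κ z.1) ∂D := by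
    intro φ hφ
    conv_lhs => rw [← hdis]
    rw [Measure.lintegral_compProd (by fun_prop)]
    have : ∫⁻ z, φ z.1 * ∫⁻ r, ψ (z.1, r) ∂(κ z.1) ∂D
        = ∫⁻ x, φ x * ∫⁻ r, ψ (x, r) ∂(κ x) ∂(D.map Prod.fst) := by
      exact (lintegral_map (hφ.mul hκ) measurable_fst).symm
    rw [this]
    refine lintegral_congr fun x => ?_
    exact lintegral_const_mul (φ x) (hψ.comp (measurable_prodMk_left (x := x)))
  have h1 : ∀ G : Ω₁ × X × R → ℝ≥0∞, Measurable G →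
      ∫⁻ ω, G (H ω, Z ω) ∂μ = ∫⁻ h, ∫⁻ z, G (h, z) ∂D ∂(μ.map H) := by
    intro G hG
    rw [← lintegral_prod _ hG.aemeasurable, ← hlaw, lintegral_map hG (by fun_prop)]
  rw [h1 (fun p => Φ (p.1, p.2.1) * ψ p.2) (by fun_prop),
    h1 (fun p => Φ (p.1, p.2.1) * ∫⁻ r, ψ (p.2.1, r) ∂(κ p.2.1))
      ((by fun_prop : Measurable fun p : Ω₁ × X × R => Φ (p.1, p.2.1)).mul
        (hκ.comp (by fun_prop)))]
  exact lintegral_congr fun h => inner (fun x => Φ (h, x)) (by fun_prop)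

/-- Version of `lintegral_mul_indep_prod` for a sub-σ-algebra. -/
lemma lintegral_mul_indep_prod' {Ω X R : Type*} {m m0 : MeasurableSpace Ω}
    [mX : MeasurableSpace X] [MeasurableSpace R] [StandardBorelSpace R] [Nonempty R]
    {μ : Measure Ω} [IsProbabilityMeasure μ] {D : Measure (X × R)} [IsProbabilityMeasure D]
    (hm : m ≤ m0) {Z : Ω → X × R} (hZ : Measurable Z) (hD : μ.map Z = D)
    (hind : Indep m (MeasurableSpace.comap Z inferInstance) μ) {Φ : Ω → ℝ≥0∞}
    (hΦ : Measurable[m ⊔ MeasurableSpace.comap (fun ω => (Z ω).1) mX] Φ)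
    {ψ : X × R → ℝ≥0∞} (hψ : Measurable ψ) :
    ∫⁻ ω, Φ ω * ψ (Z ω) ∂μ =
      ∫⁻ ω, Φ ω * ∫⁻ r, ψ ((Z ω).1, r) ∂(condDistrib Prod.snd Prod.fst D (Z ω).1) ∂μ := by
  -- The join is generated by the single map ω ↦ (ω, context), where the first copy of `Ω` carries
  -- only `m`. So `Φ` factors through that map, and the identity into `(Ω, m)` plays the role of the
  -- past variable `H`.
  have hcomap : m ⊔ MeasurableSpace.comap (fun ω => (Z ω).1) mX =
      MeasurableSpace.comap (fun ω => (ω, (Z ω).1)) (@Prod.instMeasurableSpace _ _ m mX) := by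
    simp [Prod.instMeasurableSpace, MeasurableSpace.prod, MeasurableSpace.comap_sup,
      MeasurableSpace.comap_comp, Function.comp_def]
    congr 1
    exact MeasurableSpace.comap_id.symm
  rw [hcomap] at hΦ
  obtain ⟨Φ', hΦ', rfl⟩ := @Measurable.exists_eq_measurable_comp Ω (Ω × X) ℝ≥0∞
    (@Prod.instMeasurableSpace _ _ m mX) (fun ω => (ω, (Z ω).1)) Φ _ _ _ hΦ
  have hH : Measurable[m0, m] (id : Ω → Ω) := fun s hs => hm s hs
  have hi : @IndepFun Ω Ω (X × R) m0 m _ id Z μ := by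
    refine (@IndepFun_iff_Indep _ _ _ m0 m _ id Z μ).2 ?_
    rwa [MeasurableSpace.comap_id]
  exact @lintegral_mul_indep_prod Ω Ω X R m0 m mX _ _ _ μ _ D _ id Z hH hZ hD hi Φ' hΦ' ψ hψ

/-- One round of interaction: `Z = (context, reward vector) ∼ D` is independent of the past `m`, and
the law of the action `A` given `m` and the context does not change if the rewards are also
given. -/
structure IsRound {Ω X : Type*} (m : MeasurableSpace Ω) {m0 : MeasurableSpace Ω}
    [mX : MeasurableSpace X] {K : ℕ} (μ : Measure Ω) (D : Measure (X × (Fin K → ℝ)))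
    (Z : Ω → X × (Fin K → ℝ)) (A : Ω → Fin K) : Prop where
  le : m ≤ m0
  measurable_env : Measurable Z
  measurable_action : Measurable A
  env_law : μ.map Z = D
  env_indep : Indep m (MeasurableSpace.comap Z inferInstance) μ
  action_law : ∀ b, μ[{ω | A ω = b}.indicator fun _ => (1 : ℝ) |
      m ⊔ MeasurableSpace.comap Z inferInstance] =ᵐ[μ]
    μ[{ω | A ω = b}.indicator fun _ => (1 : ℝ) | m ⊔ MeasurableSpace.comap (fun ω => (Z ω).1) mX]

/-! ### Integrating out the action and the rewards of one round. -/

section Round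

variable {Ω X : Type*} {m m0 : MeasurableSpace Ω} [mX : MeasurableSpace X] {K : ℕ}
  {μ : Measure Ω} {D : Measure (X × (Fin K → ℝ))}
  {Z : Ω → X × (Fin K → ℝ)} {A : Ω → Fin K}

/-- The conditional law of the action given the past and the context. -/
def actionProb (m : MeasurableSpace Ω) {m0 : MeasurableSpace Ω} (μ : Measure Ω)
    (x : Ω → X) (A : Ω → Fin K) (b : Fin K) : Ω → ℝ :=
  μ[{ω | A ω = b}.indicator fun _ => (1 : ℝ) | m ⊔ MeasurableSpace.comap x mX]

lemma measurable_actionProb (x : Ω → X) (b : Fin K) :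
    Measurable[m ⊔ MeasurableSpace.comap x mX] (actionProb m μ x A b) :=
  stronglyMeasurable_condExp.measurable

lemma IsRound.sup_comap_le (h : IsRound m μ D Z A) :
    m ⊔ MeasurableSpace.comap (fun ω => (Z ω).1) mX ≤ m0 :=
  sup_le h.le (measurable_fst.comp h.measurable_env).comap_le

lemma IsRound.sup_comap_le' (h : IsRound m μ D Z A) :
    m ⊔ MeasurableSpace.comap Z inferInstance ≤ m0 :=
  sup_le h.le h.measurable_env.comap_le

lemma IsRound.ae_env (h : IsRound m μ D Z A) {P : X × (Fin K → ℝ) → Prop} (hP : ∀ᵐ z ∂D, P z) :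
    ∀ᵐ ω ∂μ, P (Z ω) :=
  ae_of_ae_map h.measurable_env.aemeasurable (h.env_law.symm ▸ hP)

lemma IsRound.integrable_indicator [IsFiniteMeasure μ] (h : IsRound m μ D Z A) (b : Fin K) :
    Integrable ({ω | A ω = b}.indicator fun _ => (1 : ℝ)) μ :=
  (integrable_const _).indicator (h.measurable_action (measurableSet_singleton b))

lemma actionProb_nonneg (x : Ω → X) (b : Fin K) : 0 ≤ᵐ[μ] actionProb m μ x A b :=
  condExp_nonneg (ae_of_all _ fun _ => Set.indicator_nonneg (fun _ _ => zero_le_one) _)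

lemma IsRound.sum_actionProb [IsFiniteMeasure μ] (h : IsRound m μ D Z A) :
    (fun ω => ∑ b, actionProb m μ (fun ω => (Z ω).1) A b ω) =ᵐ[μ] fun _ => 1 := by
  have h1 := condExp_finsetSum (m := m ⊔ MeasurableSpace.comap (fun ω => (Z ω).1) mX)
    (fun b (_ : b ∈ Finset.univ) => h.integrable_indicator b)
  have h2 : (∑ b, {ω | A ω = b}.indicator fun _ => (1 : ℝ)) = fun _ => 1 := by
    funext ω
    rw [Finset.sum_apply, Finset.sum_eq_single (A ω)] <;> simp +contextual [Set.indicator, eq_comm]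
  rw [h2, condExp_const h.sup_comap_le] at h1
  filter_upwards [h1] with ω hω
  rw [hω, Finset.sum_apply]
  rfl

/-- Integrating out the action and the rewards of a round. -/
lemma IsRound.lintegral_mul_eq [IsProbabilityMeasure μ] [IsProbabilityMeasure D]
    (h : IsRound m μ D Z A)
    {Φ : Ω → ℝ≥0∞} (hΦ : Measurable[m ⊔ MeasurableSpace.comap (fun ω => (Z ω).1) mX] Φ)
    {ψ : Fin K → X × (Fin K → ℝ) → ℝ≥0∞} (hψ : ∀ b, Measurable (ψ b)) :
    ∫⁻ ω, Φ ω * ψ (A ω) (Z ω) ∂μ =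
      ∫⁻ ω, Φ ω * ∑ b, ENNReal.ofReal (actionProb m μ (fun ω => (Z ω).1) A b ω) *
        ∫⁻ r, ψ b ((Z ω).1, r) ∂(condDistrib Prod.snd Prod.fst D (Z ω).1) ∂μ := by
  set p := actionProb m μ (fun ω => (Z ω).1) A with hp
  have hΦ0 : Measurable Φ := hΦ.mono h.sup_comap_le le_rfl
  have hZ := h.measurable_env
  have hpm : ∀ b, Measurable (p b) := fun b =>
    (measurable_actionProb _ b).mono h.sup_comap_le le_rfl
  have hκ : ∀ b, Measurable fun ω =>
      ∫⁻ r, ψ b ((Z ω).1, r) ∂(condDistrib Prod.snd Prod.fst D (Z ω).1) := fun b =>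
    ((hψ b).lintegral_kernel_prod_right' (κ := condDistrib Prod.snd Prod.fst D)).comp
      (measurable_fst.comp hZ)
  have hind : ∀ b, Measurable ({ω | A ω = b}.indicator fun _ => (1 : ℝ)) := fun b =>
    measurable_const.indicator (h.measurable_action (measurableSet_singleton b))
  have hsplit : ∀ ω, Φ ω * ψ (A ω) (Z ω) =
      ∑ b, Φ ω * ψ b (Z ω) * ENNReal.ofReal ({ω | A ω = b}.indicator (fun _ => (1 : ℝ)) ω) := by
    intro ω
    rw [Finset.sum_eq_single (A ω)] <;> simp +contextual [Set.indicator, eq_comm]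
  calc ∫⁻ ω, Φ ω * ψ (A ω) (Z ω) ∂μ
      = ∑ b, ∫⁻ ω, Φ ω * ψ b (Z ω) *
          ENNReal.ofReal ({ω | A ω = b}.indicator (fun _ => (1 : ℝ)) ω) ∂μ := by
        simp_rw [hsplit]
        exact lintegral_finsetSum _ fun b _ =>
          (hΦ0.mul ((hψ b).comp hZ)).mul (hind b).ennreal_ofReal
    _ = ∑ b, ∫⁻ ω, Φ ω * (ENNReal.ofReal (p b ω) *
          ∫⁻ r, ψ b ((Z ω).1, r) ∂(condDistrib Prod.snd Prod.fst D (Z ω).1)) ∂μ := by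
        refine Finset.sum_congr rfl fun b _ => ?_
        have hZm : Measurable[m ⊔ MeasurableSpace.comap Z inferInstance] Z :=
          (comap_measurable Z).mono le_sup_right le_rfl
        have hle : m ⊔ MeasurableSpace.comap (fun ω => (Z ω).1) mX ≤
            m ⊔ MeasurableSpace.comap Z inferInstance := by
          refine sup_le_sup le_rfl ?_
          rintro _ ⟨s, hs, rfl⟩
          exact ⟨Prod.fst ⁻¹' s, measurable_fst hs, rfl⟩
        -- The order matters: the action indicator is first replaced by its conditional probability
        -- given the past and the full pair `Z`. By `action_law` this probability involves only the
        -- context, so it can join `Φ` when the rewards are integrated out.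
        refine (lintegral_mul_ofReal_condExp h.sup_comap_le' (h.integrable_indicator b)
          (ae_of_all _ fun _ => Set.indicator_nonneg (fun _ _ => zero_le_one) _)
          ((hΦ.mono hle le_rfl).mul ((hψ b).comp hZm))).symm.trans ?_
        calc _ = ∫⁻ ω, (Φ ω * ENNReal.ofReal (p b ω)) * ψ b (Z ω) ∂μ := by
              refine lintegral_congr_ae ?_
              filter_upwards [h.action_law b] with ω hω
              rw [hω, hp, actionProb]
              simp only [Pi.mul_apply, Function.comp_apply]
              ring
          _ = _ := by
              refine (lintegral_mul_indep_prod' h.le hZ h.env_law h.env_indep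
                (hΦ.mul (measurable_actionProb _ b).ennreal_ofReal) (hψ b)).trans ?_
              simp only [Pi.mul_apply, mul_assoc, hp]
    _ = _ := by
        simp_rw [Finset.mul_sum]
        exact (lintegral_finsetSum _ fun b _ =>
          hΦ0.mul ((hpm b).ennreal_ofReal.mul (hκ b))).symm

end Round

/-! ### One-step exponential inequalities -/

/-- Hoeffding's lemma, in the extended nonnegative form used by the one-step estimates. -/
lemma lintegral_exp_centered_le {S : Type*} [MeasurableSpace S] {ρ : Measure S}
    [IsProbabilityMeasure ρ] {Y : S → ℝ} {l u : ℝ} (hY : AEMeasurable Y ρ)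
    (hb : ∀ᵐ s ∂ρ, Y s ∈ Set.Icc l u) (t : ℝ) :
    ∫⁻ s, ENNReal.ofReal (Real.exp (t * (Y s - ∫ s, Y s ∂ρ))) ∂ρ ≤
      ENNReal.ofReal (Real.exp ((u - l) ^ 2 * t ^ 2 / 8)) := by
  have h := hasSubgaussianMGF_of_mem_Icc hY hb
  rw [← ofReal_integral_eq_lintegral_ofReal (h.integrable_exp_mul t)
    (ae_of_all _ fun _ => (Real.exp_pos _).le)]
  refine ENNReal.ofReal_le_ofReal ((h.mgf_le t).trans (Real.exp_le_exp.2 (le_of_eq ?_)))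
  simp only [NNReal.coe_pow, NNReal.coe_div, coe_nnnorm, NNReal.coe_ofNat, Real.norm_eq_abs,
      div_pow, sq_abs]
  ring

/-! ### The conditional law of the rewards given the context. -/

section Kernel

variable {X : Type*} [MeasurableSpace X] {K : ℕ} {D : Measure (X × (Fin K → ℝ))}
  [IsProbabilityMeasure D] {F : Set (Predictor X K)} {fstar : Predictor X K}

lemma ae_condDistrib_mem_Icc (h : HasUnitRewards D) :
    ∀ᵐ p ∂D, ∀ᵐ r ∂(condDistrib Prod.snd Prod.fst D p.1), ∀ b, r b ∈ Set.Icc (0 : ℝ) 1 := by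
  have hdis : (D.map Prod.fst) ⊗ₘ condDistrib (Prod.snd : X × (Fin K → ℝ) → _) Prod.fst D = D := by
    have := compProd_map_condDistrib (mβ := inferInstance) (X := (Prod.fst : X × (Fin K → ℝ) → X))
      (Y := Prod.snd) (μ := D) measurable_snd.aemeasurable
    simpa using this
  have h' : ∀ᵐ p ∂((D.map Prod.fst) ⊗ₘ
      condDistrib (Prod.snd : X × (Fin K → ℝ) → _) Prod.fst D), ∀ b, p.2 b ∈ Set.Icc (0 : ℝ) 1 := by
    rw [hdis]; exact h
  exact ae_of_ae_map measurable_fst.aemeasurable (Measure.ae_ae_of_ae_compProd h')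

/-- Transfers realizability from conditional expectations to the regular conditional law, against
which the exponential moments are computed. -/
lemma ae_integral_condDistrib (h : HasUnitRewards D) (hr : IsRealizedBy D F fstar) :
    ∀ᵐ p ∂D, ∀ b, ∫ r, r b ∂(condDistrib Prod.snd Prod.fst D p.1) = fstar p.1 b := by
  rw [ae_all_iff]
  intro b
  have hint : Integrable (fun p : X × (Fin K → ℝ) => p.2 b) D :=
    Integrable.of_mem_Icc 0 1 (by fun_prop) (h.mono fun p hp => hp b)
  filter_upwards [hr.2 b, condExp_ae_eq_integral_condDistrib (X := Prod.fst) (Y := Prod.snd)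
    measurable_fst measurable_snd.aemeasurable (f := fun r : Fin K → ℝ => r b)
    (measurable_pi_apply b).stronglyMeasurable hint] with p h1 h2
  rw [← h2, ← h1]

/-- The excess loss equals `(v - f)² - 2 (v - f) (r - f)` with `f = fstar p.1 b`. Hoeffding's lemma
at `t = 2 (v - f)` costs `(v - f)² / 2`, half of the quadratic gain. The null set is chosen before
`v`, so `v` may later be a value depending on the context. -/
lemma ae_lintegral_exp_excess_le (h : HasUnitRewards D) (hr : IsRealizedBy D F fstar) :
    ∀ᵐ p ∂D, ∀ b (v : ℝ), ∫⁻ r, ENNReal.ofReal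
        (Real.exp (-((v - r b) ^ 2 - (fstar p.1 b - r b) ^ 2)))
          ∂(condDistrib Prod.snd Prod.fst D p.1) ≤
      ENNReal.ofReal (Real.exp (-(v - fstar p.1 b) ^ 2 / 2)) := by
  filter_upwards [ae_condDistrib_mem_Icc h, ae_integral_condDistrib h hr] with p h1 h2 b v
  have h3 := lintegral_exp_centered_le (ρ := condDistrib Prod.snd Prod.fst D p.1)
    (measurable_pi_apply b).aemeasurable (h1.mono fun r hr => hr b) (2 * (v - fstar p.1 b))
  rw [h2 b] at h3
  calc _ = ∫⁻ r, ENNReal.ofReal (Real.exp (-(v - fstar p.1 b) ^ 2)) * ENNReal.ofReal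
        (Real.exp (2 * (v - fstar p.1 b) * (r b - fstar p.1 b)))
          ∂(condDistrib Prod.snd Prod.fst D p.1) := by
        refine lintegral_congr fun r => ?_
        rw [← ENNReal.ofReal_mul (Real.exp_pos _).le, ← Real.exp_add]
        ring_nf
    _ ≤ ENNReal.ofReal (Real.exp (-(v - fstar p.1 b) ^ 2)) *
        ENNReal.ofReal (Real.exp ((1 - 0) ^ 2 * (2 * (v - fstar p.1 b)) ^ 2 / 8)) := by
        rw [lintegral_const_mul _ (by fun_prop)]
        gcongr
    _ = _ := by
        rw [← ENNReal.ofReal_mul (Real.exp_pos _).le, ← Real.exp_add]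
        ring_nf

/-- A difference of two rewards lies in an interval of length 2, so Hoeffding's lemma costs exactly
`t² / 2`. -/
lemma ae_lintegral_exp_gap_le (h : HasUnitRewards D) (hr : IsRealizedBy D F fstar) (t : ℝ) :
    ∀ᵐ p ∂D, ∀ b c, ∫⁻ r, ENNReal.ofReal
        (Real.exp (t * (r c - r b - (fstar p.1 c - fstar p.1 b)) - t ^ 2 / 2))
          ∂(condDistrib Prod.snd Prod.fst D p.1) ≤ 1 := by
  filter_upwards [ae_condDistrib_mem_Icc h, ae_integral_condDistrib h hr] with p h1 h2 b c
  have hi : ∀ b, Integrable (fun r : Fin K → ℝ => r b) (condDistrib Prod.snd Prod.fst D p.1) :=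
    fun b => Integrable.of_mem_Icc 0 1 (measurable_pi_apply b).aemeasurable
        (h1.mono fun r hr => hr b)
  have h3 := lintegral_exp_centered_le (ρ := condDistrib Prod.snd Prod.fst D p.1)
    (Y := fun r => r c - r b) (l := -1) (u := 1)
    ((measurable_pi_apply c).sub (measurable_pi_apply b)).aemeasurable
    (h1.mono fun r hr => ⟨by linarith [(hr b).2, (hr c).1], by linarith [(hr b).1, (hr c).2]⟩) t
  rw [integral_sub (hi c) (hi b), h2 b, h2 c] at h3
  calc _ = ∫⁻ r, ENNReal.ofReal (Real.exp (-(t ^ 2 / 2))) * ENNReal.ofReal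
        (Real.exp (t * (r c - r b - (fstar p.1 c - fstar p.1 b))))
          ∂(condDistrib Prod.snd Prod.fst D p.1) := by
        refine lintegral_congr fun r => ?_
        rw [← ENNReal.ofReal_mul (Real.exp_pos _).le, ← Real.exp_add]
        ring_nf
    _ ≤ ENNReal.ofReal (Real.exp (-(t ^ 2 / 2))) *
        ENNReal.ofReal (Real.exp ((1 - -1) ^ 2 * t ^ 2 / 8)) := by
        rw [lintegral_const_mul _ (by fun_prop)]
        gcongr
    _ = 1 := by
        rw [← ENNReal.ofReal_mul (Real.exp_pos _).le, ← Real.exp_add]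
        ring_nf
        simp

end Kernel

/-- A chord bound that allows averaging over the action: Jensen's inequality for the exponential
goes the wrong way, while a linear bound can be averaged and returned to an exponential by `1 - q/4
≤ exp (-q/4)`. This costs the factor between 1/2 and 1/4. -/
lemma exp_neg_half_le {u : ℝ} (h0 : 0 ≤ u) (h1 : u ≤ 1) : Real.exp (-u / 2) ≤ 1 - u / 4 := by
  have h := Real.exp_bound' (x := u / 2) (by linarith) (by linarith) (n := 1) (by norm_num)
  have h2 : 1 + u / 2 ≤ Real.exp (u / 2) := by linarith [Real.add_one_le_exp (u / 2)]
  rw [neg_div, Real.exp_neg, inv_le_iff_one_le_mul₀ (Real.exp_pos _)]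
  nlinarith

/-! ### One-step inequalities for the losses, the regret and the mean rewards. -/

section Round

variable {Ω X : Type*} {m m0 : MeasurableSpace Ω} [mX : MeasurableSpace X] {K : ℕ}
  {μ : Measure Ω} {D : Measure (X × (Fin K → ℝ))} {F : Set (Predictor X K)}
  {fstar : Predictor X K} {Z : Ω → X × (Fin K → ℝ)} {A : Ω → Fin K}

/-- The excess square loss of `v` over `fstar` in a round. -/
def excess (fstar v : Predictor X K) (z : X × (Fin K → ℝ)) (b : Fin K) : ℝ :=
  (v z.1 b - z.2 b) ^ 2 - (fstar z.1 b - z.2 b) ^ 2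

/-- The conditional mean of `(v - fstar)²` at the action of a round. -/
def condError (m : MeasurableSpace Ω) {m0 : MeasurableSpace Ω} (μ : Measure Ω)
    (fstar v : Predictor X K) (x : Ω → X) (A : Ω → Fin K) (ω : Ω) : ℝ :=
  ∑ b, actionProb m μ x A b ω * (v (x ω) b - fstar (x ω) b) ^ 2

lemma measurable_condError {fstar v : Predictor X K} (hf : ∀ b, Measurable fun x => fstar x b)
    (hv : ∀ b, Measurable fun x => v x b) (x : Ω → X) :
    Measurable[m ⊔ MeasurableSpace.comap x mX] (condError m μ fstar v x A) := by
  have hx : Measurable[m ⊔ MeasurableSpace.comap x mX] x :=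
    (comap_measurable x).mono le_sup_right le_rfl
  unfold condError
  refine Finset.measurable_fun_sum _ fun b _ => (measurable_actionProb x b).mul ?_
  exact (((hv b).comp hx).sub ((hf b).comp hx)).pow_const 2

variable [IsProbabilityMeasure μ] [IsProbabilityMeasure D]

/-- The supermartingale step. The compensator is the error averaged over the action law, not the
error at the drawn action; only the averaged error can later be compared with the explored error.
The weight `Φ` encodes conditioning on the past and the context. -/
lemma IsRound.lintegral_exp_excess_le (h : IsRound m μ D Z A) (hu : HasUnitRewards D)
    (hr : IsRealizedBy D F fstar) (hF : IsPredictorClass F)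
    {v : Predictor X K} (hv : ∀ b, Measurable fun x => v x b)
    (hv1 : ∀ x b, v x b ∈ Set.Icc (0 : ℝ) 1)
    {Φ : Ω → ℝ≥0∞} (hΦ : Measurable[m ⊔ MeasurableSpace.comap (fun ω => (Z ω).1) mX] Φ) :
    ∫⁻ ω, Φ ω * ENNReal.ofReal (Real.exp (-excess fstar v (Z ω) (A ω) +
        condError m μ fstar v (fun ω => (Z ω).1) A ω / 4)) ∂μ ≤ ∫⁻ ω, Φ ω ∂μ := by
  have hf : ∀ b, Measurable fun x => fstar x b := fun b => (hF _ hr.1 b).1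
  have hf1 : ∀ x b, fstar x b ∈ Set.Icc (0 : ℝ) 1 := fun x b => (hF _ hr.1 b).2 x
  set q := condError m μ fstar v (fun ω => (Z ω).1) A with hq
  have hqm : Measurable[m ⊔ MeasurableSpace.comap (fun ω => (Z ω).1) mX]
      fun ω => ENNReal.ofReal (Real.exp (q ω / 4)) :=
    (Real.measurable_exp.comp ((measurable_condError hf hv _).div_const 4)).ennreal_ofReal
  calc _ = ∫⁻ ω, (Φ ω * ENNReal.ofReal (Real.exp (q ω / 4))) *
        (fun b z => ENNReal.ofReal (Real.exp (-excess fstar v z b))) (A ω) (Z ω) ∂μ := by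
        refine lintegral_congr fun ω => ?_
        rw [mul_assoc, ← ENNReal.ofReal_mul (Real.exp_pos _).le, ← Real.exp_add, add_comm]
    _ = _ := h.lintegral_mul_eq (hΦ.mul hqm) (ψ := fun b z => ENNReal.ofReal
        (Real.exp (-excess fstar v z b))) (fun b => by
          have h1 := (hv b).comp (measurable_fst : Measurable (Prod.fst : X × (Fin K → ℝ) → X))
          have h2 := (hf b).comp (measurable_fst : Measurable (Prod.fst : X × (Fin K → ℝ) → X))
          have h3 : Measurable fun z : X × (Fin K → ℝ) => z.2 b := by fun_prop
          exact (Real.measurable_exp.comp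
            (((h1.sub h3).pow_const 2).sub ((h2.sub h3).pow_const 2)).neg).ennreal_ofReal)
    _ ≤ ∫⁻ ω, Φ ω ∂μ := by
        refine lintegral_mono_ae ?_
        have hz := ae_lintegral_exp_excess_le hu hr
        filter_upwards [h.ae_env hz, h.sum_actionProb, ae_all_iff.2 fun b => actionProb_nonneg
            (m := m)
          (μ := μ) (A := A) (fun ω => (Z ω).1) b] with ω h1 h2 h3
        set p := fun b => actionProb m μ (fun ω => (Z ω).1) A b ω with hp
        change ∑ b, p b = 1 at h2
        change ∀ b, 0 ≤ p b at h3
        have hd : ∀ b, (v (Z ω).1 b - fstar (Z ω).1 b) ^ 2 ≤ 1 := fun b => by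
          have a1 := hv1 (Z ω).1 b
          have a2 := hf1 (Z ω).1 b
          nlinarith [a1.1, a1.2, a2.1, a2.2]
        have key : ∑ b, p b * Real.exp (-(v (Z ω).1 b - fstar (Z ω).1 b) ^ 2 / 2) ≤
            Real.exp (-(q ω / 4)) := by
          calc _ ≤ ∑ b, p b * (1 - (v (Z ω).1 b - fstar (Z ω).1 b) ^ 2 / 4) :=
                Finset.sum_le_sum fun b _ => mul_le_mul_of_nonneg_left
                  (exp_neg_half_le (sq_nonneg _) (hd b)) (h3 b)
            _ = 1 - q ω / 4 := by
                simp only [mul_sub, mul_one, Finset.sum_sub_distrib, h2, hq, condError]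
                rw [Finset.sum_div]
                simp only [mul_div_assoc, hp]
            _ ≤ _ := by linarith [Real.add_one_le_exp (-(q ω / 4))]
        have hs : ∑ b, ENNReal.ofReal (p b) * ∫⁻ r, ENNReal.ofReal (Real.exp
              (-excess fstar v ((Z ω).1, r) b)) ∂(condDistrib Prod.snd Prod.fst D (Z ω).1) ≤
            ∑ b, ENNReal.ofReal (p b) *
              ENNReal.ofReal (Real.exp (-(v (Z ω).1 b - fstar (Z ω).1 b) ^ 2 / 2)) := by
          refine Finset.sum_le_sum fun b _ => ?_
          exact mul_le_mul' le_rfl (h1 b (v (Z ω).1 b))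
        calc _ ≤ Φ ω * ENNReal.ofReal (Real.exp (q ω / 4)) * ∑ b, ENNReal.ofReal (p b) *
              ENNReal.ofReal (Real.exp (-(v (Z ω).1 b - fstar (Z ω).1 b) ^ 2 / 2)) := by
              exact mul_le_mul' le_rfl hs
          _ = Φ ω * (ENNReal.ofReal (Real.exp (q ω / 4)) * ENNReal.ofReal
              (∑ b, p b * Real.exp (-(v (Z ω).1 b - fstar (Z ω).1 b) ^ 2 / 2))) := by
              rw [ENNReal.ofReal_sum_of_nonneg fun b _ => mul_nonneg (h3 b) (Real.exp_pos _).le,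
                mul_assoc]
              simp_rw [ENNReal.ofReal_mul (h3 _)]
          _ ≤ Φ ω * 1 := by
              gcongr
              rw [← ENNReal.ofReal_mul (Real.exp_pos _).le, ENNReal.ofReal_le_one]
              calc _ ≤ Real.exp (q ω / 4) * Real.exp (-(q ω / 4)) := by gcongr
                _ = 1 := by rw [← Real.exp_add]; simp
          _ = Φ ω := mul_one _

/-- The regret of a round against its conditional mean. -/
lemma IsRound.lintegral_exp_gap_le (h : IsRound m μ D Z A) (hu : HasUnitRewards D)
    (hr : IsRealizedBy D F fstar) (hF : IsPredictorClass F) {π : X → Fin K} (hπ : Measurable π)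
    (t : ℝ)
    {Φ : Ω → ℝ≥0∞} (hΦ : Measurable[m ⊔ MeasurableSpace.comap (fun ω => (Z ω).1) mX] Φ) :
    ∫⁻ ω, Φ ω * ENNReal.ofReal (Real.exp (t * ((Z ω).2 (π (Z ω).1) - (Z ω).2 (A ω) -
        (fstar (Z ω).1 (π (Z ω).1) - fstar (Z ω).1 (A ω))) - t ^ 2 / 2)) ∂μ ≤ ∫⁻ ω, Φ ω ∂μ := by
  have hf : Measurable fun p : X × Fin K => fstar p.1 p.2 :=
    measurable_from_prod_countable_left fun b => (hF _ hr.1 b).1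
  have hev : Measurable fun p : (Fin K → ℝ) × Fin K => p.1 p.2 :=
    measurable_from_prod_countable_left fun b => measurable_pi_apply b
  calc _ = _ := h.lintegral_mul_eq hΦ (ψ := fun b z => ENNReal.ofReal (Real.exp
        (t * (z.2 (π z.1) - z.2 b - (fstar z.1 (π z.1) - fstar z.1 b)) - t ^ 2 / 2)))
        (fun b => by
          have h1 : Measurable fun z : X × (Fin K → ℝ) => z.2 (π z.1) :=
            hev.comp (measurable_snd.prodMk (hπ.comp measurable_fst))
          have h2 : Measurable fun z : X × (Fin K → ℝ) => fstar z.1 (π z.1) :=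
            hf.comp (measurable_fst.prodMk (hπ.comp measurable_fst))
          have h3 : Measurable fun z : X × (Fin K → ℝ) => z.2 b := by fun_prop
          have h4 := (hF _ hr.1 b).1.comp (measurable_fst : Measurable (Prod.fst : X ×
              (Fin K → ℝ) → X))
          exact (Real.measurable_exp.comp ((((h1.sub h3).sub (h2.sub h4)).const_mul t).sub_const
            _)).ennreal_ofReal)
    _ ≤ ∫⁻ ω, Φ ω ∂μ := by
        refine lintegral_mono_ae ?_
        have hz := ae_lintegral_exp_gap_le hu hr t
        filter_upwards [h.ae_env hz, h.sum_actionProb, ae_all_iff.2 fun b => actionProb_nonneg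
            (m := m)
          (μ := μ) (A := A) (fun ω => (Z ω).1) b] with ω h1 h2 h3
        calc _ ≤ Φ ω * ∑ b, ENNReal.ofReal (actionProb m μ (fun ω => (Z ω).1) A b ω) * 1 := by
              gcongr with b
              exact h1 b _
          _ = Φ ω := by
              simp_rw [mul_one]
              rw [← ENNReal.ofReal_sum_of_nonneg fun b _ => h3 b, h2]
              simp

/-- The mean reward of the chosen action. -/
lemma IsRound.lintegral_reward_eq (h : IsRound m μ D Z A) (hu : HasUnitRewards D)
    (hr : IsRealizedBy D F fstar) (hF : IsPredictorClass F) :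
    ∫⁻ ω, ENNReal.ofReal ((Z ω).2 (A ω)) ∂μ = ∫⁻ ω, ENNReal.ofReal (fstar (Z ω).1 (A ω)) ∂μ := by
  have h1 := h.lintegral_mul_eq (Φ := fun _ => 1) measurable_const
    (ψ := fun b z => ENNReal.ofReal (z.2 b)) (fun b => by fun_prop)
  have h2 := h.lintegral_mul_eq (Φ := fun _ => 1) measurable_const
    (ψ := fun b z => ENNReal.ofReal (fstar z.1 b))
    (fun b => ((hF _ hr.1 b).1.comp measurable_fst).ennreal_ofReal)
  simp only [one_mul] at h1 h2
  rw [h1, h2]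
  refine lintegral_congr_ae ?_
  have hz := (ae_condDistrib_mem_Icc hu).and (ae_integral_condDistrib hu hr)
  filter_upwards [h.ae_env hz] with ω hω
  refine Finset.sum_congr rfl fun b _ => ?_
  rw [← ofReal_integral_eq_lintegral_ofReal
    (Integrable.of_mem_Icc 0 1 (measurable_pi_apply _).aemeasurable (hω.1.mono fun r hr => hr b))
    (hω.1.mono fun r hr => (hr b).1), hω.2 b]
  simp

/-- The policy `π` collects the mean reward `fstar(x, π(x))`. -/
lemma IsRound.lintegral_reward_policy_eq (h : IsRound m μ D Z A) (hu : HasUnitRewards D)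
    (hr : IsRealizedBy D F fstar) (hF : IsPredictorClass F) {π : X → Fin K} (hπ : Measurable π) :
    ∫⁻ ω, ENNReal.ofReal ((Z ω).2 (π (Z ω).1)) ∂μ =
      ∫⁻ ω, ENNReal.ofReal (fstar (Z ω).1 (π (Z ω).1)) ∂μ := by
  have hf : Measurable fun p : X × Fin K => fstar p.1 p.2 :=
    measurable_from_prod_countable_left fun b => (hF _ hr.1 b).1
  have hev : Measurable fun p : (Fin K → ℝ) × Fin K => p.1 p.2 :=
    measurable_from_prod_countable_left fun b => measurable_pi_apply b
  have h1 := lintegral_mul_indep_prod' h.le h.measurable_env h.env_law h.env_indep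
    (Φ := fun _ => 1) measurable_const (ψ := fun z => ENNReal.ofReal (z.2 (π z.1)))
    (hev.comp (measurable_snd.prodMk (hπ.comp measurable_fst))).ennreal_ofReal
  simp only [one_mul] at h1
  rw [h1]
  refine lintegral_congr_ae ?_
  have hz := (ae_condDistrib_mem_Icc hu).and (ae_integral_condDistrib hu hr)
  filter_upwards [h.ae_env hz] with ω hω
  rw [← ofReal_integral_eq_lintegral_ofReal
    (Integrable.of_mem_Icc 0 1 (measurable_pi_apply _).aemeasurable (hω.1.mono fun r hr => hr _))
    (hω.1.mono fun r hr => (hr _).1), hω.2]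

end Round

/-! ### Exponential supermartingales given the whole context sequence -/

/-- A context sequence `x₁, …, x_T` of law `ν`, each independent of the past `hist`. -/
structure IsIidContexts {Ω X : Type*} [m0 : MeasurableSpace Ω] [mX : MeasurableSpace X]
    (μ : Measure Ω) (ν : Measure X) (T : ℕ) (hist : ℕ → MeasurableSpace Ω) (x : ℕ → Ω → X) :
    Prop where
  measurable : ∀ n, Measurable (x n)
  mono : Monotone hist
  le : ∀ n, hist n ≤ m0
  comap_le : ∀ n, 1 ≤ n → MeasurableSpace.comap (x n) mX ≤ hist (n + 1)
  law : ∀ n ∈ Set.Icc 1 T, μ.map (x n) = ν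
  indep : ∀ n ∈ Set.Icc 1 T, Indep (hist n) (MeasurableSpace.comap (x n) mX) μ

section ContextProcess

/-- The contexts of the first `n` rounds, padded with `x₀`. -/
def contextPrefix {Ω X : Type*} (x : ℕ → Ω → X) (x₀ : X) (n : ℕ) (ω : Ω) : ℕ → X :=
  fun s => if s ∈ Finset.Icc 1 n then x s ω else x₀

lemma contextPrefix_succ {Ω X : Type*} (x : ℕ → Ω → X) (x₀ : X) (n : ℕ) (ω : Ω) :
    contextPrefix x x₀ (n + 1) ω =
      Function.update (contextPrefix x x₀ n ω) (n + 1) (x (n + 1) ω) := by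
  funext s
  by_cases hs : s = n + 1
  · subst hs; simp [contextPrefix]
  · have : s ≤ n + 1 ↔ s ≤ n := by omega
    simp [contextPrefix, hs, this]

variable {Ω X : Type*} [m0 : MeasurableSpace Ω] [mX : MeasurableSpace X]
  {μ : Measure Ω} {ν : Measure X} {T : ℕ} {hist : ℕ → MeasurableSpace Ω} {x : ℕ → Ω → X}

lemma IsIidContexts.measurable_contextPrefix (h : IsIidContexts μ ν T hist x) (x₀ : X)
    (n : ℕ) : Measurable[hist (n + 1)] (contextPrefix x x₀ n) := by
  refine @measurable_pi_lambda _ _ _ (hist (n + 1)) _ _ fun s => ?_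
  by_cases hs : s ∈ Finset.Icc 1 n
  · simp only [contextPrefix, hs, if_true]
    rw [Finset.mem_Icc] at hs
    exact (comap_measurable (x s)).mono
      ((h.comap_le s hs.1).trans (h.mono (Nat.succ_le_succ hs.2))) le_rfl
  · simp only [contextPrefix, hs, if_false]
    exact measurable_const

/-- If `W_n` has conditional mean at most `1` given the past and the context of round `n`, then
`∏ W_n` has conditional mean at most `1` given all contexts. -/
lemma IsIidContexts.lintegral_prod_le [IsProbabilityMeasure μ] [IsProbabilityMeasure ν]
    (h : IsIidContexts μ ν T hist x) {W : ℕ → Ω → ℝ≥0∞}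
    (hW : ∀ n ∈ Set.Icc 1 T, Measurable[hist (n + 1)] (W n))
    (hstep : ∀ n ∈ Set.Icc 1 T, ∀ Φ : Ω → ℝ≥0∞,
      Measurable[hist n ⊔ MeasurableSpace.comap (x n) mX] Φ →
        ∫⁻ ω, Φ ω * W n ω ∂μ ≤ ∫⁻ ω, Φ ω ∂μ) (x₀ : X) {n : ℕ} (hn : n ≤ T)
    {g : (ℕ → X) → ℝ≥0∞} (hg : Measurable g) :
    ∫⁻ ω, g (contextPrefix x x₀ n ω) * ∏ s ∈ Finset.Icc 1 n, W s ω ∂μ ≤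
      ∫⁻ ω, g (contextPrefix x x₀ n ω) ∂μ := by
  induction n generalizing g with
  | zero => simp
  | succ n ih =>
    have hmem : n + 1 ∈ Set.Icc 1 T := ⟨by omega, hn⟩
    have hP : Measurable[hist (n + 1)] fun ω => ∏ s ∈ Finset.Icc 1 n, W s ω := by
      refine @Finset.measurable_fun_prod _ _ _ _ _ _ (hist (n + 1)) _ _ fun s hs => ?_
      rw [Finset.mem_Icc] at hs
      exact (hW s ⟨hs.1, by omega⟩).mono (h.mono (by omega)) le_rfl
    have hpre := h.measurable_contextPrefix x₀ n
    have hupd : Measurable fun p : (ℕ → X) × X => Function.update p.1 (n + 1) p.2 := by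
      refine measurable_pi_lambda _ fun s => ?_
      by_cases hs : s = n + 1
      · subst hs; simpa using measurable_snd
      · simp only [Function.update_of_ne hs]
        exact (measurable_pi_apply s).comp measurable_fst
    have hΦ : Measurable[hist (n + 1) ⊔ MeasurableSpace.comap (x (n + 1)) mX]
        fun ω => g (contextPrefix x x₀ (n + 1) ω) * ∏ s ∈ Finset.Icc 1 n, W s ω := by
      refine Measurable.mul ?_ (hP.mono le_sup_left le_rfl)
      simp_rw [contextPrefix_succ]
      have hxn : Measurable[hist (n + 1) ⊔ MeasurableSpace.comap (x (n + 1)) mX] (x (n + 1)) :=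
        Measurable.mono (comap_measurable (x (n + 1))) le_sup_right le_rfl
      have hpre' : Measurable[hist (n + 1) ⊔ MeasurableSpace.comap (x (n + 1)) mX]
          (contextPrefix x x₀ n) := hpre.mono le_sup_left le_rfl
      exact hg.comp (hupd.comp (hpre'.prodMk hxn))
    -- The newest context is independent of everything before it, including earlier rewards and
    -- actions, so it can be averaged out of `g` alone. This is used with `w` the product of earlier
    -- factors, and then with `w = 1` to undo the averaging.
    have hind : ∀ w : Ω → ℝ≥0∞, Measurable[hist (n + 1)] w →
        ∫⁻ ω, g (contextPrefix x x₀ (n + 1) ω) * w ω ∂μ =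
          ∫⁻ ω, (∫⁻ z, g (Function.update (contextPrefix x x₀ n ω) (n + 1) z) ∂ν) * w ω ∂μ := by
      intro w hw
      have hH : Measurable[hist (n + 1)] fun ω => (contextPrefix x x₀ n ω, w ω) :=
        hpre.prodMk hw
      have hi : IndepFun (fun ω => (contextPrefix x x₀ n ω, w ω)) (x (n + 1)) μ := by
        rw [IndepFun_iff_Indep]
        exact indep_of_indep_of_le_left (h.indep _ hmem) hH.comap_le
      have hH0 := hH.mono (h.le _) le_rfl
      have hlaw := (indepFun_iff_map_prod_eq_prod_map_map hH0.aemeasurable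
        (h.measurable (n + 1)).aemeasurable).1 hi
      rw [h.law _ hmem] at hlaw
      have hG : Measurable fun p : ((ℕ → X) × ℝ≥0∞) × X =>
          g (Function.update p.1.1 (n + 1) p.2) * p.1.2 :=
        (hg.comp (hupd.comp ((measurable_fst.comp measurable_fst).prodMk measurable_snd))).mul
          (measurable_snd.comp measurable_fst)
      have e1 : ∫⁻ ω, g (contextPrefix x x₀ (n + 1) ω) * w ω ∂μ =
          ∫⁻ p, g (Function.update p.1.1 (n + 1) p.2) * p.1.2
            ∂(μ.map fun ω => ((contextPrefix x x₀ n ω, w ω), x (n + 1) ω)) := by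
        rw [lintegral_map hG (hH0.prodMk (h.measurable _))]
        simp_rw [contextPrefix_succ]
      rw [e1, hlaw, lintegral_prod _ hG.aemeasurable, lintegral_map hG.lintegral_prod_right' hH0]
      refine lintegral_congr fun ω => ?_
      exact lintegral_mul_const _ (hg.comp (hupd.comp measurable_prodMk_left))
    have hg' : Measurable fun y : ℕ → X => ∫⁻ z, g (Function.update y (n + 1) z) ∂ν :=
      (hg.comp hupd).lintegral_prod_right'
    calc _ = ∫⁻ ω, (g (contextPrefix x x₀ (n + 1) ω) * ∏ s ∈ Finset.Icc 1 n, W s ω) *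
          W (n + 1) ω ∂μ := by
          refine lintegral_congr fun ω => ?_
          rw [← Finset.insert_Icc_right_eq_Icc_add_one (by omega), Finset.prod_insert (by simp)]
          ring
      _ ≤ _ := hstep _ hmem _ hΦ
      _ = _ := hind _ hP
      _ ≤ _ := ih (by omega) hg'
      _ = _ := by
          have := hind (fun _ => 1) measurable_const
          simpa using this.symm

/-- The contexts are independent and identically distributed. -/
lemma IsIidContexts.map_eq_pi [IsProbabilityMeasure μ] [IsProbabilityMeasure ν]
    (h : IsIidContexts μ ν T hist x) :
    μ.map (fun ω (t : Fin T) => x (t + 1) ω) = Measure.pi fun _ => ν := by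
  have key : ∀ B : ℕ → Set X, (∀ s, MeasurableSet (B s)) → ∀ n ≤ T,
      μ (⋂ s ∈ Finset.range n, x (s + 1) ⁻¹' B s) = ∏ s ∈ Finset.range n, ν (B s) := by
    intro B hB n
    induction n with
    | zero => simp
    | succ n ih =>
      intro hn
      have hmem : n + 1 ∈ Set.Icc 1 T := ⟨by omega, hn⟩
      rw [Finset.prod_range_succ, ← ih (by omega), Finset.range_add_one, Finset.set_biInter_insert,
        Set.inter_comm]
      have hA : MeasurableSet[hist (n + 1)] (⋂ s ∈ Finset.range n, x (s + 1) ⁻¹' B s) := by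
        refine @Finset.measurableSet_biInter _ _ (hist (n + 1)) _ _ fun s hs => ?_
        rw [Finset.mem_range] at hs
        exact h.mono (by omega) _ (h.comap_le (s + 1) (by omega) _ ⟨B s, hB s, rfl⟩)
      rw [(Indep_iff _ _ _).1 (h.indep _ hmem) _ _ hA ⟨B n, hB n, rfl⟩, ← h.law _ hmem,
        Measure.map_apply (h.measurable _) (hB n)]
  symm
  refine Measure.pi_eq fun B hB => ?_
  rw [Measure.map_apply (measurable_pi_lambda _ fun t => h.measurable _)
    (MeasurableSet.univ_pi hB)]
  have := key (fun s => if hs : s < T then B ⟨s, hs⟩ else Set.univ)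
    (fun s => by by_cases hs : s < T <;> simp [hs, hB]) T le_rfl
  rw [Finset.prod_range] at this
  simp only [Fin.is_lt, dite_true, Fin.eta] at this
  rw [← this]
  congr 1
  ext ω
  simp only [Set.mem_preimage, Set.mem_pi, Set.mem_univ, true_imp_iff, Set.mem_iInter,
    Finset.mem_range]
  constructor
  · intro hω s hs
    simpa [hs] using hω ⟨s, hs⟩
  · intro hω t
    simpa using hω t t.2

/-- Deviation inequality for `∑ Y_n`, on an event determined by the contexts. -/
lemma IsIidContexts.measure_inter_le [IsProbabilityMeasure μ] [IsProbabilityMeasure ν]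
    (h : IsIidContexts μ ν T hist x) {Y : ℕ → Ω → ℝ}
    (hY : ∀ n ∈ Set.Icc 1 T, Measurable[hist (n + 1)] (Y n))
    (hstep : ∀ n ∈ Set.Icc 1 T, ∀ Φ : Ω → ℝ≥0∞,
      Measurable[hist n ⊔ MeasurableSpace.comap (x n) mX] Φ →
        ∫⁻ ω, Φ ω * ENNReal.ofReal (Real.exp (Y n ω)) ∂μ ≤ ∫⁻ ω, Φ ω ∂μ) {n : ℕ} (hn : n ≤ T)
    {S : Set (Fin T → X)} (hS : MeasurableSet S) (u : ℝ) :
    μ {ω | (fun t : Fin T => x (t + 1) ω) ∈ S ∧ u ≤ ∑ s ∈ Finset.Icc 1 n, Y s ω} ≤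
      ENNReal.ofReal (Real.exp (-u)) * μ {ω | (fun t : Fin T => x (t + 1) ω) ∈ S} := by
  classical
  have hx₀ : Nonempty X := by
    by_contra hX
    rw [not_nonempty_iff] at hX
    exact (IsProbabilityMeasure.ne_zero ν) (Measure.eq_zero_of_isEmpty ν)
  obtain ⟨x₀⟩ := hx₀
  -- The factors are frozen at 1 after round `n`, because `S` involves all `T` contexts even when
  -- the sum stops earlier.
  set W : ℕ → Ω → ℝ≥0∞ := fun s ω => if s ≤ n then ENNReal.ofReal (Real.exp (Y s ω)) else 1 with hW
  have hexp : Measurable fun y : ℝ => ENNReal.ofReal (Real.exp y) :=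
    Real.measurable_exp.ennreal_ofReal
  have hWm : ∀ s ∈ Set.Icc 1 T, Measurable[hist (s + 1)] (W s) := by
    intro s hs
    by_cases hsn : s ≤ n
    · simp only [hW, hsn, if_true]
      exact hexp.comp (hY s hs)
    · simp only [hW, hsn, if_false]
      exact measurable_const
  set g : (ℕ → X) → ℝ≥0∞ := Set.indicator {y | (fun t : Fin T => y (t + 1)) ∈ S} 1 with hg
  have hgm : Measurable g := by
    refine measurable_one.indicator (measurableSet_preimage ?_ hS)
    exact measurable_pi_lambda _ fun t => measurable_pi_apply _
  have hpre : ∀ ω, (fun t : Fin T => contextPrefix x x₀ T ω (t + 1)) =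
      fun t : Fin T => x (t + 1) ω := by
    intro ω; funext t
    have : (t : ℕ) + 1 ≤ T := t.2
    simp [contextPrefix, this]
  have hxm : Measurable fun ω => fun t : Fin T => x (t + 1) ω :=
    measurable_pi_lambda _ fun t => h.measurable _
  have key := h.lintegral_prod_le hWm (fun s hs Φ hΦ => by
    by_cases hsn : s ≤ n
    · simp only [hW, hsn, if_true]
      exact hstep s hs Φ hΦ
    · simp [hW, hsn]) x₀ le_rfl hgm
  have hprod : ∀ ω, ∏ s ∈ Finset.Icc 1 T, W s ω =
      ENNReal.ofReal (Real.exp (∑ s ∈ Finset.Icc 1 n, Y s ω)) := by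
    intro ω
    rw [Real.exp_sum, ENNReal.ofReal_prod_of_nonneg fun _ _ => (Real.exp_pos _).le]
    have hsub : Finset.Icc 1 n ⊆ Finset.Icc 1 T := Finset.Icc_subset_Icc_right hn
    rw [← Finset.prod_subset hsub]
    · refine Finset.prod_congr rfl fun s hs => ?_
      simp [hW, (Finset.mem_Icc.1 hs).2]
    · intro s hs hs'
      rw [Finset.mem_Icc] at hs hs'
      have : ¬ s ≤ n := fun hc => hs' ⟨hs.1, hc⟩
      simp [hW, this]
  have hgω : ∀ ω, g (contextPrefix x x₀ T ω) =
      Set.indicator {ω | (fun t : Fin T => x (t + 1) ω) ∈ S} 1 ω := by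
    intro ω
    simp only [hg, Set.indicator, Set.mem_ofPred_eq, hpre ω, Pi.one_apply]
  simp_rw [hgω, hprod] at key
  have hSm : MeasurableSet {ω | (fun t : Fin T => x (t + 1) ω) ∈ S} := hxm hS
  rw [lintegral_indicator_one hSm] at key
  have hsum : Measurable fun ω => ∑ s ∈ Finset.Icc 1 n, Y s ω := by
    refine Finset.measurable_fun_sum _ fun s hs => ?_
    rw [Finset.mem_Icc] at hs
    exact (hY s ⟨hs.1, hs.2.trans hn⟩).mono (h.le _) le_rfl
  set Q := {ω | (fun t : Fin T => x (t + 1) ω) ∈ S ∧ u ≤ ∑ s ∈ Finset.Icc 1 n, Y s ω}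
  have hQm : MeasurableSet Q := (hxm hS).inter (measurableSet_le measurable_const hsum)
  have hQ : ENNReal.ofReal (Real.exp u) * μ Q ≤
      μ {ω | (fun t : Fin T => x (t + 1) ω) ∈ S} := by
    refine le_trans ?_ key
    rw [← lintegral_indicator_one hQm, ← lintegral_const_mul _ (measurable_one.indicator hQm)]
    refine lintegral_mono fun ω => ?_
    by_cases hω : ω ∈ Q
    · have h1 : ω ∈ {ω | (fun t : Fin T => x (t + 1) ω) ∈ S} := hω.1
      rw [Set.indicator_of_mem hω, Set.indicator_of_mem h1]
      simp only [Pi.one_apply, mul_one, one_mul]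
      exact ENNReal.ofReal_le_ofReal (Real.exp_le_exp.2 hω.2)
    · simp [Set.indicator_of_notMem hω]
  calc μ Q = ENNReal.ofReal (Real.exp (-u)) * (ENNReal.ofReal (Real.exp u) * μ Q) := by
        rw [← mul_assoc, ← ENNReal.ofReal_mul (Real.exp_pos _).le, ← Real.exp_add]
        simp
    _ ≤ _ := by gcongr

end ContextProcess

/-! ### Symmetrization for independent samples -/

section Symmetrization

variable {X : Type*} [MeasurableSpace X] {ν : Measure X} [IsProbabilityMeasure ν] {T n : ℕ}

lemma measurePreserving_pi_comp_perm (e : Equiv.Perm (Fin T)) :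
    MeasurePreserving (fun (z : Fin T → X) t => z (e t)) (Measure.pi fun _ => ν)
      (Measure.pi fun _ => ν) := by
  have hm : Measurable fun (z : Fin T → X) t => z (e t) :=
    measurable_pi_lambda _ fun t => measurable_pi_apply _
  refine ⟨hm, (Measure.pi_eq fun B hB => ?_).symm⟩
  rw [Measure.map_apply hm (MeasurableSet.univ_pi hB)]
  have : (fun (z : Fin T → X) t => z (e t)) ⁻¹' Set.univ.pi B =
      Set.univ.pi fun t => B (e.symm t) := by
    ext z
    simp only [Set.mem_preimage, Set.mem_pi, Set.mem_univ, true_imp_iff]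
    exact ⟨fun h t => by simpa using h (e.symm t), fun h t => by simpa using h (e t)⟩
  rw [this, Measure.pi_pi]
  exact Equiv.prod_comp e.symm fun t => ν (B t)

/-- `z` on the first `n` coordinates, `y` on the others. -/
def splice (n : ℕ) (p : (Fin T → X) × (Fin T → X)) : Fin T → X :=
  fun t => if (t : ℕ) < n then p.1 t else p.2 t

lemma measurePreserving_splice (n : ℕ) :
    MeasurePreserving (splice n) ((Measure.pi fun _ : Fin T => ν).prod
      (Measure.pi fun _ : Fin T => ν)) (Measure.pi fun _ => ν) := by
  have hm : Measurable (splice n : (Fin T → X) × (Fin T → X) → Fin T → X) := by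
    refine measurable_pi_lambda _ fun t => ?_
    by_cases ht : (t : ℕ) < n
    · simp only [splice, ht, if_true]; exact (measurable_pi_apply t).comp measurable_fst
    · simp only [splice, ht, if_false]; exact (measurable_pi_apply t).comp measurable_snd
  refine ⟨hm, (Measure.pi_eq fun B hB => ?_).symm⟩
  rw [Measure.map_apply hm (MeasurableSet.univ_pi hB)]
  have : (splice n : (Fin T → X) × (Fin T → X) → Fin T → X) ⁻¹' Set.univ.pi B =
      (Set.univ.pi fun t : Fin T => if (t : ℕ) < n then B t else Set.univ) ×ˢ
        (Set.univ.pi fun t : Fin T => if (t : ℕ) < n then Set.univ else B t) := by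
    ext p
    simp only [Set.mem_preimage, Set.mem_pi, Set.mem_univ, true_imp_iff, Set.mem_prod, splice]
    rw [← forall_and]
    refine forall_congr' fun t => ?_
    by_cases ht : (t : ℕ) < n <;> simp [ht]
  rw [this, Measure.prod_prod, Measure.pi_pi, Measure.pi_pi, ← Finset.prod_mul_distrib]
  refine Finset.prod_congr rfl fun t _ => ?_
  by_cases ht : (t : ℕ) < n <;> simp [ht]

/-- The index `i` of the sample. -/
def sampleIdx (hn : 2 * n ≤ T) (i : Fin n) : Fin T := ⟨i, by omega⟩

/-- The ghost index `n + i` of the index `i` of the sample. -/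
def ghostIdx (hn : 2 * n ≤ T) (i : Fin n) : Fin T := ⟨n + i, by omega⟩

/-- Exchange of `i` and `n + i` for all `i ∈ S`. -/
def ghostSwapFun (hn : 2 * n ≤ T) (S : Finset (Fin n)) (t : Fin T) : Fin T :=
  if h : (t : ℕ) < n then (if ⟨t, h⟩ ∈ S then ⟨n + t, by omega⟩ else t)
  else if h' : (t : ℕ) < 2 * n then (if ⟨t - n, by omega⟩ ∈ S then ⟨t - n, by omega⟩ else t) else t

lemma ghostSwapFun_sampleIdx (hn : 2 * n ≤ T) (S : Finset (Fin n)) (i : Fin n) :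
    ghostSwapFun hn S (sampleIdx hn i) = if i ∈ S then ghostIdx hn i else sampleIdx hn i := by
  unfold ghostSwapFun sampleIdx ghostIdx
  rw [dif_pos i.2]

lemma ghostSwapFun_ghostIdx (hn : 2 * n ≤ T) (S : Finset (Fin n)) (i : Fin n) :
    ghostSwapFun hn S (ghostIdx hn i) = if i ∈ S then sampleIdx hn i else ghostIdx hn i := by
  have : n + (i : ℕ) < 2 * n := by omega
  simp [ghostSwapFun, sampleIdx, ghostIdx, this]

lemma ghostSwapFun_involutive (hn : 2 * n ≤ T) (S : Finset (Fin n)) :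
    Function.Involutive (ghostSwapFun hn S) := by
  intro t
  rcases lt_or_ge (t : ℕ) n with h | h
  · have : t = sampleIdx hn ⟨t, h⟩ := rfl
    rw [this, ghostSwapFun_sampleIdx]
    split_ifs with hS
    · rw [ghostSwapFun_ghostIdx, if_pos hS]
    · rw [ghostSwapFun_sampleIdx, if_neg hS]
  · rcases lt_or_ge (t : ℕ) (2 * n) with h' | h'
    · have : t = ghostIdx hn ⟨t - n, by omega⟩ := by
        ext; simp only [ghostIdx]; omega
      rw [this, ghostSwapFun_ghostIdx]
      split_ifs with hS
      · rw [ghostSwapFun_sampleIdx, if_pos hS]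
      · rw [ghostSwapFun_ghostIdx, if_neg hS]
    · have : ghostSwapFun hn S t = t := by
        simp [ghostSwapFun, not_lt.2 h, not_lt.2 h']
      rw [this, this]

/-- The discount 1/2 creates the negative drift `-(a + b)/8`, which dominates the second-order terms
because `a² ≤ a` and `b² ≤ b`. This is why the deviation inequality is relative and has no `√n`
term. -/
lemma exp_swap_le {a b : ℝ} (ha : a ∈ Set.Icc (0 : ℝ) 1) (hb : b ∈ Set.Icc (0 : ℝ) 1) :
    Real.exp ((a / 2 - b) / 4) + Real.exp ((b / 2 - a) / 4) ≤ 2 := by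
  obtain ⟨ha0, ha1⟩ := ha
  obtain ⟨hb0, hb1⟩ := hb
  have h1 := Real.abs_exp_sub_one_sub_id_le (x := (a / 2 - b) / 4)
    (abs_le.2 ⟨by linarith, by linarith⟩)
  have h2 := Real.abs_exp_sub_one_sub_id_le (x := (b / 2 - a) / 4)
    (abs_le.2 ⟨by linarith, by linarith⟩)
  nlinarith [(abs_le.1 h1).2, (abs_le.1 h2).2, mul_nonneg ha0 hb0, mul_nonneg ha0
      (sub_nonneg.2 ha1),
    mul_nonneg hb0 (sub_nonneg.2 hb1)]

/-- The discounted ghost sum minus the sample sum, rescaled. -/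
def ghostGap (hn : 2 * n ≤ T) (w : Fin T → ℝ) : ℝ :=
  ∑ i : Fin n, (w (ghostIdx hn i) / 2 - w (sampleIdx hn i)) / 4

lemma ghostGap_le_add (hn : 2 * n ≤ T) (w v : Fin T → ℝ) :
    ghostGap hn w ≤ ghostGap hn v + (∑ t, |w t - v t|) / 4 := by
  have hinj1 : Function.Injective (sampleIdx hn) := fun i j h => by
    simpa [sampleIdx, Fin.ext_iff] using h
  have hinj2 : Function.Injective (ghostIdx hn) := fun i j h => by
    simpa [ghostIdx, Fin.ext_iff] using h
  have hdisj : Disjoint (Finset.univ.map ⟨_, hinj1⟩) (Finset.univ.map ⟨_, hinj2⟩) := by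
    rw [Finset.disjoint_left]
    intro t h1 h2
    simp only [Finset.mem_map, Finset.mem_univ, true_and, Function.Embedding.coeFn_mk] at h1 h2
    obtain ⟨i, rfl⟩ := h1
    obtain ⟨j, hj⟩ := h2
    simp only [ghostIdx, sampleIdx, Fin.mk.injEq] at hj
    omega
  have hsum : ∑ i : Fin n, (|w (sampleIdx hn i) - v (sampleIdx hn i)| +
      |w (ghostIdx hn i) - v (ghostIdx hn i)|) ≤ ∑ t, |w t - v t| := by
    rw [Finset.sum_add_distrib]
    calc _ = ∑ t ∈ (Finset.univ.map ⟨_, hinj1⟩).disjUnion (Finset.univ.map ⟨_, hinj2⟩) hdisj,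
          |w t - v t| := by
          rw [Finset.sum_disjUnion]; simp
      _ ≤ _ := Finset.sum_le_sum_of_subset_of_nonneg (Finset.subset_univ _)
          fun _ _ _ => abs_nonneg _
  have : ghostGap hn w - ghostGap hn v ≤ (∑ i : Fin n, (|w (sampleIdx hn i) - v (sampleIdx hn i)| +
      |w (ghostIdx hn i) - v (ghostIdx hn i)|)) / 4 := by
    rw [ghostGap, ghostGap, ← Finset.sum_sub_distrib, Finset.sum_div]
    refine Finset.sum_le_sum fun i _ => ?_
    have h1 := neg_abs_le (w (sampleIdx hn i) - v (sampleIdx hn i))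
    have h2 := le_abs_self (w (ghostIdx hn i) - v (ghostIdx hn i))
    have h3 := abs_nonneg (w (ghostIdx hn i) - v (ghostIdx hn i))
    linarith
  linarith

/-- Each pair is exchanged or not independently of the others, so the sum over `S` expands a product
over pairs, each factor of which is at most 2 by `exp_swap_le`. -/
lemma sum_exp_ghostGap_le (hn : 2 * n ≤ T) {v : Fin T → ℝ} (hv : ∀ t, v t ∈ Set.Icc (0 : ℝ) 1) :
    ∑ S : Finset (Fin n), Real.exp (ghostGap hn fun t => v (ghostSwapFun hn S t)) ≤ 2 ^ n := by
  have h1 : ∀ S : Finset (Fin n), Real.exp (ghostGap hn fun t => v (ghostSwapFun hn S t)) =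
      (∏ i ∈ S, Real.exp ((v (sampleIdx hn i) / 2 - v (ghostIdx hn i)) / 4)) *
        ∏ i ∈ Finset.univ \ S, Real.exp ((v (ghostIdx hn i) / 2 - v (sampleIdx hn i)) / 4) := by
    intro S
    rw [ghostGap, Real.exp_sum, mul_comm, ← Finset.prod_sdiff (Finset.subset_univ S)]
    congr 1 <;> refine Finset.prod_congr rfl fun i hi => ?_
    · have : i ∉ S := (Finset.mem_sdiff.1 hi).2
      rw [ghostSwapFun_ghostIdx, ghostSwapFun_sampleIdx, if_neg this, if_neg this]
    · rw [ghostSwapFun_ghostIdx, ghostSwapFun_sampleIdx, if_pos hi, if_pos hi]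
  simp_rw [h1]
  rw [← Finset.powerset_univ, ← Finset.prod_add]
  calc _ ≤ ∏ _i : Fin n, (2 : ℝ) := Finset.prod_le_prod
        (fun i _ => add_nonneg (Real.exp_pos _).le (Real.exp_pos _).le)
        fun i _ => exp_swap_le (hv _) (hv _)
    _ = 2 ^ n := by simp

variable {ι : Type*} [Countable ι] {h : ι → X → ℝ}

/-- The product law is invariant under each of the `2 ^ n` exchanges, so the integrand may be
averaged over them. At a fixed sample one cover serves all exchanges, and each of its vectors
contributes at most 1 on average. The bound `N` need not be measurable, since it is only integrated
after a pointwise comparison and scaled by a finite constant. -/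
lemma lintegral_iSup_exp_ghostGap_le (hn : 2 * n ≤ T) (hm : ∀ i, Measurable (h i))
    {N : (Fin T → X) → ℝ≥0∞} {η : ℝ}
    (hN : ∀ z, ∃ V : Finset (Fin T → ℝ), (V.card : ℝ≥0∞) ≤ N z ∧
      (∀ v ∈ V, ∀ t, v t ∈ Set.Icc (0 : ℝ) 1) ∧ ∀ i, ∃ v ∈ V, ∑ t, |h i (z t) - v t| ≤ η) :
    ∫⁻ z, ⨆ i, ENNReal.ofReal (Real.exp (ghostGap hn fun t => h i (z t)))
        ∂(Measure.pi fun _ => ν) ≤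
      ENNReal.ofReal (Real.exp (η / 4)) * ∫⁻ z, N z ∂(Measure.pi fun _ => ν) := by
  set G : (Fin T → X) → ℝ≥0∞ := fun z =>
    ⨆ i, ENNReal.ofReal (Real.exp (ghostGap hn fun t => h i (z t))) with hG
  have hGm : Measurable G := by
    refine Measurable.iSup fun i => (Real.measurable_exp.comp ?_).ennreal_ofReal
    have := hm i
    unfold ghostGap
    fun_prop
  have hswap : ∀ S, ∫⁻ z, G (fun t => z (ghostSwapFun hn S t)) ∂(Measure.pi fun _ => ν) =
      ∫⁻ z, G z ∂(Measure.pi fun _ => ν) := fun S =>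
    (measurePreserving_pi_comp_perm (ν := ν) (ghostSwapFun_involutive hn S).toPerm).lintegral_comp
      hGm
  have hpt : ∀ z, ∑ S : Finset (Fin n), G (fun t => z (ghostSwapFun hn S t)) ≤
      (2 ^ n : ℝ≥0∞) * (ENNReal.ofReal (Real.exp (η / 4)) * N z) := by
    intro z
    obtain ⟨V, hV, hV1, hcov⟩ := hN z
    obtain ⟨E, hE⟩ : ∃ E : (Fin T → ℝ) → Finset (Fin n) → ℝ, ∀ v S, E v S =
      Real.exp (ghostGap hn fun t => v (ghostSwapFun hn S t)) := ⟨_, fun _ _ => rfl⟩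
    have hE0 : ∀ v S, 0 ≤ E v S := fun v S => by rw [hE]; exact (Real.exp_pos _).le
    have h1 : ∀ S, G (fun t => z (ghostSwapFun hn S t)) ≤ ENNReal.ofReal (Real.exp (η / 4)) *
        ∑ v ∈ V, ENNReal.ofReal (E v S) := by
      intro S
      refine iSup_le fun i => ?_
      obtain ⟨v, hv, hvi⟩ := hcov i
      calc _ ≤ ENNReal.ofReal (Real.exp (η / 4)) * ENNReal.ofReal (E v S) := by
            rw [hE, ← ENNReal.ofReal_mul (Real.exp_pos _).le, ← Real.exp_add]
            refine ENNReal.ofReal_le_ofReal (Real.exp_le_exp.2 ?_)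
            have h2 := ghostGap_le_add hn (fun t => h i (z (ghostSwapFun hn S t)))
              (fun t => v (ghostSwapFun hn S t))
            -- The covering error is a sum over all `T` points, hence is unchanged when function
            -- values and cover vector are permuted together.
            have h3 : ∑ t, |h i (z (ghostSwapFun hn S t)) - v (ghostSwapFun hn S t)| =
                ∑ t, |h i (z t) - v t| :=
              Equiv.sum_comp (ghostSwapFun_involutive hn S).toPerm fun t => |h i (z t) - v t|
            rw [h3] at h2
            linarith
        _ ≤ _ := mul_le_mul' le_rfl
            (Finset.single_le_sum_of_canonicallyOrdered (f := fun v => ENNReal.ofReal (E v S)) hv)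
    have h2 : ∀ v ∈ V, ENNReal.ofReal (∑ S : Finset (Fin n), E v S) ≤ (2 ^ n : ℝ≥0∞) := by
      intro v hv
      calc _ ≤ ENNReal.ofReal (2 ^ n) := by
            simp_rw [hE]
            exact ENNReal.ofReal_le_ofReal (sum_exp_ghostGap_le hn (hV1 v hv))
        _ = 2 ^ n := by rw [ENNReal.ofReal_pow (by norm_num)]; simp
    calc _ ≤ ∑ S : Finset (Fin n), ENNReal.ofReal (Real.exp (η / 4)) *
          ∑ v ∈ V, ENNReal.ofReal (E v S) := Finset.sum_le_sum fun S _ => h1 S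
      _ = ENNReal.ofReal (Real.exp (η / 4)) *
            ∑ v ∈ V, ENNReal.ofReal (∑ S : Finset (Fin n), E v S) := by
          rw [← Finset.mul_sum, Finset.sum_comm]
          congr 1
          refine Finset.sum_congr rfl fun v _ => ?_
          rw [ENNReal.ofReal_sum_of_nonneg fun _ _ => hE0 _ _]
      _ ≤ ENNReal.ofReal (Real.exp (η / 4)) * ∑ v ∈ V, (2 ^ n : ℝ≥0∞) :=
          mul_le_mul' le_rfl (Finset.sum_le_sum h2)
      _ = (2 ^ n : ℝ≥0∞) * (ENNReal.ofReal (Real.exp (η / 4)) * V.card) := by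
          rw [Finset.sum_const, nsmul_eq_mul]
          ring
      _ ≤ _ := mul_le_mul' le_rfl (mul_le_mul' le_rfl hV)
  have h2n : (2 ^ n : ℝ≥0∞) ≠ 0 := by positivity
  have h2n' : (2 ^ n : ℝ≥0∞) ≠ ∞ := ENNReal.pow_ne_top (by norm_num)
  have hall : (2 ^ n : ℝ≥0∞) * ∫⁻ z, G z ∂(Measure.pi fun _ => ν) ≤
      (2 ^ n : ℝ≥0∞) * (ENNReal.ofReal (Real.exp (η / 4)) * ∫⁻ z, N z ∂(Measure.pi fun _ => ν)) :=
          by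
    calc _ = ∑ S : Finset (Fin n),
          ∫⁻ z, G (fun t => z (ghostSwapFun hn S t)) ∂(Measure.pi fun _ => ν) := by
          simp_rw [hswap]
          simp
      _ = ∫⁻ z, ∑ S : Finset (Fin n), G (fun t => z (ghostSwapFun hn S t))
            ∂(Measure.pi fun _ => ν) := by
          rw [lintegral_finsetSum]
          intro S _
          exact hGm.comp (measurable_pi_lambda _ fun t => measurable_pi_apply _)
      _ ≤ ∫⁻ z, (2 ^ n : ℝ≥0∞) * (ENNReal.ofReal (Real.exp (η / 4)) * N z)
            ∂(Measure.pi fun _ => ν) := lintegral_mono hpt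
      _ = _ := by
          rw [lintegral_const_mul' _ _ h2n', lintegral_const_mul' _ _ ENNReal.ofReal_ne_top]
  exact (ENNReal.mul_le_mul_iff_right h2n h2n').1 hall

/-- Uniform relative deviation inequality for `[0,1]`-valued functions: with high probability
`n ∫ h dν / 2 ≤ ∑_{i ≤ n} h(z_i) + 4 u` for all `h` in the class. -/
lemma measure_pi_exists_deviation_le (hn : 2 * n ≤ T) (hm : ∀ i, Measurable (h i))
    (h01 : ∀ i x, h i x ∈ Set.Icc (0 : ℝ) 1) {N : (Fin T → X) → ℝ≥0∞} {η : ℝ}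
    (hN : ∀ z, ∃ V : Finset (Fin T → ℝ), (V.card : ℝ≥0∞) ≤ N z ∧
      (∀ v ∈ V, ∀ t, v t ∈ Set.Icc (0 : ℝ) 1) ∧ ∀ i, ∃ v ∈ V, ∑ t, |h i (z t) - v t| ≤ η) (u : ℝ) :
    (Measure.pi fun _ => ν) {z : Fin T → X | ∃ i, u ≤
        (n * (∫ x, h i x ∂ν) / 2 - ∑ j : Fin n, h i (z (sampleIdx hn j))) / 4} ≤
      ENNReal.ofReal (Real.exp (η / 4 - u)) * ∫⁻ z, N z ∂(Measure.pi fun _ => ν) := by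
  set P : Measure (Fin T → X) := Measure.pi fun _ => ν with hP
  set B : (Fin T → X) → ι → ℝ := fun z i =>
    (n * (∫ x, h i x ∂ν) / 2 - ∑ j : Fin n, h i (z (sampleIdx hn j))) / 4 with hB
  have hBm : ∀ i, Measurable fun z => B z i := fun i => by
    have := hm i
    simp only [hB]
    fun_prop
  set G : (Fin T → X) → ℝ≥0∞ := fun z =>
    ⨆ i, ENNReal.ofReal (Real.exp (ghostGap hn fun t => h i (z t))) with hG
  have hgm : ∀ i, Measurable fun z : Fin T → X => ghostGap hn fun t => h i (z t) := fun i => by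
    have := hm i
    unfold ghostGap
    fun_prop
  have hGm : Measurable G :=
    Measurable.iSup fun i => (Real.measurable_exp.comp (hgm i)).ennreal_ofReal
  -- Averaging `ghostGap` over the ghost half alone gives `B z i`; Jensen's inequality moves the
  -- average out of the exponential, and the supremum over `i` is then taken inside.
  have hjensen : ∀ z i, ENNReal.ofReal (Real.exp (B z i)) ≤ ∫⁻ y, G (splice n (z, y)) ∂P := by
    intro z i
    have hsp : Measurable fun y : Fin T → X => splice n (z, y) :=
      (measurePreserving_splice (ν := ν) n).measurable.comp measurable_prodMk_left
    have hs : ∀ y j, splice n (z, y) (sampleIdx hn j) = z (sampleIdx hn j) := fun y j => by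
      simp [splice, sampleIdx]
    have hg : ∀ y j, splice n (z, y) (ghostIdx hn j) = y (ghostIdx hn j) := fun y j => by
      simp [splice, ghostIdx]
    have hint : ∀ t : Fin T, Integrable (fun y : Fin T → X => h i (y t)) P := fun t =>
      Integrable.of_mem_Icc 0 1 ((hm i).comp (measurable_pi_apply t)).aemeasurable
        (ae_of_all _ fun y => h01 i _)
    have hval : ∀ t : Fin T, ∫ y : Fin T → X, h i (y t) ∂P = ∫ x, h i x ∂ν := fun t => by
      have := (measurePreserving_eval (fun _ : Fin T => ν) t).map_eq
      rw [← this, integral_map (measurable_pi_apply t).aemeasurable (hm i).aestronglyMeasurable]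
    have hY : ∀ y, ghostGap hn (fun t => h i (splice n (z, y) t)) =
        ∑ j : Fin n, (h i (y (ghostIdx hn j)) / 2 - h i (z (sampleIdx hn j))) / 4 := fun y => by
      simp only [ghostGap, hs, hg]
    have hYint : Integrable (fun y => ghostGap hn fun t => h i (splice n (z, y) t)) P := by
      simp_rw [hY]
      exact integrable_finsetSum _ fun j _ =>
        (((hint _).div_const 2).sub (integrable_const _)).div_const 4
    have hmean : ∫ y, ghostGap hn (fun t => h i (splice n (z, y) t)) ∂P = B z i := by
      simp_rw [hY]
      have hij : ∀ j : Fin n, Integrable (fun y : Fin T → X =>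
          (h i (y (ghostIdx hn j)) / 2 - h i (z (sampleIdx hn j))) / 4) P := fun j =>
        (((hint _).div_const 2).sub (integrable_const _)).div_const 4
      rw [integral_finsetSum _ fun j _ => hij j]
      simp_rw [integral_div]
      have : ∀ j : Fin n, ∫ y, (h i (y (ghostIdx hn j)) / 2 - h i (z (sampleIdx hn j))) ∂P =
          (∫ x, h i x ∂ν) / 2 - h i (z (sampleIdx hn j)) := fun j => by
        rw [integral_sub ((hint _).div_const 2) (integrable_const _), integral_div, hval]
        simp
      simp_rw [this]
      rw [← Finset.sum_div, Finset.sum_sub_distrib]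
      simp [hB, mul_div_assoc]
    have hbd : ∀ y, ghostGap hn (fun t => h i (splice n (z, y) t)) ∈ Set.Icc (-(n : ℝ)) n := by
      intro y
      have h1 : ∀ j : Fin n, (h i (y (ghostIdx hn j)) / 2 - h i (z (sampleIdx hn j))) / 4 ∈
          Set.Icc (-1 : ℝ) 1 := fun j => by
        have a1 := h01 i (y (ghostIdx hn j))
        have a2 := h01 i (z (sampleIdx hn j))
        exact ⟨by linarith [a1.1, a2.2], by linarith [a1.2, a2.1]⟩
      rw [hY]
      constructor
      · have := Finset.sum_le_sum fun j (_ : j ∈ Finset.univ) => (h1 j).1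
        simpa using this
      · have := Finset.sum_le_sum fun j (_ : j ∈ Finset.univ) => (h1 j).2
        simpa using this
    have hexpint : Integrable (fun y => Real.exp (ghostGap hn fun t => h i (splice n (z,
        y) t))) P :=
      Integrable.of_mem_Icc 0 (Real.exp n)
        (Real.measurable_exp.comp ((hgm i).comp hsp)).aemeasurable
        (ae_of_all _ fun y => ⟨(Real.exp_pos _).le, Real.exp_le_exp.2 (hbd y).2⟩)
    calc _ = ENNReal.ofReal (Real.exp (∫ y, ghostGap hn (fun t => h i (splice n (z, y) t)) ∂P)) :=
        by
          rw [hmean]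
      _ ≤ ENNReal.ofReal (∫ y, Real.exp (ghostGap hn fun t => h i (splice n (z, y) t)) ∂P) :=
          ENNReal.ofReal_le_ofReal (convexOn_exp.map_integral_le Real.continuous_exp.continuousOn
            isClosed_univ (ae_of_all _ fun _ => Set.mem_univ _) hYint hexpint)
      _ = ∫⁻ y, ENNReal.ofReal (Real.exp (ghostGap hn fun t => h i (splice n (z, y) t))) ∂P :=
          ofReal_integral_eq_lintegral_ofReal hexpint (ae_of_all _ fun _ => (Real.exp_pos _).le)
      _ ≤ _ := lintegral_mono fun y => le_iSup (fun i => ENNReal.ofReal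
          (Real.exp (ghostGap hn fun t => h i (splice n (z, y) t)))) i
  have hle : ∫⁻ z, ⨆ i, ENNReal.ofReal (Real.exp (B z i)) ∂P ≤
      ENNReal.ofReal (Real.exp (η / 4)) * ∫⁻ z, N z ∂P := by
    calc _ ≤ ∫⁻ z, ∫⁻ y, G (splice n (z, y)) ∂P ∂P := lintegral_mono fun z => iSup_le (hjensen z)
      _ = ∫⁻ p, G (splice n p) ∂(P.prod P) :=
          (lintegral_prod (fun p => G (splice n p))
            (hGm.comp (measurePreserving_splice (ν := ν) n).measurable).aemeasurable).symm
      _ = ∫⁻ z, G z ∂P := (measurePreserving_splice (ν := ν) n).lintegral_comp hGm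
      _ ≤ _ := lintegral_iSup_exp_ghostGap_le hn hm hN
  have hmk := mul_meas_ge_le_lintegral₀ (μ := P) (f := fun z => ⨆ i, ENNReal.ofReal (Real.exp
      (B z i)))
    (Measurable.iSup fun i => (Real.measurable_exp.comp (hBm i)).ennreal_ofReal).aemeasurable
    (ENNReal.ofReal (Real.exp u))
  have hsub : {z : Fin T → X | ∃ i, u ≤ B z i} ⊆
      {z | ENNReal.ofReal (Real.exp u) ≤ ⨆ i, ENNReal.ofReal (Real.exp (B z i))} := by
    rintro z ⟨i, hi⟩
    exact (ENNReal.ofReal_le_ofReal (Real.exp_le_exp.2 hi)).trans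
      (le_iSup (fun i => ENNReal.ofReal (Real.exp (B z i))) i)
  calc _ ≤ P {z | ENNReal.ofReal (Real.exp u) ≤ ⨆ i, ENNReal.ofReal (Real.exp (B z i))} :=
        measure_mono hsub
    _ = ENNReal.ofReal (Real.exp (-u)) * (ENNReal.ofReal (Real.exp u) *
          P {z | ENNReal.ofReal (Real.exp u) ≤ ⨆ i, ENNReal.ofReal (Real.exp (B z i))}) := by
        rw [← mul_assoc, ← ENNReal.ofReal_mul (Real.exp_pos _).le, ← Real.exp_add]
        simp
    _ ≤ ENNReal.ofReal (Real.exp (-u)) * (ENNReal.ofReal (Real.exp (η / 4)) * ∫⁻ z, N z ∂P) := by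
        exact mul_le_mul' le_rfl (hmk.trans hle)
    _ = _ := by
        rw [← mul_assoc, ← ENNReal.ofReal_mul (Real.exp_pos _).le, ← Real.exp_add]
        ring_nf

end Symmetrization

/-! ### Rounds and epochs of a run -/

lemma one_le_epochStart (m : ℕ) : 1 ≤ epochStart m := Nat.one_le_two_pow

lemma epochStart_succ {m : ℕ} (hm : 1 ≤ m) : epochStart (m + 1) = 2 * epochStart m := by
  obtain ⟨k, rfl⟩ := Nat.exists_eq_add_of_le' hm
  simp [epochStart, pow_succ, mul_comm]

lemma epochStart_le {T m : ℕ} (hT : 1 ≤ T) (hm : m ≤ numEpochs T) : epochStart m ≤ T := by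
  unfold epochStart
  refine (Nat.pow_le_pow_right (by norm_num) (?_ : m - 1 ≤ Nat.log 2 T)).trans
    (Nat.pow_log_le_self 2 (by omega))
  unfold numEpochs at hm
  omega

lemma exists_epoch {T t : ℕ} (ht : t ∈ Set.Icc 1 T) :
    ∃ m ∈ Set.Icc 1 (numEpochs T), t ∈ Set.Ico (epochStart m) (epochStart (m + 1)) := by
  refine ⟨Nat.log 2 t + 1, ⟨by omega, ?_⟩, ?_, ?_⟩
  · exact Nat.succ_le_succ (Nat.log_mono_right ht.2)
  · simpa [epochStart] using Nat.pow_log_le_self 2 (by have := ht.1; omega)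
  · simpa [epochStart] using Nat.lt_pow_succ_log_self (by norm_num : 1 < 2) t

section History

variable {Ω X : Type*} [mX : MeasurableSpace X] {K : ℕ}
  {x : ℕ → Ω → X} {r : ℕ → Ω → Fin K → ℝ} {a : ℕ → Ω → Fin K}

lemma history_mono : Monotone (history x r a) := fun _ _ hst =>
  biSup_mono fun _ hi => ⟨hi.1, hi.2.trans_le hst⟩

lemma measurable_history {t : ℕ} (ht : 1 ≤ t) :
    Measurable[history x r a (t + 1)] fun ω => (x t ω, r t ω, a t ω) :=
  (comap_measurable fun ω => (x t ω, r t ω, a t ω)).mono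
    (le_biSup (fun s => MeasurableSpace.comap (fun ω => (x s ω, r s ω, a s ω)) inferInstance)
      (⟨ht, by omega⟩ : t ∈ Set.Ico 1 (t + 1))) le_rfl

end History

/-! ### The exponential deviation process of a run. -/

section Run

variable {Ω X : Type*} [m0 : MeasurableSpace Ω] [mX : MeasurableSpace X] {K : ℕ}
  {μ : Measure Ω} {D : Measure (X × (Fin K → ℝ))} {F : Set (Predictor X K)} {β : ℕ → ℝ} {T : ℕ}
  {x : ℕ → Ω → X} {r : ℕ → Ω → Fin K → ℝ} {a : ℕ → Ω → Fin K}
  {fstar : Predictor X K}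

lemma IsEliminationRun.history_le (h : IsEliminationRun μ D F β T x r a) (t : ℕ) :
    history x r a t ≤ m0 :=
  iSup₂_le fun s _ => ((h.measurable_context s).prodMk
    ((h.measurable_reward s).prodMk (h.measurable_action s))).comap_le

lemma IsEliminationRun.isIidContexts [IsProbabilityMeasure D]
    (h : IsEliminationRun μ D F β T x r a) :
    IsIidContexts μ (D.map Prod.fst) T (history x r a) x where
  measurable := h.measurable_context
  mono := history_mono
  le := h.history_le
  comap_le n hn := (measurable_fst.comp (measurable_history hn)).comap_le
  law n hn := by
    rw [← h.env_law n hn, Measure.map_map measurable_fst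
      ((h.measurable_context n).prodMk (h.measurable_reward n))]
    rfl
  indep n hn := by
    refine indep_of_indep_of_le_right (h.env_indep n hn) ?_
    rintro _ ⟨s, hs, rfl⟩
    exact ⟨Prod.fst ⁻¹' s, measurable_fst hs, rfl⟩

lemma IsEliminationRun.isRound (h : IsEliminationRun μ D F β T x r a) {t : ℕ}
    (ht : t ∈ Set.Icc 1 T) :
    IsRound (history x r a t) μ D (fun ω => (x t ω, r t ω)) (a t) where
  le := h.history_le t
  measurable_env := (h.measurable_context t).prodMk (h.measurable_reward t)
  measurable_action := h.measurable_action t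
  env_law := h.env_law t ht
  env_indep := h.env_indep t ht
  action_law b := by
    obtain ⟨m, hm, htm⟩ := exists_epoch ht
    exact (h.action_law_given_reward m hm t htm ht.2 b).trans (h.action_law m hm t htm ht.2 b).symm

/-- Negative excess loss of `v` in round `s`, plus a quarter of its conditional mean square
error. -/
def deviation (μ : Measure Ω) (fstar v : Predictor X K) (x : ℕ → Ω → X)
    (r : ℕ → Ω → Fin K → ℝ) (a : ℕ → Ω → Fin K) (s : ℕ) (ω : Ω) : ℝ :=
  -excess fstar v (x s ω, r s ω) (a s ω) +
    condError (history x r a s) μ fstar v (x s) (a s) ω / 4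

lemma measurable_excess {v : Predictor X K} (hf : ∀ b, Measurable fun x => fstar x b)
    (hv : ∀ b, Measurable fun x => v x b) :
    Measurable fun p : X × (Fin K → ℝ) × Fin K => excess fstar v (p.1, p.2.1) p.2.2 := by
  have hf' : Measurable fun p : X × Fin K => fstar p.1 p.2 := measurable_from_prod_countable_left hf
  have hv' : Measurable fun p : X × Fin K => v p.1 p.2 := measurable_from_prod_countable_left hv
  have hev : Measurable fun p : (Fin K → ℝ) × Fin K => p.1 p.2 :=
    measurable_from_prod_countable_left fun b => measurable_pi_apply b
  have h1 : Measurable fun p : X × (Fin K → ℝ) × Fin K => p.2.1 p.2.2 := hev.comp measurable_snd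
  have h2 : Measurable fun p : X × (Fin K → ℝ) × Fin K => (p.1, p.2.2) := by fun_prop
  exact (((hv'.comp h2).sub h1).pow_const 2).sub (((hf'.comp h2).sub h1).pow_const 2)

lemma measurable_deviation
    {v : Predictor X K} (hf : ∀ b, Measurable fun x => fstar x b)
    (hv : ∀ b, Measurable fun x => v x b) {s : ℕ} (hs : 1 ≤ s) :
    Measurable[history x r a (s + 1)] (deviation μ fstar v x r a s) := by
  have h1 : Measurable[history x r a (s + 1)] fun ω => excess fstar v (x s ω, r s ω) (a s ω) :=
    (measurable_excess hf hv).comp (measurable_history hs)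
  have h2 : Measurable[history x r a (s + 1)]
      (condError (history x r a s) μ fstar v (x s) (a s)) := by
    refine (measurable_condError hf hv (x s)).mono (sup_le (history_mono (by omega)) ?_) le_rfl
    exact (measurable_fst.comp (measurable_history hs)).comap_le
  exact h1.neg.add (h2.div_const 4)

/-- Union bound for a finite family of predictors that may depend on the contexts through a
countable partition. -/
lemma IsEliminationRun.measure_exists_deviation_le [IsProbabilityMeasure μ] [IsProbabilityMeasure D]
    (h : IsEliminationRun μ D F β T x r a) (hT : 1 ≤ T) (hu : HasUnitRewards D)
    (hr : IsRealizedBy D F fstar) (hF : IsPredictorClass F)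
    {κ J : Type*} [Countable J] {v : κ → ℕ → Predictor X K}
    (hv : ∀ k s b, Measurable fun x => v k s x b)
    (hv1 : ∀ k s x b, v k s x b ∈ Set.Icc (0 : ℝ) 1)
    {S : J → Set (Fin T → X)} (hS : ∀ j, MeasurableSet (S j)) (hdisj : Pairwise fun i j => Disjoint
        (S i) (S j))
    (V : J → Finset κ) {B : ℕ} (hV : ∀ j, (V j).card ≤ B) (u : ℝ) :
    μ {ω | ∃ j, (fun t : Fin T => x (t + 1) ω) ∈ S j ∧ ∃ k ∈ V j, ∃ m ∈ Finset.Icc 1 (numEpochs T),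
        u ≤ ∑ s ∈ Finset.Ico 1 (epochStart m), deviation μ fstar (v k s) x r a s ω} ≤
      (B * numEpochs T : ℕ) * ENNReal.ofReal (Real.exp (-u)) := by
  have hf : ∀ b, Measurable fun x => fstar x b := fun b => (hF _ hr.1 b).1
  have hν : IsProbabilityMeasure (D.map Prod.fst) :=
    Measure.isProbabilityMeasure_map measurable_fst.aemeasurable
  set E : J → κ → ℕ → Set Ω := fun j k m => {ω | (fun t : Fin T => x (t + 1) ω) ∈ S j ∧
    u ≤ ∑ s ∈ Finset.Ico 1 (epochStart m), deviation μ fstar (v k s) x r a s ω} with hE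
  set A : J → Set Ω := fun j => {ω | (fun t : Fin T => x (t + 1) ω) ∈ S j} with hA
  have hxm : Measurable fun ω => fun t : Fin T => x (t + 1) ω :=
    measurable_pi_lambda _ fun t => h.measurable_context _
  have hE1 : ∀ j k, ∀ m ∈ Finset.Icc 1 (numEpochs T),
      μ (E j k m) ≤ ENNReal.ofReal (Real.exp (-u)) * μ (A j) := by
    intro j k m hm
    have hle : epochStart m - 1 ≤ T :=
      (Nat.sub_le _ _).trans (epochStart_le hT (Finset.mem_Icc.1 hm).2)
    have key := h.isIidContexts.measure_inter_le
      (Y := fun s => deviation μ fstar (v k s) x r a s)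
      (fun s hs => measurable_deviation hf (hv k s) hs.1)
      (fun s hs Φ hΦ => (h.isRound hs).lintegral_exp_excess_le hu hr hF (hv k s) (hv1 k s) hΦ)
      hle (hS j) u
    have hI : Finset.Icc 1 (epochStart m - 1) = Finset.Ico 1 (epochStart m) := by
      have := one_le_epochStart m
      ext s; simp only [Finset.mem_Icc, Finset.mem_Ico]; omega
    rwa [hI] at key
  have hsub : {ω | ∃ j, (fun t : Fin T => x (t + 1) ω) ∈ S j ∧ ∃ k ∈ V j,
      ∃ m ∈ Finset.Icc 1 (numEpochs T),
        u ≤ ∑ s ∈ Finset.Ico 1 (epochStart m), deviation μ fstar (v k s) x r a s ω} ⊆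
      ⋃ j, ⋃ k ∈ V j, ⋃ m ∈ Finset.Icc 1 (numEpochs T), E j k m := by
    rintro ω ⟨j, hj, k, hk, m, hm, hω⟩
    simp only [Set.mem_iUnion]
    exact ⟨j, k, hk, m, hm, hj, hω⟩
  -- The pieces are disjoint and each failure probability is proportional to the mass of its piece,
  -- so the number of pieces does not enter the bound.
  have hAsum : ∑' j, μ (A j) ≤ 1 := by
    have hd : Pairwise fun i j => Disjoint (A i) (A j) := fun i j hij =>
      Set.disjoint_left.2 fun ω h1 h2 => Set.disjoint_left.1 (hdisj hij) h1 h2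
    rw [← measure_iUnion hd fun j => hxm (hS j)]
    exact prob_le_one
  calc _ ≤ μ (⋃ j, ⋃ k ∈ V j, ⋃ m ∈ Finset.Icc 1 (numEpochs T), E j k m) := measure_mono hsub
    _ ≤ ∑' j, μ (⋃ k ∈ V j, ⋃ m ∈ Finset.Icc 1 (numEpochs T), E j k m) := measure_iUnion_le _
    _ ≤ ∑' j, ((B * numEpochs T : ℕ) * ENNReal.ofReal (Real.exp (-u))) * μ (A j) := by
        refine ENNReal.tsum_le_tsum fun j => ?_
        calc _ ≤ ∑ k ∈ V j, ∑ m ∈ Finset.Icc 1 (numEpochs T), μ (E j k m) :=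
              (measure_biUnion_finset_le _ _).trans
                (Finset.sum_le_sum fun k _ => measure_biUnion_finset_le _ _)
          _ ≤ ∑ k ∈ V j, ∑ m ∈ Finset.Icc 1 (numEpochs T),
                ENNReal.ofReal (Real.exp (-u)) * μ (A j) :=
              Finset.sum_le_sum fun k _ => Finset.sum_le_sum fun m hm => hE1 j k m hm
          _ = ((V j).card * numEpochs T : ℕ) * ENNReal.ofReal (Real.exp (-u)) * μ (A j) := by
              simp only [Finset.sum_const, nsmul_eq_mul, Nat.card_Icc, Nat.add_sub_cancel]
              push_cast
              ring
          _ ≤ _ := by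
              gcongr
              exact hV j
    _ = ((B * numEpochs T : ℕ) * ENNReal.ofReal (Real.exp (-u))) * ∑' j, μ (A j) :=
        ENNReal.tsum_mul_left
    _ ≤ _ := mul_le_of_le_one_right' hAsum

end Run

/-! ### Covers -/

/-- Truncation to `[0,1]`. -/
def clip (y : ℝ) : ℝ := max 0 (min 1 y)

lemma clip_mem (y : ℝ) : clip y ∈ Set.Icc (0 : ℝ) 1 :=
  ⟨le_max_left _ _, max_le zero_le_one (min_le_left _ _)⟩

lemma abs_sub_clip_le {y z : ℝ} (hy : y ∈ Set.Icc (0 : ℝ) 1) : |y - clip z| ≤ |y - z| := by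
  obtain ⟨h0, h1⟩ := hy
  unfold clip
  rcases le_total z 0 with hz | hz
  · rw [min_eq_right (by linarith), max_eq_left hz, abs_of_nonneg (by linarith),
      abs_of_nonneg (by linarith)]
    linarith
  · rcases le_total z 1 with hz1 | hz1
    · rw [min_eq_right hz1, max_eq_right hz]
    · rw [min_eq_left hz1, max_eq_right zero_le_one, abs_of_nonpos (by linarith),
        abs_of_nonpos (by linarith)]
      linarith

lemma abs_sq_sub_sq_le {y z w : ℝ} (hy : y ∈ Set.Icc (0 : ℝ) 1) (hz : z ∈ Set.Icc (0 : ℝ) 1)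
    (hw : w ∈ Set.Icc (0 : ℝ) 1) : |(y - w) ^ 2 - (z - w) ^ 2| ≤ 2 * |y - z| := by
  have : (y - w) ^ 2 - (z - w) ^ 2 = (y + z - 2 * w) * (y - z) := by ring
  rw [this, abs_mul]
  refine mul_le_mul_of_nonneg_right (abs_le.2 ⟨?_, ?_⟩) (abs_nonneg _) <;>
    linarith [hy.1, hy.2, hz.1, hz.2, hw.1, hw.2]

/-- The squared error at action `a` on the region where `a` is optimal. -/
def regionError {X : Type*} {K : ℕ} (fstar f : Predictor X K) (a : Fin K) : X → ℝ :=
  (bestRegion fstar 0 a).indicator fun x => (f x a - fstar x a) ^ 2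

lemma sq_sub_mem_Icc {y z : ℝ} (hy : y ∈ Set.Icc (0 : ℝ) 1) (hz : z ∈ Set.Icc (0 : ℝ) 1) :
    (y - z) ^ 2 ∈ Set.Icc (0 : ℝ) 1 :=
  ⟨sq_nonneg _, by nlinarith [hy.1, hy.2, hz.1, hz.2]⟩

lemma regionError_mem_Icc {X : Type*} {K : ℕ} {fstar f : Predictor X K} {a : Fin K}
    (hs : ∀ x, fstar x a ∈ Set.Icc (0 : ℝ) 1) (hf : ∀ x, f x a ∈ Set.Icc (0 : ℝ) 1) (x : X) :
    regionError fstar f a x ∈ Set.Icc (0 : ℝ) 1 := by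
  unfold regionError Set.indicator
  split_ifs
  · exact sq_sub_mem_Icc (hf x) (hs x)
  · simp

section Cover

variable {X : Type*} {T : ℕ} {G : Set (X → ℝ)} {ε : ℝ}

lemma sum_le_of_avg_le (hT : 1 ≤ T) {w : Fin T → ℝ} (h : (1 / (T : ℝ)) * ∑ t, w t ≤ ε) :
    ∑ t, w t ≤ T * ε := by
  have hT' : (0 : ℝ) < T := by exact_mod_cast hT
  rw [one_div, inv_mul_le_iff₀ hT'] at h
  exact h

/-- Total boundedness of the cube `[0,1]^T` bounds the covering number uniformly in the points. It
is therefore finite and attained, and its expectation is finite, so the `toReal` in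
`expectedCoveringNumber` loses nothing. -/
lemma exists_isL1Cover_card_eq (T : ℕ) (hε : 0 < ε) :
    ∃ C : ℕ, ∀ {X : Type*} {G : Set (X → ℝ)}, (∀ g ∈ G, ∀ x, g x ∈ Set.Icc (0 : ℝ) 1) →
      ∀ z : Fin T → X, coveringNumber G ε z ≤ C ∧
        ∃ V, IsL1Cover G ε z V ∧ (V.card : ℕ∞) = coveringNumber G ε z := by
  have htb : TotallyBounded (Set.univ.pi fun _ : Fin T => Set.Icc (0 : ℝ) 1) :=
    (isCompact_univ_pi fun _ => isCompact_Icc).totallyBounded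
  obtain ⟨S, hSf, hS⟩ := Metric.totallyBounded_iff.1 htb ε hε
  refine ⟨hSf.toFinset.card, fun {X G} hG z => ?_⟩
  have hcov : IsL1Cover G ε z hSf.toFinset := by
    intro g hg
    have hmem : (fun t => g (z t)) ∈ Set.univ.pi fun _ : Fin T => Set.Icc (0 : ℝ) 1 :=
      fun t _ => hG g hg _
    obtain ⟨v, hv, hd⟩ := Set.mem_iUnion₂.1 (hS hmem)
    refine ⟨v, by simpa using hv, ?_⟩
    have h1 : ∀ t, |g (z t) - v t| ≤ ε := fun t => by
      have := (dist_le_pi_dist (fun t => g (z t)) v t).trans (Metric.mem_ball.1 hd).le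
      rwa [Real.dist_eq] at this
    rcases Nat.eq_zero_or_pos T with rfl | hT
    · simpa using hε.le
    have hT' : (0 : ℝ) < T := by exact_mod_cast hT
    rw [one_div, inv_mul_le_iff₀ hT']
    calc _ ≤ ∑ _t : Fin T, ε := Finset.sum_le_sum fun t _ => h1 t
      _ = T * ε := by simp
  have hle : coveringNumber G ε z ≤ hSf.toFinset.card := iInf₂_le _ hcov
  refine ⟨hle, ?_⟩
  obtain ⟨V, hV⟩ := ciInf_mem fun V : Finset (Fin T → ℝ) =>
    ⨅ (_ : IsL1Cover G ε z V), (V.card : ℕ∞)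
  change _ = coveringNumber G ε z at hV
  by_cases hVc : IsL1Cover G ε z V
  · exact ⟨V, hVc, by rw [← hV]; simp [hVc]⟩
  · simp only [hVc, iInf_false] at hV
    rw [← hV] at hle
    simp at hle

/-- The points on which the rational vectors `V` cover `G`, with total error `η`. -/
def ratCoverSet (G : Set (X → ℝ)) (η : ℝ) (V : Finset (Fin T → ℚ)) : Set (Fin T → X) :=
  {z | ∀ g ∈ G, ∃ q ∈ V, ∑ t, |g (z t) - (q t : ℝ)| ≤ η}

/-- Rounding each coordinate to a rational within `ε` doubles the total error `ε * T` and leaves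
only countably many possible covers, which gives a countable partition of the context space. -/
lemma exists_mem_ratCoverSet (hT : 1 ≤ T) (hε : 0 < ε) {z : Fin T → X} {V : Finset (Fin T → ℝ)}
    (hV : IsL1Cover G ε z V) :
    ∃ V' : Finset (Fin T → ℚ), V'.card ≤ V.card ∧ z ∈ ratCoverSet G (2 * ε * T) V' := by
  classical
  have hq : ∀ y : ℝ, ∃ q : ℚ, |y - q| ≤ ε := fun y => by
    obtain ⟨q, h1, h2⟩ := exists_rat_btwn (show y - ε < y by linarith)
    exact ⟨q, abs_le.2 ⟨by linarith, by linarith⟩⟩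
  choose q hq using hq
  refine ⟨V.image fun v t => q (v t), Finset.card_image_le, fun g hg => ?_⟩
  obtain ⟨v, hv, hgv⟩ := hV g hg
  refine ⟨_, Finset.mem_image_of_mem _ hv, ?_⟩
  have h1 := sum_le_of_avg_le hT hgv
  calc _ ≤ ∑ t, (|g (z t) - v t| + ε) := by
        refine Finset.sum_le_sum fun t _ => ?_
        have := abs_sub_le (g (z t)) (v t) (q (v t))
        linarith [hq (v t)]
    _ ≤ _ := by
        rw [Finset.sum_add_distrib]
        simp only [Finset.sum_const, Finset.card_univ, Fintype.card_fin, nsmul_eq_mul]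
        linarith

variable [MeasurableSpace X] {K : ℕ} {F : Set (Predictor X K)}

lemma measurableSet_ratCoverSet (hF : IsPredictorClass F) (hp : IsPointwiseMeasurable F)
    (a : Fin K) (η : ℝ) (V : Finset (Fin T → ℚ)) :
    MeasurableSet (ratCoverSet (actionClass F a) η V) := by
  obtain ⟨F₀, hsub, hcount, hlim⟩ := hp
  have heq : ratCoverSet (actionClass F a) η V =
      ⋂ f ∈ F₀, ⋃ q ∈ V, {z : Fin T → X | ∑ t, |f (z t) a - (q t : ℝ)| ≤ η} := by
    ext z
    simp only [ratCoverSet, Set.mem_iInter, Set.mem_iUnion, actionClass, Set.forall_mem_image,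
      Set.mem_ofPred_eq, exists_prop]
    refine ⟨fun h f hf => h (hsub hf), fun h f hf => ?_⟩
    -- A finite union of closed `ℓ₁` balls is closed, so being covered passes from the countable
    -- subclass to its pointwise limits.
    obtain ⟨w, hw, hwl⟩ := hlim f hf
    have hcl : IsClosed (⋃ q ∈ V, {y : Fin T → ℝ | ∑ t, |y t - (q t : ℝ)| ≤ η}) :=
      Set.Finite.isClosed_biUnion V.finite_toSet fun q _ =>
        isClosed_le (by fun_prop) continuous_const
    have hmem := hcl.mem_of_tendsto (x := fun t => f (z t) a)
      (tendsto_pi_nhds.2 fun t => hwl (z t) a)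
      (Filter.Eventually.of_forall fun n => by
        obtain ⟨q, hq, h1⟩ := h (w n) (hw n)
        exact Set.mem_iUnion₂.2 ⟨q, hq, h1⟩)
    obtain ⟨q, hq, h1⟩ := Set.mem_iUnion₂.1 hmem
    exact ⟨q, hq, h1⟩
  rw [heq]
  refine MeasurableSet.biInter hcount fun f hf => ?_
  refine Finset.measurableSet_biUnion _ fun q _ => measurableSet_le ?_ measurable_const
  have := (hF f (hsub hf) a).1
  refine Finset.measurable_fun_sum _ fun t _ => ?_
  exact ((this.comp (measurable_pi_apply t)).sub_const _).abs

lemma actionClass_mem_Icc (hF : IsPredictorClass F) {a : Fin K} :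
    ∀ g ∈ actionClass F a, ∀ x, g x ∈ Set.Icc (0 : ℝ) 1 := by
  rintro _ ⟨f, hf, rfl⟩ x
  exact (hF f hf a).2 x

variable {ν : Measure X} [IsProbabilityMeasure ν]

lemma lintegral_coveringNumber_ne_top (hF : IsPredictorClass F) (a : Fin K) (T : ℕ) (hε : 0 < ε) :
    ∫⁻ z, (coveringNumber (actionClass F a) ε z : ℝ≥0∞) ∂(Measure.pi fun _ : Fin T => ν) ≠ ∞ := by
  obtain ⟨C, hC⟩ := exists_isL1Cover_card_eq T hε
  refine ne_top_of_le_ne_top (b := (C : ℝ≥0∞)) (by simp) ?_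
  calc _ ≤ ∫⁻ _, (C : ℝ≥0∞) ∂(Measure.pi fun _ : Fin T => ν) := by
        refine lintegral_mono fun z => ?_
        have := ENat.toENNReal_le.2 (hC (actionClass_mem_Icc hF (a := a)) z).1
        simpa using this
    _ = C := by simp

lemma ofReal_expectedCoveringNumber (hF : IsPredictorClass F) (a : Fin K) (T : ℕ) (hε : 0 < ε) :
    ENNReal.ofReal (expectedCoveringNumber ν T (actionClass F a) ε) =
      ∫⁻ z, (coveringNumber (actionClass F a) ε z : ℝ≥0∞) ∂(Measure.pi fun _ : Fin T => ν) :=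
  ENNReal.ofReal_toReal (lintegral_coveringNumber_ne_top hF a T hε)

lemma one_le_expectedCoveringNumber (hF : IsPredictorClass F) (hne : F.Nonempty) (a : Fin K)
    (T : ℕ) (hε : 0 < ε) : 1 ≤ expectedCoveringNumber ν T (actionClass F a) ε := by
  have h1 : ∀ z : Fin T → X, (1 : ℕ∞) ≤ coveringNumber (actionClass F a) ε z := fun z => by
    refine le_iInf₂ fun V hV => ?_
    obtain ⟨f, hf⟩ := hne
    obtain ⟨v, hv, -⟩ := hV _ ⟨f, hf, rfl⟩
    exact_mod_cast Finset.card_pos.2 ⟨v, hv⟩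
  have h2 : (1 : ℝ≥0∞) ≤ ∫⁻ z, (coveringNumber (actionClass F a) ε z : ℝ≥0∞)
      ∂(Measure.pi fun _ : Fin T => ν) := by
    calc (1 : ℝ≥0∞) = ∫⁻ _, 1 ∂(Measure.pi fun _ : Fin T => ν) := by simp
      _ ≤ _ := lintegral_mono fun z => by
          have := ENat.toENNReal_le.2 (h1 z)
          simpa using this
  have := ENNReal.toReal_mono (lintegral_coveringNumber_ne_top hF a T hε) h2
  simpa [expectedCoveringNumber] using this

/-- Markov's inequality for the size of a rational cover. -/
lemma measure_forall_notMem_ratCoverSet_le (hF : IsPredictorClass F)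
    (hp : IsPointwiseMeasurable F) (a : Fin K) (hT : 1 ≤ T) (hε : 0 < ε) (B : ℕ) :
    (B + 1) * (Measure.pi fun _ : Fin T => ν) {z | ∀ V : Finset (Fin T → ℚ), V.card ≤ B →
        z ∉ ratCoverSet (actionClass F a) (2 * ε * T) V} ≤
      ENNReal.ofReal (expectedCoveringNumber ν T (actionClass F a) ε) := by
  obtain ⟨C, hC⟩ := exists_isL1Cover_card_eq T hε
  set E := {z : Fin T → X | ∀ V : Finset (Fin T → ℚ), V.card ≤ B →
        z ∉ ratCoverSet (actionClass F a) (2 * ε * T) V} with hE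
  -- The covering number itself may fail to be measurable; a measurable indicator below it suffices
  -- for Markov's inequality.
  have hEm : MeasurableSet E := by
    have : E = ⋂ V : Finset (Fin T → ℚ), ⋂ _ : V.card ≤ B,
        (ratCoverSet (actionClass F a) (2 * ε * T) V)ᶜ := by
      ext z; simp [hE]
    rw [this]
    exact MeasurableSet.iInter fun V => MeasurableSet.iInter fun _ =>
      (measurableSet_ratCoverSet hF hp a _ V).compl
  rw [ofReal_expectedCoveringNumber hF a T hε, ← lintegral_indicator_one hEm,
    ← lintegral_const_mul _ (measurable_one.indicator hEm)]
  refine lintegral_mono fun z => ?_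
  by_cases hz : z ∈ E
  · obtain ⟨V, hV, hcard⟩ := (hC (actionClass_mem_Icc hF (a := a)) z).2
    obtain ⟨V', hV', hzV⟩ := exists_mem_ratCoverSet hT hε hV
    have hlt : B + 1 ≤ V.card := by
      by_contra hlt
      exact hz V' (by omega) hzV
    rw [Set.indicator_of_mem hz, ← hcard]
    simp only [Pi.one_apply, mul_one, ENat.toENNReal_coe]
    exact_mod_cast hlt
  · simp [Set.indicator_of_notMem hz]

lemma measurableSet_bestRegion {fstar : Predictor X K} (hf : ∀ b, Measurable fun x => fstar x b)
    (lam : ℝ) (a : Fin K) : MeasurableSet (bestRegion fstar lam a) := by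
  have : bestRegion fstar lam a = ⋂ b, ⋂ _ : b ≠ a, {x | fstar x b + lam ≤ fstar x a} := by
    ext x; simp [bestRegion]
  rw [this]
  exact MeasurableSet.iInter fun b => MeasurableSet.iInter fun _ =>
    measurableSet_le ((hf b).add_const _) (hf a)

lemma measurable_regionError {fstar f : Predictor X K} (hs : ∀ b, Measurable fun x => fstar x b)
    (hf : ∀ b, Measurable fun x => f x b) (a : Fin K) : Measurable (regionError fstar f a) :=
  (((hf a).sub (hs a)).pow_const 2).indicator (measurableSet_bestRegion hs 0 a)

/-- Uniform deviation of the region errors at a single action, through the covering number. -/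
lemma measure_exists_regionError_deviation_le (hF : IsPredictorClass F) {F₀ : Set (Predictor X K)}
    (hF₀ : F₀ ⊆ F) (hcount : F₀.Countable) {fstar : Predictor X K} (hstar : fstar ∈ F)
    (a : Fin K) (hT : 1 ≤ T) (hε : 0 < ε) {n : ℕ} (hn : 2 * n ≤ T) (u : ℝ) :
    (Measure.pi fun _ : Fin T => ν) {z | ∃ f ∈ F₀, u ≤ (n * (∫ x, regionError fstar f a x ∂ν) / 2 -
        ∑ j : Fin n, regionError fstar f a (z (sampleIdx hn j))) / 4} ≤
      ENNReal.ofReal (Real.exp (ε * T / 2 - u)) *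
        ENNReal.ofReal (expectedCoveringNumber ν T (actionClass F a) ε) := by
  classical
  have hc : Countable F₀ := hcount.to_subtype
  obtain ⟨C, hC⟩ := exists_isL1Cover_card_eq T hε
  -- A cover of the predictors becomes one of the squared errors after truncation, at twice the
  -- error since squaring is 2-Lipschitz here. Thus `η = 2 * (T * ε)`, and `η / 4` is the `ε * T /
  -- 2` of the statement.
  have key := measure_pi_exists_deviation_le (ν := ν) hn (h := fun f : F₀ => regionError fstar f a)
    (fun f => measurable_regionError (fun b => (hF _ hstar b).1)
      (fun b => (hF _ (hF₀ f.2) b).1) a)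
    (fun f x => regionError_mem_Icc (hF _ hstar a).2 (hF _ (hF₀ f.2) a).2 x)
    (N := fun z => (coveringNumber (actionClass F a) ε z : ℝ≥0∞)) (η := 2 * (T * ε))
    (fun z => by
      obtain ⟨V, hV, hcard⟩ := (hC (actionClass_mem_Icc hF (a := a)) z).2
      refine ⟨V.image fun v t => if z t ∈ bestRegion fstar 0 a then
        (clip (v t) - fstar (z t) a) ^ 2 else 0, ?_, ?_, ?_⟩
      · rw [← hcard]
        simp only [ENat.toENNReal_coe, Nat.cast_le]
        exact Finset.card_image_le
      · intro w hw t
        obtain ⟨v, -, rfl⟩ := Finset.mem_image.1 hw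
        dsimp only
        split_ifs
        · exact sq_sub_mem_Icc (clip_mem _) ((hF _ hstar a).2 _)
        · simp
      · intro f
        obtain ⟨v, hv, hfv⟩ := hV _ ⟨f, hF₀ f.2, rfl⟩
        refine ⟨_, Finset.mem_image_of_mem _ hv, ?_⟩
        have h1 := sum_le_of_avg_le hT hfv
        calc _ ≤ ∑ t, 2 * |(f : Predictor X K) (z t) a - v t| := by
              refine Finset.sum_le_sum fun t _ => ?_
              have hft := (hF _ (hF₀ f.2) a).2 (z t)
              simp only [regionError, Set.indicator]
              split_ifs
              · exact (abs_sq_sub_sq_le hft (clip_mem _) ((hF _ hstar a).2 _)).trans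
                  (mul_le_mul_of_nonneg_left (abs_sub_clip_le hft) (by norm_num))
              · simp
          _ ≤ _ := by
              rw [← Finset.mul_sum]
              linarith) u
  rw [ofReal_expectedCoveringNumber hF a T hε]
  refine (measure_mono ?_).trans (key.trans (le_of_eq ?_))
  · rintro z ⟨f, hf, hz⟩
    exact ⟨⟨f, hf⟩, hz⟩
  · ring_nf

end Cover

/-! ### The good event -/

/-- The integrand of `exploredError`. -/
def exploredSq {X : Type*} {K : ℕ} (fstar f : Predictor X K) (x : X) : ℝ :=
  (1 / (K : ℝ)) * ∑ a, regionError fstar f a x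

lemma exploredError_eq {X : Type*} [MeasurableSpace X] {K : ℕ} (ν : Measure X)
    (fstar f : Predictor X K) :
    exploredError ν fstar 0 f = ∫ x, exploredSq fstar f x ∂ν := rfl

section Explored

variable {X : Type*} {K : ℕ} {fstar f : Predictor X K}

lemma exploredSq_mem_Icc (hs : ∀ x a, fstar x a ∈ Set.Icc (0 : ℝ) 1)
    (hf : ∀ x a, f x a ∈ Set.Icc (0 : ℝ) 1) (x : X) : exploredSq fstar f x ∈ Set.Icc (0 : ℝ) 1 := by
  have h := fun a => regionError_mem_Icc (fun x => hs x a) (fun x => hf x a) x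
  refine ⟨mul_nonneg (by positivity) (Finset.sum_nonneg fun a _ => (h a).1), ?_⟩
  rcases Nat.eq_zero_or_pos K with rfl | hK
  · simp [exploredSq]
  · have hK' : (0 : ℝ) < K := by exact_mod_cast hK
    rw [exploredSq, one_div, inv_mul_le_iff₀ hK']
    calc _ ≤ ∑ _a : Fin K, (1 : ℝ) := Finset.sum_le_sum fun a _ => (h a).2
      _ = K * 1 := by simp

lemma tendsto_exploredSq {w : ℕ → Predictor X K}
    (hw : ∀ x a, Filter.Tendsto (fun n => w n x a) Filter.atTop (nhds (f x a))) (x : X) :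
    Filter.Tendsto (fun n => exploredSq fstar (w n) x) Filter.atTop
      (nhds (exploredSq fstar f x)) := by
  refine Filter.Tendsto.const_mul _ (tendsto_finsetSum _ fun a _ => ?_)
  unfold regionError Set.indicator
  split_ifs
  · exact ((hw x a).sub_const _).pow 2
  · exact tendsto_const_nhds

variable [MeasurableSpace X]

lemma measurable_exploredSq (hs : ∀ b, Measurable fun x => fstar x b)
    (hf : ∀ b, Measurable fun x => f x b) : Measurable (exploredSq fstar f) :=
  (Finset.measurable_fun_sum _ fun a _ => measurable_regionError hs hf a).const_mul _

lemma integral_exploredSq {ν : Measure X} [IsProbabilityMeasure ν]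
    (hs : ∀ b, Measurable fun x => fstar x b) (hf : ∀ b, Measurable fun x => f x b)
    (hs1 : ∀ x a, fstar x a ∈ Set.Icc (0 : ℝ) 1) (hf1 : ∀ x a, f x a ∈ Set.Icc (0 : ℝ) 1) :
    exploredError ν fstar 0 f = (1 / (K : ℝ)) * ∑ a, ∫ x, regionError fstar f a x ∂ν := by
  rw [exploredError_eq]
  unfold exploredSq
  rw [integral_const_mul, integral_finsetSum]
  exact fun a _ => Integrable.of_mem_Icc 0 1 (measurable_regionError hs hf a).aemeasurable
    (ae_of_all _ fun x => regionError_mem_Icc (fun x => hs1 x a) (fun x => hf1 x a) x)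

lemma tendsto_exploredError {ν : Measure X} [IsProbabilityMeasure ν] {w : ℕ → Predictor X K}
    (hs : ∀ b, Measurable fun x => fstar x b) (hs1 : ∀ x a, fstar x a ∈ Set.Icc (0 : ℝ) 1)
    (hwm : ∀ n b, Measurable fun x => w n x b) (hw1 : ∀ n x a, w n x a ∈ Set.Icc (0 : ℝ) 1)
    (hw : ∀ x a, Filter.Tendsto (fun n => w n x a) Filter.atTop (nhds (f x a))) :
    Filter.Tendsto (fun n => exploredError ν fstar 0 (w n)) Filter.atTop
      (nhds (exploredError ν fstar 0 f)) := by
  simp_rw [exploredError_eq]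
  refine tendsto_integral_of_dominated_convergence (fun _ => 1)
    (fun n => (measurable_exploredSq hs (hwm n)).aestronglyMeasurable) (integrable_const _)
    (fun n => ae_of_all _ fun x => ?_) (ae_of_all _ fun x => tendsto_exploredSq hw x)
  have := exploredSq_mem_Icc hs1 (hw1 n) x
  rw [Real.norm_eq_abs, abs_of_nonneg this.1]
  exact this.2

end Explored

lemma two_mul_epochStart_pred {m : ℕ} (hm : 2 ≤ m) : 2 * epochStart (m - 1) = epochStart m := by
  rw [← epochStart_succ (by omega)]
  congr 1
  omega

/-- Only the first `τ_m / 2` rounds are used as the sample, so that a ghost sample of equal size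
still fits into the `T` contexts on which the covering numbers are taken. The shift by 1 reconciles
rounds starting at 1 with coordinates starting at 0. -/
lemma sum_sampleIdx_le {X : Type*} {T m : ℕ} (hm : 2 ≤ m) (hn : 2 * epochStart (m - 1) ≤ T)
    {g : X → ℝ}
    (hg : ∀ x, 0 ≤ g x) (y : ℕ → X) :
    ∑ j : Fin (epochStart (m - 1)), g (y (sampleIdx hn j + 1)) ≤
      ∑ s ∈ Finset.Ico 1 (epochStart m), g (y s) := by
  have h1 := one_le_epochStart (m - 1)
  have h2 := two_mul_epochStart_pred hm
  calc _ = ∑ s ∈ Finset.range (epochStart (m - 1)), g (y (s + 1)) := by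
        rw [Finset.sum_range]; rfl
    _ ≤ ∑ s ∈ Finset.range (epochStart m - 1), g (y (s + 1)) :=
        Finset.sum_le_sum_of_subset_of_nonneg (Finset.range_mono (by omega)) fun _ _ _ => hg _
    _ = _ := by
        rw [Finset.sum_Ico_eq_sum_range]
        simp_rw [add_comm 1]

lemma numEpochs_le {T : ℕ} (hT : 2 ≤ T) : numEpochs T ≤ T := Nat.log_lt_self 2 (by omega)

lemma one_le_numEpochs {T : ℕ} : 1 ≤ numEpochs T := by simp [numEpochs]

/-- The argument on the left is at most the square of the one in `finiteConst`, which accounts for 8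
against 16. -/
lemma log_le_finiteConst {X : Type*} {K T : ℕ} {F : Set (Predictor X K)} (hT : 2 ≤ T)
    (hne : F.Nonempty) (hfin : F.Finite) {δ : ℝ}
    (hδ : 0 < δ) (hδ1 : δ < 1) :
    8 * Real.log (8 * (F.ncard * numEpochs T : ℕ) / δ) ≤ finiteConst F T δ := by
  have hn : (1 : ℝ) ≤ F.ncard := by exact_mod_cast (Set.ncard_pos hfin).2 hne
  have hT' : (2 : ℝ) ≤ T := by exact_mod_cast hT
  have hM : (numEpochs T : ℝ) ≤ T := by exact_mod_cast numEpochs_le hT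
  have hM1 : (1 : ℝ) ≤ numEpochs T := by exact_mod_cast one_le_numEpochs
  have hn0 : (0 : ℝ) < F.ncard := by linarith
  have hM0 : (0 : ℝ) < numEpochs T := by linarith
  have hT0 : (0 : ℝ) < T := by linarith
  have hpos : 0 < 2 * F.ncard * (T : ℝ) ^ 2 / δ := by positivity
  have hle : 8 * (F.ncard * numEpochs T : ℕ) / δ ≤ (2 * F.ncard * (T : ℝ) ^ 2 / δ) ^ 2 := by
    rw [div_pow, div_le_div_iff₀ hδ (by positivity)]
    push_cast
    have h1 : (numEpochs T : ℝ) * 2 ≤ (T : ℝ) ^ 4 := by nlinarith [sq_nonneg ((T : ℝ) ^ 2 - 4)]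
    have h2 : (F.ncard : ℝ) * numEpochs T * 2 ≤ F.ncard ^ 2 * (T : ℝ) ^ 4 := by
      calc _ = (F.ncard : ℝ) * (numEpochs T * 2) := by ring
        _ ≤ F.ncard ^ 2 * (T : ℝ) ^ 4 := by
            apply mul_le_mul _ h1 (by positivity) (by positivity)
            nlinarith
    have h3 : δ ^ 2 ≤ δ := by nlinarith
    calc 8 * ((F.ncard : ℝ) * numEpochs T) * δ ^ 2 = 4 * (F.ncard * numEpochs T * 2) * δ ^ 2 := by
          ring
      _ ≤ 4 * (F.ncard ^ 2 * (T : ℝ) ^ 4) * δ := by gcongr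
      _ = _ := by ring
  have := Real.log_le_log (by push_cast; positivity) hle
  rw [Real.log_pow] at this
  unfold finiteConst
  push_cast at this ⊢
  linarith

section Good

variable {Ω X : Type*} [m0 : MeasurableSpace Ω] [mX : MeasurableSpace X] {K : ℕ}
  {μ : Measure Ω} {D : Measure (X × (Fin K → ℝ))} {F : Set (Predictor X K)} {β : ℕ → ℝ} {T : ℕ}
  {x : ℕ → Ω → X} {r : ℕ → Ω → Fin K → ℝ} {a : ℕ → Ω → Fin K}
  {fstar : Predictor X K}

/-- The deviation bound for the square losses. -/
def LossesConcentrate (μ : Measure Ω) (F : Set (Predictor X K)) (fstar : Predictor X K) (T : ℕ)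
    (x : ℕ → Ω → X) (r : ℕ → Ω → Fin K → ℝ) (a : ℕ → Ω → Fin K) (c : ℝ) (ω : Ω) : Prop :=
  ∀ f ∈ F, ∀ m ∈ Finset.Icc 1 (numEpochs T),
    ∑ s ∈ Finset.Ico 1 (epochStart m), deviation μ fstar f x r a s ω ≤ c

/-- The deviation bound for the explored errors. -/
def ErrorsConcentrate (ν : Measure X) (F : Set (Predictor X K)) (fstar : Predictor X K) (T : ℕ)
    (x : ℕ → Ω → X) (c : ℝ) (ω : Ω) : Prop :=
  ∀ f ∈ F, ∀ m ∈ Finset.Icc 2 (numEpochs T),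
    epochStart (m - 1) * exploredError ν fstar 0 f ≤
      2 * ∑ s ∈ Finset.Ico 1 (epochStart m), exploredSq fstar f (x s ω) + 2 * c

lemma IsEliminationRun.measure_preimage_contexts_le [IsProbabilityMeasure μ]
    [IsProbabilityMeasure D] (h : IsEliminationRun μ D F β T x r a) (S : Set (Fin T → X)) :
    μ {ω | (fun t : Fin T => x (t + 1) ω) ∈ S} ≤ (Measure.pi fun _ => D.map Prod.fst) S := by
  have hν : IsProbabilityMeasure (D.map Prod.fst) :=
    Measure.isProbabilityMeasure_map measurable_fst.aemeasurable
  rw [← h.isIidContexts.map_eq_pi]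
  exact Measure.le_map_apply
    (measurable_pi_lambda _ fun t => h.measurable_context _).aemeasurable S

lemma IsEliminationRun.measure_not_lossesConcentrate_finite_le [IsProbabilityMeasure μ]
    [IsProbabilityMeasure D] (h : IsEliminationRun μ D F β T x r a) (hT : 1 ≤ T)
    (hu : HasUnitRewards D) (hr : IsRealizedBy D F fstar) (hF : IsPredictorClass F)
    (hfin : F.Finite) (u : ℝ) :
    μ {ω | ¬ LossesConcentrate μ F fstar T x r a u ω} ≤
      (F.ncard * numEpochs T : ℕ) * ENNReal.ofReal (Real.exp (-u)) := by
  have : Fintype F := hfin.fintype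
  have key := h.measure_exists_deviation_le (J := Unit) (κ := F) hT hu hr hF
    (v := fun f _ => f) (fun f _ b => (hF _ f.2 b).1) (fun f _ x b => (hF _ f.2 b).2 x)
    (S := fun _ => Set.univ) (fun _ => MeasurableSet.univ)
    (fun i j hij => (hij rfl).elim) (fun _ => Finset.univ) (B := F.ncard)
    (fun _ => by rw [Finset.card_univ, ← Nat.card_eq_fintype_card]; rfl) u
  refine (measure_mono ?_).trans key
  intro ω hω
  simp only [LossesConcentrate, not_forall, not_le] at hω
  obtain ⟨f, hf, m, hm, hlt⟩ := hω
  exact ⟨(), Set.mem_univ _, ⟨f, hf⟩, Finset.mem_univ _, m, hm, hlt.le⟩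

/-- Each predictor is treated as a class of one function with an exact one-vector cover (`η = 0`); a
union bound over predictors and epochs does the rest. -/
lemma IsEliminationRun.measure_not_errorsConcentrate_finite_le [IsProbabilityMeasure μ]
    [IsProbabilityMeasure D] (h : IsEliminationRun μ D F β T x r a) (hT : 1 ≤ T)
    (hr : IsRealizedBy D F fstar) (hF : IsPredictorClass F) (hfin : F.Finite) (u : ℝ) :
    μ {ω | ¬ ErrorsConcentrate (D.map Prod.fst) F fstar T x (4 * u) ω} ≤
      (F.ncard * numEpochs T : ℕ) * ENNReal.ofReal (Real.exp (-u)) := by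
  have hν : IsProbabilityMeasure (D.map Prod.fst) :=
    Measure.isProbabilityMeasure_map measurable_fst.aemeasurable
  set ν := D.map Prod.fst
  have hs := fun b => (hF _ hr.1 b).1
  have hs1 := fun x b => (hF _ hr.1 b).2 x
  set E : Predictor X K → ℕ → Set Ω := fun f m => {ω | epochStart (m - 1) *
    exploredError ν fstar 0 f > 2 * ∑ s ∈ Finset.Ico 1 (epochStart m),
      exploredSq fstar f (x s ω) + 2 * (4 * u)} with hE
  have hE1 : ∀ f ∈ F, ∀ m ∈ Finset.Icc 2 (numEpochs T),
      μ (E f m) ≤ ENNReal.ofReal (Real.exp (-u)) := by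
    intro f hf m hm
    rw [Finset.mem_Icc] at hm
    have hn : 2 * epochStart (m - 1) ≤ T := by
      rw [two_mul_epochStart_pred hm.1]; exact epochStart_le hT hm.2
    have hf1 := fun x b => (hF _ hf b).2 x
    have key := measure_pi_exists_deviation_le (ν := ν) hn (ι := Unit) (h :=
        fun _ => exploredSq fstar f)
      (fun _ => measurable_exploredSq hs fun b => (hF _ hf b).1)
      (fun _ x => exploredSq_mem_Icc hs1 hf1 x) (N := fun _ => 1) (η := 0)
      (fun z => ⟨{fun t => exploredSq fstar f (z t)}, by simp,
        by simpa using fun t => exploredSq_mem_Icc hs1 hf1 (z t), by simp⟩) u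
    calc μ (E f m) ≤ _ := measure_mono ?_
      _ ≤ _ := h.measure_preimage_contexts_le _
      _ ≤ _ := key
      _ = _ := by simp
    intro ω hω
    refine ⟨(), ?_⟩
    have h1 := sum_sampleIdx_le hm.1 hn (fun x => (exploredSq_mem_Icc hs1 hf1 x).1)
      (fun s => x s ω)
    have h2 : 2 * ∑ s ∈ Finset.Ico 1 (epochStart m), exploredSq fstar f (x s ω) + 2 * (4 * u) <
      epochStart (m - 1) * exploredError ν fstar 0 f := hω
    rw [exploredError_eq] at h2
    dsimp only at h1 ⊢
    linarith
  have hsub : {ω | ¬ ErrorsConcentrate ν F fstar T x (4 * u) ω} ⊆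
      ⋃ f ∈ hfin.toFinset, ⋃ m ∈ Finset.Icc 2 (numEpochs T), E f m := by
    intro ω hω
    simp only [ErrorsConcentrate, not_forall, not_le] at hω
    obtain ⟨f, hf, m, hm, hlt⟩ := hω
    simp only [Set.mem_iUnion]
    exact ⟨f, by simpa using hf, m, hm, hlt⟩
  calc _ ≤ _ := measure_mono hsub
    _ ≤ ∑ f ∈ hfin.toFinset, ∑ m ∈ Finset.Icc 2 (numEpochs T), μ (E f m) :=
        (measure_biUnion_finset_le _ _).trans
          (Finset.sum_le_sum fun f _ => measure_biUnion_finset_le _ _)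
    _ ≤ ∑ f ∈ hfin.toFinset, ∑ m ∈ Finset.Icc 2 (numEpochs T), ENNReal.ofReal (Real.exp (-u)) :=
        Finset.sum_le_sum fun f hf => Finset.sum_le_sum fun m hm => hE1 f (by simpa using hf) m hm
    _ = (F.ncard * (numEpochs T - 1) : ℕ) * ENNReal.ofReal (Real.exp (-u)) := by
        simp only [Finset.sum_const, nsmul_eq_mul, Nat.card_Icc, Set.ncard_eq_toFinset_card F hfin]
        push_cast
        ring
    _ ≤ _ := by
        gcongr
        exact Nat.sub_le _ _

/-- The good event for a finite class. -/
lemma IsEliminationRun.measure_not_concentrate_finite_le [IsProbabilityMeasure μ]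
    [IsProbabilityMeasure D] (h : IsEliminationRun μ D F β T x r a) (hT : 2 ≤ T)
    (hu : HasUnitRewards D) (hr : IsRealizedBy D F fstar) (hF : IsPredictorClass F)
    (hfin : F.Finite) {δ : ℝ} (hδ : 0 < δ) (hδ1 : δ < 1) {c : ℝ} (hc : finiteConst F T δ ≤ c) :
    μ {ω | ¬ (LossesConcentrate μ F fstar T x r a c ω ∧
      ErrorsConcentrate (D.map Prod.fst) F fstar T x c ω)} ≤ ENNReal.ofReal (δ / 2) := by
  have hne : F.Nonempty := ⟨_, hr.1⟩
  set u := Real.log (8 * (F.ncard * numEpochs T : ℕ) / δ) with hu'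
  have hn : 1 ≤ F.ncard * numEpochs T :=
    Nat.mul_pos ((Set.ncard_pos hfin).2 hne) one_le_numEpochs
  have hn' : (1 : ℝ) ≤ (F.ncard * numEpochs T : ℕ) := by exact_mod_cast hn
  have hu0 : 0 ≤ u := Real.log_nonneg (by rw [le_div_iff₀ hδ]; linarith)
  have huc : 8 * u ≤ c := (log_le_finiteConst hT hne hfin hδ hδ1).trans hc
  have hexp : ((F.ncard * numEpochs T : ℕ) : ℝ≥0∞) * ENNReal.ofReal (Real.exp (-u)) =
      ENNReal.ofReal (δ / 8) := by
    rw [← ENNReal.ofReal_natCast, ← ENNReal.ofReal_mul (by positivity), Real.exp_neg, hu',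
      Real.exp_log (by positivity)]
    congr 1
    field_simp
  have hsub : {ω | ¬ (LossesConcentrate μ F fstar T x r a c ω ∧
      ErrorsConcentrate (D.map Prod.fst) F fstar T x c ω)} ⊆
      {ω | ¬ LossesConcentrate μ F fstar T x r a u ω} ∪
        {ω | ¬ ErrorsConcentrate (D.map Prod.fst) F fstar T x (4 * u) ω} := by
    intro ω hω
    by_contra hcon
    simp only [Set.mem_union, Set.mem_ofPred_eq, not_or, not_not] at hcon
    refine hω ⟨fun f hf m hm => (hcon.1 f hf m hm).trans (by linarith),
      fun f hf m hm => (hcon.2 f hf m hm).trans (by linarith)⟩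
  calc _ ≤ _ := (measure_mono hsub).trans (measure_union_le _ _)
    _ ≤ ENNReal.ofReal (δ / 8) + ENNReal.ofReal (δ / 8) := by
        rw [← hexp]
        exact add_le_add
          (h.measure_not_lossesConcentrate_finite_le (by omega) hu hr hF hfin u)
          (h.measure_not_errorsConcentrate_finite_le (by omega) hr hF hfin u)
    _ ≤ _ := by
        rw [← ENNReal.ofReal_add (by positivity) (by positivity)]
        exact ENNReal.ofReal_le_ofReal (by linarith)

end Good

/-! ### The good event through covering numbers -/

section VectorPredictor

variable {X : Type*} {K T : ℕ}

/-- The time-dependent predictor with the truncated values `q`. -/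
def vectorPredictor (q : Fin K → Fin T → ℚ) (s : ℕ) : Predictor X K :=
  fun _ b => if h : s - 1 < T then clip (q b ⟨s - 1, h⟩) else 0

lemma vectorPredictor_mem_Icc (q : Fin K → Fin T → ℚ) (s : ℕ) (y : X) (b : Fin K) :
    vectorPredictor q s y b ∈ Set.Icc (0 : ℝ) 1 := by
  unfold vectorPredictor
  split_ifs
  · exact clip_mem _
  · simp

lemma sum_abs_sub_vectorPredictor_le {f : Predictor X K}
    (hf1 : ∀ y b, f y b ∈ Set.Icc (0 : ℝ) 1) {q : Fin K → Fin T → ℚ} {η : ℝ} (y : ℕ → X)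
    (hq : ∀ b, ∑ t : Fin T, |f (y (t + 1)) b - (q b t : ℝ)| ≤ η) {n : ℕ} (hn : n ≤ T) (hn1 : 1 ≤
        n) :
    ∑ s ∈ Finset.Ico 1 n, ∑ b, |f (y s) b - vectorPredictor q s (y s) b| ≤ K * η := by
  rw [Finset.sum_comm]
  calc _ ≤ ∑ _b : Fin K, η := Finset.sum_le_sum fun b _ => le_trans ?_ (hq b)
    _ = K * η := by simp
  calc _ = ∑ s ∈ Finset.range (n - 1), |f (y (s + 1)) b - vectorPredictor q (s + 1) (y
      (s + 1)) b| := by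
        rw [Finset.sum_Ico_eq_sum_range]
        simp_rw [add_comm 1]
    _ ≤ ∑ s ∈ Finset.range T, |f (y (s + 1)) b - vectorPredictor q (s + 1) (y (s + 1)) b| :=
        Finset.sum_le_sum_of_subset_of_nonneg (Finset.range_mono (by omega))
          fun _ _ _ => abs_nonneg _
    _ = ∑ t : Fin T, |f (y (t + 1)) b - vectorPredictor q (t + 1) (y (t + 1)) b| := by
        rw [Finset.sum_range]
    _ ≤ _ := by
        refine Finset.sum_le_sum fun t _ => ?_
        simp only [vectorPredictor, Nat.add_sub_cancel, Fin.is_lt, dite_true, Fin.eta]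
        exact abs_sub_clip_le (hf1 _ b)

end VectorPredictor

section CoverGood

variable {Ω X : Type*} [m0 : MeasurableSpace Ω] [mX : MeasurableSpace X] {K : ℕ}
  {μ : Measure Ω} {D : Measure (X × (Fin K → ℝ))} {F : Set (Predictor X K)} {β : ℕ → ℝ} {T : ℕ}
  {x : ℕ → Ω → X} {r : ℕ → Ω → Fin K → ℝ} {a : ℕ → Ω → Fin K}
  {fstar : Predictor X K}

lemma IsEliminationRun.ae_regular [IsProbabilityMeasure μ] (h : IsEliminationRun μ D F β T x r a)
    (hu : HasUnitRewards D) :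
    ∀ᵐ ω ∂μ, ∀ s ∈ Set.Icc 1 T, (∀ b, r s ω b ∈ Set.Icc (0 : ℝ) 1) ∧
      ∀ b, actionProb (history x r a s) μ (x s) (a s) b ω ∈ Set.Icc (0 : ℝ) 1 := by
  rw [ae_all_iff]
  intro s
  by_cases hs : s ∈ Set.Icc 1 T
  · filter_upwards [(h.isRound hs).ae_env hu, (h.isRound hs).sum_actionProb,
      ae_all_iff.2 fun b => actionProb_nonneg (m := history x r a s) (μ := μ) (A := a s) (x s) b]
      with ω h1 h2 h3 _
    refine ⟨h1, fun b => ⟨h3 b, ?_⟩⟩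
    rw [← h2]
    exact Finset.single_le_sum (f := fun b => actionProb (history x r a s) μ (x s) (a s) b ω)
      (fun b _ => h3 b) (Finset.mem_univ b)
  · exact ae_of_all _ fun ω hs' => (hs hs').elim

/-- The deviation is Lipschitz in the predictor. -/
lemma deviation_le_add {f v : Predictor X K} {s : ℕ} {ω : Ω}
    (hs1 : ∀ b, fstar (x s ω) b ∈ Set.Icc (0 : ℝ) 1) (hf1 : ∀ b, f (x s ω) b ∈ Set.Icc (0 : ℝ) 1)
    (hv1 : ∀ b, v (x s ω) b ∈ Set.Icc (0 : ℝ) 1) (hr1 : ∀ b, r s ω b ∈ Set.Icc (0 : ℝ) 1)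
    (hp : ∀ b, actionProb (history x r a s) μ (x s) (a s) b ω ∈ Set.Icc (0 : ℝ) 1) :
    deviation μ fstar f x r a s ω ≤ deviation μ fstar v x r a s ω +
      5 / 2 * ∑ b, |f (x s ω) b - v (x s ω) b| := by
  have h1 : -excess fstar f (x s ω, r s ω) (a s ω) ≤ -excess fstar v (x s ω, r s ω) (a s ω) +
      2 * ∑ b, |f (x s ω) b - v (x s ω) b| := by
    have h2 := abs_sq_sub_sq_le (hf1 (a s ω)) (hv1 (a s ω)) (hr1 (a s ω))
    have h3 := Finset.single_le_sum (f := fun b => |f (x s ω) b - v (x s ω) b|)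
      (fun b _ => abs_nonneg _) (Finset.mem_univ (a s ω))
    have h4 := (abs_le.1 h2).1
    simp only [excess]
    linarith
  have h2 : condError (history x r a s) μ fstar f (x s) (a s) ω ≤
      condError (history x r a s) μ fstar v (x s) (a s) ω +
        2 * ∑ b, |f (x s ω) b - v (x s ω) b| := by
    unfold condError
    rw [Finset.mul_sum, ← Finset.sum_add_distrib]
    refine Finset.sum_le_sum fun b _ => ?_
    have h3 := (abs_le.1 (abs_sq_sub_sq_le (hf1 b) (hv1 b) (hs1 b))).2
    have h4 := abs_nonneg (f (x s ω) b - v (x s ω) b)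
    nlinarith [(hp b).1, (hp b).2]
  unfold deviation
  linarith

/-- A choice of one vector per action is used as a sequence of predictors that ignore the context,
to which the one-step inequality applies. The error `5/2 * (K * η)` is the price of replacing `f` by
its vectors, by `deviation_le_add`. -/
lemma IsEliminationRun.measure_not_lossesConcentrate_cover_le [IsProbabilityMeasure μ]
    [IsProbabilityMeasure D] (h : IsEliminationRun μ D F β T x r a) (hT : 1 ≤ T)
    (hu : HasUnitRewards D) (hr : IsRealizedBy D F fstar) (hF : IsPredictorClass F)
    (hp : IsPointwiseMeasurable F) (η : ℝ) (B : Fin K → ℕ) (u : ℝ) :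
    μ {ω | (∀ b, ∃ V : Finset (Fin T → ℚ), V.card ≤ B b ∧
        (fun t : Fin T => x (t + 1) ω) ∈ ratCoverSet (actionClass F b) η V) ∧
        ¬ LossesConcentrate μ F fstar T x r a (u + 5 / 2 * (K * η)) ω} ≤
      ((∏ b, B b) * numEpochs T : ℕ) * ENNReal.ofReal (Real.exp (-u)) := by
  classical
  set J := ∀ b : Fin K, {V : Finset (Fin T → ℚ) // V.card ≤ B b}
  have hJ : Encodable J := Encodable.ofCountable J
  set A : J → Set (Fin T → X) := fun j => ⋂ b, ratCoverSet (actionClass F b) η (j b).1 with hA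
  have hAm : ∀ j, MeasurableSet (A j) := fun j =>
    MeasurableSet.iInter fun b => measurableSet_ratCoverSet hF hp b η _
  -- Each context sequence is assigned to the first tuple of covers, in a fixed enumeration, that
  -- works for it.
  set S : J → Set (Fin T → X) := fun j =>
    A j \ ⋃ i : J, ⋃ _ : Encodable.encode i < Encodable.encode j, A i with hS
  have hSm : ∀ j, MeasurableSet (S j) := fun j =>
    (hAm j).diff (MeasurableSet.iUnion fun i => MeasurableSet.iUnion fun _ => hAm i)
  have hdisj : Pairwise fun i j => Disjoint (S i) (S j) := by
    intro i j hij
    rw [Set.disjoint_left]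
    rintro z ⟨hi, hi'⟩ ⟨hj, hj'⟩
    simp only [Set.mem_iUnion, not_exists] at hi' hj'
    rcases lt_trichotomy (Encodable.encode i) (Encodable.encode j) with hlt | heq | hlt
    · exact hj' i hlt hi
    · exact hij (Encodable.encode_injective heq)
    · exact hi' j hlt hj
  have key := h.measure_exists_deviation_le hT hu hr hF (v := fun q => vectorPredictor q)
    (fun q s b => by unfold vectorPredictor; exact measurable_const)
    (fun q s y b => vectorPredictor_mem_Icc q s y b) hSm hdisj
    (fun j => Fintype.piFinset fun b => (j b).1) (B := ∏ b, B b)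
    (fun j => by
      rw [Fintype.card_piFinset]
      exact Finset.prod_le_prod' fun b _ => (j b).2) u
  refine le_trans (measure_mono_ae ?_) key
  filter_upwards [h.ae_regular hu] with ω hreg hω
  obtain ⟨hcov, hbad⟩ := hω
  choose V hVc hV using hcov
  have hex : ∃ n, ∃ j : J, Encodable.encode j = n ∧ (fun t : Fin T => x (t + 1) ω) ∈ A j :=
    ⟨_, fun b => ⟨V b, hVc b⟩, rfl, Set.mem_iInter.2 hV⟩
  obtain ⟨j, hj, hjA⟩ := Nat.find_spec hex
  have hjS : (fun t : Fin T => x (t + 1) ω) ∈ S j := by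
    refine ⟨hjA, ?_⟩
    simp only [Set.mem_iUnion, not_exists]
    intro i hi hiA
    exact Nat.find_min hex (hj ▸ hi) ⟨i, rfl, hiA⟩
  simp only [LossesConcentrate, not_forall, not_le] at hbad
  obtain ⟨f, hf, m, hm, hlt⟩ := hbad
  have hq : ∀ b, ∃ q ∈ (j b).1, ∑ t : Fin T, |f (x (t + 1) ω) b - (q t : ℝ)| ≤ η := fun b =>
    Set.mem_iInter.1 hjA b _ ⟨f, hf, rfl⟩
  choose q hqV hqη using hq
  refine ⟨j, hjS, q, Fintype.mem_piFinset.2 hqV, m, hm, ?_⟩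
  have hmT := epochStart_le hT (Finset.mem_Icc.1 hm).2
  have hf1 := fun y b => (hF _ hf b).2 y
  have hsum : ∑ s ∈ Finset.Ico 1 (epochStart m), deviation μ fstar f x r a s ω ≤
      ∑ s ∈ Finset.Ico 1 (epochStart m), (deviation μ fstar (vectorPredictor q s) x r a s ω +
        5 / 2 * ∑ b, |f (x s ω) b - vectorPredictor q s (x s ω) b|) := by
    refine Finset.sum_le_sum fun s hs => ?_
    rw [Finset.mem_Ico] at hs
    have hreg' := hreg s ⟨hs.1, by omega⟩
    exact deviation_le_add (fun b => (hF _ hr.1 b).2 _) (hf1 _)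
      (vectorPredictor_mem_Icc q s _) hreg'.1 hreg'.2
  rw [Finset.sum_add_distrib, ← Finset.mul_sum] at hsum
  have := sum_abs_sub_vectorPredictor_le hf1 (fun s => x s ω) hqη hmT (one_le_epochStart m)
  linarith

/-- The deviation bound is applied to each action separately, so the covers do not multiply, and the
actions are then averaged. It is proved on the countable subclass and extended to `F` by dominated
convergence. -/
lemma IsEliminationRun.measure_not_errorsConcentrate_cover_le [IsProbabilityMeasure μ]
    [IsProbabilityMeasure D] (h : IsEliminationRun μ D F β T x r a) (hT : 1 ≤ T)
    (hr : IsRealizedBy D F fstar) (hF : IsPredictorClass F) (hp : IsPointwiseMeasurable F)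
    {ε : ℝ} (hε : 0 < ε) (u : Fin K → ℝ) {c : ℝ} (hc : 4 * ∑ b, u b ≤ c) (hc0 : 0 ≤ c) :
    μ {ω | ¬ ErrorsConcentrate (D.map Prod.fst) F fstar T x c ω} ≤
      ∑ b, numEpochs T * (ENNReal.ofReal (Real.exp (ε * T / 2 - u b)) *
        ENNReal.ofReal (expectedCoveringNumber (D.map Prod.fst) T (actionClass F b) ε)) := by
  have hν : IsProbabilityMeasure (D.map Prod.fst) :=
    Measure.isProbabilityMeasure_map measurable_fst.aemeasurable
  set ν := D.map Prod.fst
  have hs := fun b => (hF _ hr.1 b).1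
  have hs1 := fun y b => (hF _ hr.1 b).2 y
  obtain ⟨F₀, hsub, hcount, hlim⟩ := hp
  set E : Fin K → ℕ → Set Ω := fun b m => {ω | ∃ f ∈ F₀,
    epochStart (m - 1) * (∫ y, regionError fstar f b y ∂ν) / 2 >
      ∑ s ∈ Finset.Ico 1 (epochStart m), regionError fstar f b (x s ω) + 4 * u b} with hE
  have hE1 : ∀ b, ∀ m ∈ Finset.Icc 2 (numEpochs T), μ (E b m) ≤
      ENNReal.ofReal (Real.exp (ε * T / 2 - u b)) *
        ENNReal.ofReal (expectedCoveringNumber ν T (actionClass F b) ε) := by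
    intro b m hm
    rw [Finset.mem_Icc] at hm
    have hn : 2 * epochStart (m - 1) ≤ T := by
      rw [two_mul_epochStart_pred hm.1]; exact epochStart_le hT hm.2
    refine (measure_mono ?_).trans ((h.measure_preimage_contexts_le _).trans
      (measure_exists_regionError_deviation_le hF hsub hcount hr.1 b hT hε hn (u b)))
    rintro ω ⟨f, hf, hlt⟩
    refine ⟨f, hf, ?_⟩
    have h1 := sum_sampleIdx_le hm.1 hn (g := regionError fstar f b) (fun y =>
      (regionError_mem_Icc (fun y => hs1 y b) (hF _ (hsub hf) b).2 y).1) (fun s => x s ω)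
    dsimp only at h1 ⊢
    linarith
  have hincl : {ω | ¬ ErrorsConcentrate ν F fstar T x c ω} ⊆
      ⋃ b ∈ Finset.univ, ⋃ m ∈ Finset.Icc 2 (numEpochs T), E b m := by
    intro ω hω
    by_contra hcon
    simp only [Set.mem_iUnion, not_exists, hE, Finset.mem_univ, Set.mem_ofPred_eq, not_and,
      not_lt, true_imp_iff] at hcon
    refine hω ?_
    have hF₀ : ∀ f ∈ F₀, ∀ m ∈ Finset.Icc 2 (numEpochs T),
        epochStart (m - 1) * exploredError ν fstar 0 f ≤
          2 * ∑ s ∈ Finset.Ico 1 (epochStart m), exploredSq fstar f (x s ω) + 2 * c := by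
      intro f hf m hm
      have hfm := fun b => (hF _ (hsub hf) b).1
      have hf1 := fun y b => (hF _ (hsub hf) b).2 y
      rw [integral_exploredSq hs hfm hs1 hf1]
      have h1 := Finset.sum_le_sum fun b (_ : b ∈ Finset.univ) => hcon b m hm f hf
      rw [Finset.sum_add_distrib, ← Finset.mul_sum, Finset.sum_comm, ← Finset.sum_div,
        ← Finset.mul_sum] at h1
      simp only [exploredSq, ← Finset.mul_sum]
      have hK : (1 / (K : ℝ)) * c ≤ c := by
        rcases Nat.eq_zero_or_pos K with rfl | hK
        · simpa using hc0
        · have : (1 : ℝ) ≤ K := by exact_mod_cast hK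
          rw [one_div, inv_mul_le_iff₀ (by linarith)]
          nlinarith
      have hK0 : (0 : ℝ) ≤ 1 / K := by positivity
      have h2 := mul_le_mul_of_nonneg_left (h1.trans (add_le_add le_rfl hc)) hK0
      rw [mul_add] at h2
      nlinarith
    intro f hf m hm
    obtain ⟨w, hw, hwl⟩ := hlim f hf
    refine le_of_tendsto_of_tendsto' ((tendsto_exploredError (ν := ν) hs hs1
      (fun n b => (hF _ (hsub (hw n)) b).1) (fun n y b => (hF _ (hsub (hw n)) b).2 y)
      hwl).const_mul _) (((tendsto_finsetSum _ fun s _ =>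
        tendsto_exploredSq hwl (x s ω)).const_mul 2).add_const _) fun n => hF₀ _ (hw n) m hm
  calc _ ≤ _ := measure_mono hincl
    _ ≤ ∑ b, ∑ m ∈ Finset.Icc 2 (numEpochs T), μ (E b m) :=
        (measure_biUnion_finset_le _ _).trans
          (Finset.sum_le_sum fun f _ => measure_biUnion_finset_le _ _)
    _ ≤ ∑ b, ∑ m ∈ Finset.Icc 2 (numEpochs T),
          (ENNReal.ofReal (Real.exp (ε * T / 2 - u b)) *
            ENNReal.ofReal (expectedCoveringNumber ν T (actionClass F b) ε)) :=
        Finset.sum_le_sum fun b _ => Finset.sum_le_sum fun m hm => hE1 b m hm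
    _ ≤ _ := by
        refine Finset.sum_le_sum fun b _ => ?_
        rw [Finset.sum_const, nsmul_eq_mul, Nat.card_Icc]
        gcongr
        omega

end CoverGood

/-! ### The confidence constant -/

lemma half_lt_log_two : (1 : ℝ) / 2 < Real.log 2 := by linarith [Real.log_two_gt_d9]

lemma half_lt_log {T : ℕ} (hT : 2 ≤ T) : (1 : ℝ) / 2 < Real.log T :=
  half_lt_log_two.trans_le (Real.log_le_log (by norm_num) (by exact_mod_cast hT))

lemma le_finiteConst {X : Type*} {K T : ℕ} {F : Set (Predictor X K)} {δ : ℝ} (hT : 2 ≤ T)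
    (hfin : F.Finite) (hne : F.Nonempty) (hδ : 0 < δ) :
    16 * Real.log (8 / δ) ≤ finiteConst F T δ := by
  have hn : (1 : ℝ) ≤ F.ncard := by exact_mod_cast (Set.ncard_pos hfin).2 hne
  have hT' : (2 : ℝ) ≤ T := by exact_mod_cast hT
  unfold finiteConst
  have h4 : (4 : ℝ) ≤ (T : ℝ) ^ 2 := by nlinarith
  have : (8 : ℝ) ≤ 2 * F.ncard * (T : ℝ) ^ 2 := by nlinarith
  gcongr

section Const

variable {X : Type*} [MeasurableSpace X] {K T : ℕ} {F : Set (Predictor X K)} {ν : Measure X}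
    {δ ε : ℝ}

lemma IsConfidenceConst.cases {c : ℝ} (hc : IsConfidenceConst ν F T δ c) :
    (F.Finite ∧ c = finiteConst F T δ) ∨ c = coveringConst ν F T δ := by
  rcases hc with hc | hc
  · unfold confidenceConst at hc
    split_ifs at hc with hfin
    · rcases min_choice (finiteConst F T δ) (coveringConst ν F T δ) with h | h
      · exact Or.inl ⟨hfin, hc.trans h⟩
      · exact Or.inr (hc.trans h)
    · exact Or.inr hc
  · exact Or.inl hc

lemma IsConfidenceConst.le_finiteConst {c : ℝ} (hc : IsConfidenceConst ν F T δ c)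
    (hfin : F.Finite) : c ≤ finiteConst F T δ := by
  rcases hc with hc | hc
  · rw [hc, confidenceConst, if_pos hfin]
    exact min_le_left _ _
  · exact hc.2.le

/-- The logarithmic term of action `a` in the covering constant. -/
def coverLog (ν : Measure X) (F : Set (Predictor X K)) (T : ℕ) (δ ε : ℝ) (a : Fin K) : ℝ :=
  Real.log (8 * expectedCoveringNumber ν T (actionClass F a) ε * K * (T : ℝ) ^ 2 * Real.log T / δ)

variable [IsProbabilityMeasure ν]

/-- The factor `T² log T` in the constant dominates `T`, hence also the number of epochs; all
union-bound logarithms of the covering case reduce to this. -/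
lemma log_mul_le_coverLog (hT : 2 ≤ T) (hF : IsPredictorClass F) (hne : F.Nonempty) (hε : 0 < ε)
    (hδ : 0 < δ) (b : Fin K) {y : ℝ} (hy : 0 < y)
    (hyle : y ≤ expectedCoveringNumber ν T (actionClass F b) ε * K * T) :
    Real.log (8 * y / δ) ≤ coverLog ν F T δ ε b := by
  have hN := one_le_expectedCoveringNumber (ν := ν) hF hne b T hε
  have hK : (1 : ℝ) ≤ K := by exact_mod_cast (Nat.succ_le_of_lt b.pos : 1 ≤ K)
  have hT' : (2 : ℝ) ≤ T := by exact_mod_cast hT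
  have hl := half_lt_log hT
  set N := expectedCoveringNumber ν T (actionClass F b) ε with hNdef
  refine Real.log_le_log (by positivity) ?_
  rw [← hNdef]
  refine div_le_div_of_nonneg_right ?_ hδ.le
  have h1 : (T : ℝ) ≤ T ^ 2 * Real.log T := by nlinarith
  have hNK : 0 ≤ 8 * N * K := by positivity
  nlinarith [mul_le_mul_of_nonneg_left h1 hNK]

lemma le_coverLog (hT : 2 ≤ T) (hF : IsPredictorClass F) (hne : F.Nonempty) (hε : 0 < ε)
    (hδ : 0 < δ) (b : Fin K) : Real.log (16 / δ) ≤ coverLog ν F T δ ε b := by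
  have hN := one_le_expectedCoveringNumber (ν := ν) hF hne b T hε
  have hK : (1 : ℝ) ≤ K := by exact_mod_cast (Nat.succ_le_of_lt b.pos : 1 ≤ K)
  have hT' : (2 : ℝ) ≤ T := by exact_mod_cast hT
  have := log_mul_le_coverLog (ν := ν) hT hF hne hε hδ b (y := 2) (by norm_num) (by
    have : 1 ≤ expectedCoveringNumber ν T (actionClass F b) ε * K :=
        one_le_mul_of_one_le_of_one_le hN hK
    nlinarith)
  norm_num at this
  exact this

lemma one_le_log_div (hδ : 0 < δ) (hδ1 : δ < 1) : 1 ≤ Real.log (16 / δ) := by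
  rw [Real.le_log_iff_exp_le (by positivity), le_div_iff₀ hδ]
  have := Real.exp_one_lt_d9
  nlinarith [Real.exp_pos 1]

lemma coveringConst_le (hT : 2 ≤ T) (hF : IsPredictorClass F) (hne : F.Nonempty) (hK : 1 ≤ K)
    (hδ : 0 < δ) (hδ1 : δ < 1) :
    320 * Real.log (16 / δ) ≤ coveringConst ν F T δ := by
  refine le_ciInf fun ε => ?_
  have h0 : ∀ b, 0 ≤ coverLog ν F T δ ε b := fun b =>
    (zero_le_one.trans (one_le_log_div hδ hδ1)).trans (le_coverLog hT hF hne ε.2 hδ b)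
  have h1 := Finset.single_le_sum (f := coverLog ν F T δ ε) (fun b _ => h0 b)
    (Finset.mem_univ (⟨0, hK⟩ : Fin K))
  have h2 := le_coverLog (ν := ν) hT hF hne ε.2 hδ (⟨0, hK⟩ : Fin K)
  have h3 : (0 : ℝ) ≤ 100 * (ε : ℝ) * K * T := by
    have : (0 : ℝ) < ε := ε.2
    positivity
  change _ ≤ 100 * (ε : ℝ) * K * T + 320 * ∑ b, coverLog ν F T δ ε b
  linarith

lemma IsConfidenceConst.log_le {c : ℝ} (hc : IsConfidenceConst ν F T δ c) (hT : 2 ≤ T)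
    (hF : IsPredictorClass F) (hne : F.Nonempty) (hK : 1 ≤ K) (hδ : 0 < δ) (hδ1 : δ < 1) :
    4 * Real.log (2 / δ) ≤ c ∧ 4 ≤ c := by
  have h8 : 1 ≤ Real.log (8 / δ) := by
    rw [Real.le_log_iff_exp_le (by positivity), le_div_iff₀ hδ]
    have := Real.exp_one_lt_d9
    nlinarith [Real.exp_pos 1]
  have h2 : Real.log (2 / δ) ≤ Real.log (8 / δ) := by gcongr; norm_num
  have h16 : Real.log (8 / δ) ≤ Real.log (16 / δ) := by gcongr; norm_num
  rcases hc.cases with ⟨hfin, rfl⟩ | rfl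
  · have := RegCB.le_finiteConst hT hfin hne hδ
    exact ⟨by linarith, by linarith⟩
  · have := coveringConst_le (ν := ν) hT hF hne hK hδ hδ1
    exact ⟨by linarith, by linarith⟩

end Const

/-! ### Allocating the failure probability in the covering case. -/

section CoverGood

variable {Ω X : Type*} [m0 : MeasurableSpace Ω] [mX : MeasurableSpace X] {K : ℕ}
  {μ : Measure Ω} {D : Measure (X × (Fin K → ℝ))} {F : Set (Predictor X K)} {β : ℕ → ℝ} {T : ℕ}
  {x : ℕ → Ω → X} {r : ℕ → Ω → Fin K → ℝ} {a : ℕ → Ω → Fin K}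
  {fstar : Predictor X K}

/-- The good event for a class with the covering constant. -/
lemma IsEliminationRun.measure_not_concentrate_cover_le [IsProbabilityMeasure μ]
    [IsProbabilityMeasure D] (h : IsEliminationRun μ D F β T x r a) (hT : 2 ≤ T)
    (hu : HasUnitRewards D) (hr : IsRealizedBy D F fstar) (hF : IsPredictorClass F)
    (hp : IsPointwiseMeasurable F) (hK : 1 ≤ K) {δ : ℝ} (hδ : 0 < δ) (hδ1 : δ < 1) {c : ℝ}
    (hc : c = coveringConst (D.map Prod.fst) F T δ) :
    μ {ω | ¬ (LossesConcentrate μ F fstar T x r a c ω ∧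
      ErrorsConcentrate (D.map Prod.fst) F fstar T x c ω)} ≤ ENNReal.ofReal (δ / 2) := by
  have hν : IsProbabilityMeasure (D.map Prod.fst) :=
    Measure.isProbabilityMeasure_map measurable_fst.aemeasurable
  set ν := D.map Prod.fst
  have hne : F.Nonempty := ⟨_, hr.1⟩
  have hc1 : 320 * Real.log (16 / δ) ≤ c := hc ▸ coveringConst_le hT hF hne hK hδ hδ1
  have hc0 : 0 < c := by linarith [one_le_log_div hδ hδ1]
  -- The infimum need not be attained; a scale that is optimal up to a factor 2 is enough, as the
  -- constants 100 and 320 are generous.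
  obtain ⟨⟨ε, hε⟩, hεc⟩ := exists_lt_of_ciInf_lt (show coveringConst ν F T δ < 2 * c by linarith)
  change 100 * ε * K * T + 320 * ∑ b, coverLog ν F T δ ε b < 2 * c at hεc
  change 0 < ε at hε
  set ℓ := coverLog ν F T δ ε with hℓ
  set N : Fin K → ℝ := fun b => expectedCoveringNumber ν T (actionClass F b) ε with hN
  have hN1 : ∀ b, 1 ≤ N b := fun b => one_le_expectedCoveringNumber hF hne b T hε
  have hN0 : ∀ b, 0 < N b := fun b => zero_lt_one.trans_le (hN1 b)
  have hK' : (1 : ℝ) ≤ K := by exact_mod_cast hK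
  have hK0 : (0 : ℝ) < K := by linarith
  have hT' : (2 : ℝ) ≤ T := by exact_mod_cast hT
  have hT0 : (0 : ℝ) < T := by linarith
  have hM1 : (1 : ℝ) ≤ (numEpochs T : ℝ) := by exact_mod_cast one_le_numEpochs
  have hMT : (numEpochs T : ℝ) ≤ T := by exact_mod_cast numEpochs_le hT
  set M : ℝ := (numEpochs T : ℝ) with hM
  have hM0 : 0 < M := by linarith
  have hℓ0 : ∀ b, 0 ≤ ℓ b := fun b =>
    (zero_le_one.trans (one_le_log_div hδ hδ1)).trans (le_coverLog hT hF hne hε hδ b)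
  have hNK : ∀ b, 1 ≤ N b * K := fun b => one_le_mul_of_one_le_of_one_le (hN1 b) hK'
  have hKNM : ∀ b, Real.log (8 * (N b * K * M) / δ) ≤ ℓ b := fun b =>
    log_mul_le_coverLog hT hF hne hε hδ b (by have := hN0 b; positivity)
      (mul_le_mul_of_nonneg_left hMT (by linarith [hNK b]))
  have hKN : ∀ b, Real.log (8 * (N b * K) / δ) ≤ ℓ b := fun b =>
    log_mul_le_coverLog hT hF hne hε hδ b (by linarith [hNK b])
      (le_mul_of_one_le_right (by linarith [hNK b]) (by linarith))
  have hM8 : Real.log (8 * M / δ) ≤ ∑ b, ℓ b := by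
    refine le_trans (log_mul_le_coverLog hT hF hne hε hδ (⟨0, hK⟩ : Fin K) hM0 ?_)
      (Finset.single_le_sum (fun b _ => hℓ0 b) (Finset.mem_univ _))
    exact hMT.trans (le_mul_of_one_le_left hT0.le (hNK _))
  have hp0 : ∀ b, 0 < 8 * (N b * K) / δ := fun b => by have := hN0 b; positivity
  -- By Markov's inequality a cover larger than this is needed with probability at most `δ / (8 K)`
  -- for each action.
  set B : Fin K → ℕ := fun b => ⌊8 * (N b * K) / δ⌋₊ with hB
  set P : ℝ := ∏ b, (8 * (N b * K) / δ) with hP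
  have hPpos : 0 < P := Finset.prod_pos fun b _ => hp0 b
  -- `P` bounds the number of joint vectors and `M` counts epochs, so the loss deviations fail with
  -- probability at most `δ / 8`.
  set u := Real.log (8 * M * P / δ) with hu'
  have hule : u ≤ 2 * ∑ b, ℓ b := by
    have : 8 * M * P / δ = (8 * M / δ) * P := by ring
    rw [hu', this, Real.log_mul (by positivity) hPpos.ne', hP,
      Real.log_prod fun b _ => (hp0 b).ne']
    have := Finset.sum_le_sum fun b (_ : b ∈ Finset.univ) => hKN b
    linarith
  -- Chosen so that the explored errors of each action fail with probability at most `δ / (8 K)`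
  -- over all epochs. The three events together cost `3 δ / 8`.
  set w : Fin K → ℝ := fun b => ε * T / 2 + Real.log (8 * (N b * K * M) / δ) with hw
  have hwsum : ∑ b, w b ≤ K * (ε * T / 2) + ∑ b, ℓ b := by
    rw [hw, Finset.sum_add_distrib]
    have := Finset.sum_le_sum fun b (_ : b ∈ Finset.univ) => hKNM b
    simpa using this
  have hεKT : 0 ≤ ε * K * T := by positivity
  have hS0 : 0 ≤ ∑ b, ℓ b := Finset.sum_nonneg fun b _ => hℓ0 b
  have hcover : μ {ω | ¬ ∀ b, ∃ V : Finset (Fin T → ℚ), V.card ≤ B b ∧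
      (fun t : Fin T => x (t + 1) ω) ∈ ratCoverSet (actionClass F b) (2 * ε * T) V} ≤
      ENNReal.ofReal (δ / 8) := by
    have hb : ∀ b, μ {ω | ∀ V : Finset (Fin T → ℚ), V.card ≤ B b →
        (fun t : Fin T => x (t + 1) ω) ∉ ratCoverSet (actionClass F b) (2 * ε * T) V} ≤
        ENNReal.ofReal (δ / (8 * K)) := by
      intro b
      refine (h.measure_preimage_contexts_le {z | ∀ V : Finset (Fin T → ℚ), V.card ≤ B b →
        z ∉ ratCoverSet (actionClass F b) (2 * ε * T) V}).trans ?_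
      have hmk := measure_forall_notMem_ratCoverSet_le (ν := ν) hF hp b (T := T) (by omega) hε (B b)
      have hlt : 8 * (N b * K) / δ < B b + 1 := Nat.lt_floor_add_one _
      rw [mul_comm, ← ENNReal.le_div_iff_mul_le (by simp) (by simp)] at hmk
      refine hmk.trans ?_
      have hcast : ((B b : ℝ≥0∞) + 1) = ENNReal.ofReal (B b + 1) := by
        rw [ENNReal.ofReal_add (by positivity) zero_le_one]; simp
      rw [hcast, ← ENNReal.ofReal_div_of_pos (by positivity)]
      refine ENNReal.ofReal_le_ofReal ?_
      rw [div_lt_iff₀ hδ] at hlt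
      rw [div_le_div_iff₀ (by positivity) (by positivity)]
      change N b * (8 * K) ≤ δ * (B b + 1)
      linarith
    have hsub : {ω | ¬ ∀ b, ∃ V : Finset (Fin T → ℚ), V.card ≤ B b ∧
        (fun t : Fin T => x (t + 1) ω) ∈ ratCoverSet (actionClass F b) (2 * ε * T) V} ⊆
        ⋃ b ∈ Finset.univ, {ω | ∀ V : Finset (Fin T → ℚ), V.card ≤ B b →
        (fun t : Fin T => x (t + 1) ω) ∉ ratCoverSet (actionClass F b) (2 * ε * T) V} := by
      intro ω hω
      simp only [Set.mem_ofPred_eq, not_forall, not_exists, not_and] at hω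
      simpa using hω
    calc _ ≤ _ := (measure_mono hsub).trans (measure_biUnion_finset_le _ _)
      _ ≤ ∑ _b : Fin K, ENNReal.ofReal (δ / (8 * K)) := Finset.sum_le_sum fun b _ => hb b
      _ = ENNReal.ofReal (δ / 8) := by
          rw [Finset.sum_const, Finset.card_univ, Fintype.card_fin, nsmul_eq_mul,
            ← ENNReal.ofReal_natCast, ← ENNReal.ofReal_mul (by positivity)]
          congr 1
          field_simp
  have hloss := h.measure_not_lossesConcentrate_cover_le (by omega) hu hr hF hp (2 * ε * T) B u
  have hlossδ : (((∏ b, B b) * numEpochs T : ℕ) : ℝ≥0∞) * ENNReal.ofReal (Real.exp (-u)) ≤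
      ENNReal.ofReal (δ / 8) := by
    rw [← ENNReal.ofReal_natCast, ← ENNReal.ofReal_mul (by positivity), Real.exp_neg, hu',
      Real.exp_log (by positivity)]
    refine ENNReal.ofReal_le_ofReal ?_
    have hBP : (((∏ b, B b : ℕ)) : ℝ) ≤ P := by
      push_cast
      exact Finset.prod_le_prod (fun b _ => by positivity) fun b _ => Nat.floor_le (hp0 b).le
    rw [inv_div, mul_div_assoc', div_le_div_iff₀ (by positivity) (by norm_num)]
    push_cast at hBP ⊢
    have : (∏ b, (B b : ℝ)) * M * δ ≤ P * M * δ := by gcongr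
    nlinarith
  have herr := h.measure_not_errorsConcentrate_cover_le (by omega) hr hF hp hε w (c := c)
    (by linarith) hc0.le
  have herrδ : ∑ b, numEpochs T * (ENNReal.ofReal (Real.exp (ε * T / 2 - w b)) *
      ENNReal.ofReal (N b)) ≤ ENNReal.ofReal (δ / 8) := by
    have hb : ∀ b, numEpochs T * (ENNReal.ofReal (Real.exp (ε * T / 2 - w b)) *
        ENNReal.ofReal (N b)) = ENNReal.ofReal (δ / (8 * K)) := by
      intro b
      have := hN0 b
      rw [← ENNReal.ofReal_natCast, ← ENNReal.ofReal_mul (Real.exp_pos _).le,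
        ← ENNReal.ofReal_mul (by positivity)]
      congr 1
      have he : ε * T / 2 - w b = -Real.log (8 * (N b * K * M) / δ) := by rw [hw]; ring
      rw [he, Real.exp_neg, Real.exp_log (by positivity), ← hM]
      field_simp
    simp_rw [hb]
    rw [Finset.sum_const, Finset.card_univ, Fintype.card_fin, nsmul_eq_mul,
      ← ENNReal.ofReal_natCast, ← ENNReal.ofReal_mul (by positivity)]
    refine ENNReal.ofReal_le_ofReal (le_of_eq ?_)
    field_simp
  have hsub : {ω | ¬ (LossesConcentrate μ F fstar T x r a c ω ∧
      ErrorsConcentrate ν F fstar T x c ω)} ⊆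
      {ω | ¬ ∀ b, ∃ V : Finset (Fin T → ℚ), V.card ≤ B b ∧
        (fun t : Fin T => x (t + 1) ω) ∈ ratCoverSet (actionClass F b) (2 * ε * T) V} ∪
      {ω | (∀ b, ∃ V : Finset (Fin T → ℚ), V.card ≤ B b ∧
        (fun t : Fin T => x (t + 1) ω) ∈ ratCoverSet (actionClass F b) (2 * ε * T) V) ∧
        ¬ LossesConcentrate μ F fstar T x r a (u + 5 / 2 * (K * (2 * ε * T))) ω} ∪
      {ω | ¬ ErrorsConcentrate ν F fstar T x c ω} := by
    intro ω hω
    by_contra hcon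
    simp only [Set.mem_union, Set.mem_ofPred_eq, not_or, not_not, not_and] at hcon
    refine hω ⟨fun f hf m hm => (hcon.1.2 hcon.1.1 f hf m hm).trans (by nlinarith), hcon.2⟩
  calc _ ≤ _ := (measure_mono hsub).trans ((measure_union_le _ _).trans
        (add_le_add (measure_union_le _ _) le_rfl))
    _ ≤ ENNReal.ofReal (δ / 8) + ENNReal.ofReal (δ / 8) + ENNReal.ofReal (δ / 8) :=
        add_le_add (add_le_add hcover (hloss.trans hlossδ)) (herr.trans herrδ)
    _ ≤ _ := by
        rw [← ENNReal.ofReal_add (by positivity) (by positivity),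
          ← ENNReal.ofReal_add (by positivity) (by positivity)]
        exact ENNReal.ofReal_le_ofReal (by linarith)

/-- The good event has probability at least `1 - δ / 2`. -/
lemma IsEliminationRun.measure_not_concentrate_le [IsProbabilityMeasure μ]
    [IsProbabilityMeasure D] (h : IsEliminationRun μ D F β T x r a) (hT : 2 ≤ T)
    (hu : HasUnitRewards D) (hr : IsRealizedBy D F fstar) (hF : IsPredictorClass F)
    (hp : IsPointwiseMeasurable F) (hK : 1 ≤ K) {δ : ℝ} (hδ : 0 < δ) (hδ1 : δ < 1) {c : ℝ}
    (hc : IsConfidenceConst (D.map Prod.fst) F T δ c) :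
    μ {ω | ¬ (LossesConcentrate μ F fstar T x r a c ω ∧
      ErrorsConcentrate (D.map Prod.fst) F fstar T x c ω)} ≤ ENNReal.ofReal (δ / 2) := by
  rcases hc.cases with ⟨hfin, hc⟩ | hc
  · exact h.measure_not_concentrate_finite_le hT hu hr hF hfin hδ hδ1 hc.ge
  · exact h.measure_not_concentrate_cover_le hT hu hr hF hp hK hδ hδ1 hc

end CoverGood

/-! ### The implicit exploration coefficient -/

lemma exploredSq_le {X : Type*} {K : ℕ} {fstar : Predictor X K} (hK : 1 ≤ K)
    {f : Predictor X K} {S : ℝ} (hS : ∀ x a, (f x a - fstar x a) ^ 2 ≤ S)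
        (x : X) : exploredSq fstar f x ≤ S := by
  have hK' : (0 : ℝ) < K := by exact_mod_cast hK
  have hS0 : 0 ≤ S := (sq_nonneg _).trans (hS x ⟨0, hK⟩)
  rw [exploredSq, one_div, inv_mul_le_iff₀ hK']
  calc _ ≤ ∑ _a : Fin K, S := Finset.sum_le_sum fun a _ => by
        unfold regionError Set.indicator
        split_ifs
        · exact hS x a
        · exact hS0
    _ = K * S := by simp

section IEC

variable {X : Type*} [MeasurableSpace X] {K : ℕ} {F : Set (Predictor X K)} {fstar : Predictor X K}
  {ν : Measure X} [IsProbabilityMeasure ν] {L : ℝ}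

/-- Otherwise every positive constant would be admissible and there would be no smallest one. -/
lemma IsIEC.exists_ne {ν : Measure X} {lam : ℝ} (h : IsIEC ν F fstar lam L) :
    ∃ f ∈ F, f ≠ fstar := by
  by_contra hcon
  push Not at hcon
  have hmem : L / 2 ∈ {c : ℝ | 0 < c ∧ ∀ f ∈ F, ∀ x a,
      (f x a - fstar x a) ^ 2 ≤ c * exploredError ν fstar lam f} := by
    refine ⟨half_pos h.1.1, fun f hf x a => ?_⟩
    rw [hcon f hf]
    simp [exploredError]
  linarith [h.2 hmem, h.1.1]

/-- The explored error is at most the supremum `S` of the squared error, so the defining inequality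
gives `S ≤ L * S`, with `S > 0` for some `f` in the class. -/
lemma IsIEC.one_le (h : IsIEC ν F fstar 0 L) (hF : IsPredictorClass F) (hs : fstar ∈ F)
    (hK : 1 ≤ K) : 1 ≤ L := by
  obtain ⟨f, hf, hne⟩ := h.exists_ne
  have hfm := fun b => (hF _ hf b).1
  have hsm := fun b => (hF _ hs b).1
  have hf1 := fun x b => (hF _ hf b).2 x
  have hs1 := fun x b => (hF _ hs b).2 x
  obtain ⟨x₀, hx₀⟩ := Function.ne_iff.1 hne
  obtain ⟨a₀, ha₀⟩ := Function.ne_iff.1 hx₀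
  set S := ⨆ p : X × Fin K, (f p.1 p.2 - fstar p.1 p.2) ^ 2 with hS
  have hbdd : BddAbove (Set.range fun p : X × Fin K => (f p.1 p.2 - fstar p.1 p.2) ^ 2) := by
    refine ⟨1, ?_⟩
    rintro _ ⟨p, rfl⟩
    exact (sq_sub_mem_Icc (hf1 _ _) (hs1 _ _)).2
  have hle : ∀ x a, (f x a - fstar x a) ^ 2 ≤ S := fun x a => le_ciSup hbdd (x, a)
  have hpos : 0 < S := by
    refine lt_of_lt_of_le ?_ (hle x₀ a₀)
    have := sub_ne_zero.2 ha₀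
    positivity
  have hE : exploredError ν fstar 0 f ≤ S := by
    rw [exploredError_eq]
    calc _ ≤ ∫ _, S ∂ν := integral_mono (Integrable.of_mem_Icc 0 1
          (measurable_exploredSq hsm hfm).aemeasurable
          (ae_of_all _ fun x => exploredSq_mem_Icc hs1 hf1 x)) (integrable_const _)
          (exploredSq_le hK hle)
      _ = S := by simp
  have hSL : S ≤ L * S := by
    have : Nonempty (X × Fin K) := ⟨(x₀, a₀)⟩
    refine ciSup_le fun p => (h.1.2 f hf p.1 p.2).trans ?_
    exact mul_le_mul_of_nonneg_left hE h.1.1.le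
  nlinarith

end IEC

/-! ### Behaviour of the algorithm on the good event -/

lemma versionSpace_subset {X : Type*} {K : ℕ} {F : Set (Predictor X K)} {y : ℕ → X}
    {ρ : ℕ → Fin K → ℝ} {α : ℕ → Fin K} {m : ℕ} {t : ℝ} :
    versionSpace F y ρ α m t ⊆ F := by
  unfold versionSpace
  split_ifs
  · exact subset_rfl
  · exact fun f hf => hf.1

lemma bddBelow_empRisk {X : Type*} {K : ℕ} {F : Set (Predictor X K)} {y : ℕ → X}
    {ρ : ℕ → Fin K → ℝ} {α : ℕ → Fin K} {m : ℕ} :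
    BddBelow (empRisk y ρ α m '' F) := by
  refine ⟨0, ?_⟩
  rintro _ ⟨f, -, rfl⟩
  have : (1 : ℝ) ≤ epochStart m := by exact_mod_cast one_le_epochStart m
  exact mul_nonneg (one_div_nonneg.2 (by linarith)) (Finset.sum_nonneg fun _ _ => sq_nonneg _)

lemma empRisk_sub_empRisk {Ω X : Type*} {K : ℕ} {x : ℕ → Ω → X} {r : ℕ → Ω → Fin K → ℝ}
    {a : ℕ → Ω → Fin K} {fstar : Predictor X K} {ω : Ω} (m : ℕ) (f : Predictor X K) :
    empRisk (fun s => x s ω) (fun s => r s ω) (fun s => a s ω) m f -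
      empRisk (fun s => x s ω) (fun s => r s ω) (fun s => a s ω) m fstar =
    1 / ((epochStart m : ℝ) - 1) *
      ∑ s ∈ Finset.Ico 1 (epochStart m), excess fstar f (x s ω, r s ω) (a s ω) := by
  rw [empRisk, empRisk, ← mul_sub, ← Finset.sum_sub_distrib]
  rfl

/-- The gap of the action chosen in round `t`. -/
def actionGap {Ω X : Type*} {K : ℕ} (fstar : Predictor X K) (π : X → Fin K) (x : ℕ → Ω → X)
    (a : ℕ → Ω → Fin K) (t : ℕ) (ω : Ω) : ℝ :=
  fstar (x t ω) (π (x t ω)) - fstar (x t ω) (a t ω)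

lemma actionGap_mem_Icc {Ω X : Type*} [MeasurableSpace X] {K : ℕ} {F : Set (Predictor X K)}
    {x : ℕ → Ω → X} {a : ℕ → Ω → Fin K} {fstar : Predictor X K} (hF : IsPredictorClass F)
    (hs : fstar ∈ F)
    {π : X → Fin K} (hπ : IsGreedyPolicy fstar π) (t : ℕ) (ω : Ω) :
    actionGap fstar π x a t ω ∈ Set.Icc (0 : ℝ) 1 := by
  have h1 := (hF _ hs (π (x t ω))).2 (x t ω)
  have h2 := (hF _ hs (a t ω)).2 (x t ω)
  exact ⟨sub_nonneg.2 (hπ.2 _ _), by unfold actionGap; linarith [h1.2, h2.1]⟩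

section Deterministic

variable {Ω X : Type*} [m0 : MeasurableSpace Ω] [mX : MeasurableSpace X] {K : ℕ}
  {μ : Measure Ω} {D : Measure (X × (Fin K → ℝ))} {F : Set (Predictor X K)} {T : ℕ}
  {x : ℕ → Ω → X} {r : ℕ → Ω → Fin K → ℝ} {a : ℕ → Ω → Fin K} {fstar : Predictor X K}
  {c : ℝ} {ω : Ω}

/-- The version space of epoch `m` along the run `ω`. -/
def runSpace (F : Set (Predictor X K)) (x : ℕ → Ω → X) (r : ℕ → Ω → Fin K → ℝ)
    (a : ℕ → Ω → Fin K) (β : ℕ → ℝ) (m : ℕ) (ω : Ω) : Set (Predictor X K) :=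
  versionSpace F (fun s => x s ω) (fun s => r s ω) (fun s => a s ω) m (β m)

/-- Properties that a run has almost surely. -/
structure IsRegular (μ : Measure Ω) (F : Set (Predictor X K)) (β : ℕ → ℝ) (T : ℕ)
    (x : ℕ → Ω → X) (r : ℕ → Ω → Fin K → ℝ) (a : ℕ → Ω → Fin K) (ω : Ω) : Prop where
  actionProb_nonneg : ∀ s ∈ Set.Icc 1 T, ∀ b,
    0 ≤ actionProb (history x r a s) μ (x s) (a s) b ω
  actionProb_eq : ∀ m ∈ Set.Icc 1 (numEpochs T),
    ∀ s ∈ Set.Ico (epochStart m) (epochStart (m + 1)), s ≤ T → ∀ b,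
      actionProb (history x r a s) μ (x s) (a s) b ω =
        unifProb (plausible (runSpace F x r a β m ω) (x s ω)) b
  actionProb_ne_zero : ∀ s ∈ Set.Icc 1 T,
    actionProb (history x r a s) μ (x s) (a s) (a s ω) ω ≠ 0

lemma IsEliminationRun.ae_isRegular [IsProbabilityMeasure μ] {β : ℕ → ℝ}
    (h : IsEliminationRun μ D F β T x r a) (hu : HasUnitRewards D) :
    ∀ᵐ ω ∂μ, IsRegular μ F β T x r a ω := by
  have h2 : ∀ᵐ ω ∂μ, ∀ m ∈ Set.Icc 1 (numEpochs T),
      ∀ s ∈ Set.Ico (epochStart m) (epochStart (m + 1)), s ≤ T → ∀ b,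
      actionProb (history x r a s) μ (x s) (a s) b ω =
        unifProb (plausible (runSpace F x r a β m ω) (x s ω)) b := by
    simp only [ae_all_iff]
    exact fun m hm s hs hsT b => h.action_law m hm s hs hsT b
  have h3 : ∀ᵐ ω ∂μ, ∀ s ∈ Set.Icc 1 T, ∀ b,
      ¬ (actionProb (history x r a s) μ (x s) (a s) b ω = 0 ∧ a s ω = b) := by
    simp only [ae_all_iff]
    intro s hs b
    have hR := h.isRound hs
    set p := actionProb (history x r a s) μ (x s) (a s) b with hp
    have hpm : Measurable[history x r a s ⊔ MeasurableSpace.comap (x s) mX] p :=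
      measurable_actionProb _ _
    have hΦm : Measurable[history x r a s ⊔ MeasurableSpace.comap (x s) mX]
        fun ω => ({0} : Set ℝ).indicator (1 : ℝ → ℝ≥0∞) (p ω) :=
      (measurable_one.indicator (measurableSet_singleton 0)).comp hpm
    have key := lintegral_mul_ofReal_condExp hR.sup_comap_le (hR.integrable_indicator b)
      (ae_of_all _ fun _ => Set.indicator_nonneg (fun _ _ => zero_le_one) _) hΦm
    have hzero : ∀ ω, ({0} : Set ℝ).indicator (1 : ℝ → ℝ≥0∞) (p ω) * ENNReal.ofReal (p ω) = 0 := by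
      intro ω
      by_cases hω : p ω = 0
      · simp [hω]
      · rw [Set.indicator_of_notMem (by simpa using hω), zero_mul]
    -- An action of conditional probability zero is almost never drawn. This is what places the
    -- drawn action in the plausible set.
    have h0 : ∫⁻ ω, ({0} : Set ℝ).indicator (1 : ℝ → ℝ≥0∞) (p ω) *
        ENNReal.ofReal ({ω | a s ω = b}.indicator (fun _ => (1 : ℝ)) ω) ∂μ = 0 := by
      rw [← key]
      exact (lintegral_congr hzero).trans (by simp)
    have hb : MeasurableSet {ω | a s ω = b} := h.measurable_action s (measurableSet_singleton b)
    have hmeas : Measurable fun ω => ({0} : Set ℝ).indicator (1 : ℝ → ℝ≥0∞) (p ω) *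
        ENNReal.ofReal ({ω | a s ω = b}.indicator (fun _ => (1 : ℝ)) ω) :=
      (hΦm.mono hR.sup_comap_le le_rfl).mul (measurable_const.indicator hb).ennreal_ofReal
    rw [lintegral_eq_zero_iff hmeas] at h0
    filter_upwards [h0] with ω hω hcon
    have e2 : ω ∈ {ω | a s ω = b} := hcon.2
    rw [hcon.1, Set.indicator_of_mem e2] at hω
    simp at hω
  filter_upwards [h.ae_regular hu, h2, h3] with ω h1 h2 h3
  exact ⟨fun s hs b => ((h1 s hs).2 b).1, h2, fun s hs h0 => h3 s hs _ ⟨h0, rfl⟩⟩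

lemma le_high {G : Set (Predictor X K)} (hG : G ⊆ F) (hF : IsPredictorClass F) {f : Predictor X K}
    (hf : f ∈ G) (y : X) (b : Fin K) : f y b ≤ high G y b := by
  refine le_csSup ⟨1, ?_⟩ ⟨f, hf, rfl⟩
  rintro _ ⟨g, hg, rfl⟩
  exact ((hF g (hG hg) b).2 y).2

lemma low_le {G : Set (Predictor X K)} (hG : G ⊆ F) (hF : IsPredictorClass F) {f : Predictor X K}
    (hf : f ∈ G) (y : X) (b : Fin K) : low G y b ≤ f y b := by
  refine csInf_le ⟨0, ?_⟩ ⟨f, hf, rfl⟩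
  rintro _ ⟨g, hg, rfl⟩
  exact ((hF g (hG hg) b).2 y).1

/-- Implicit exploration: if `b` is optimal for `fstar`, its upper bound dominates `fstar y b`,
hence every `fstar y b'`, hence every lower bound. -/
lemma one_div_le_unifProb {G : Set (Predictor X K)} (hG : G ⊆ F) (hF : IsPredictorClass F)
    (hs : fstar ∈ G) {y : X} {b : Fin K} (hb : y ∈ bestRegion fstar 0 b) :
    1 / (K : ℝ) ≤ unifProb (plausible G y) b := by
  have hmem : b ∈ plausible G y := by
    simp only [plausible, Finset.mem_filter, Finset.mem_univ, true_and]
    intro b'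
    have h1 := low_le hG hF hs y b'
    have h2 := le_high hG hF hs y b
    have h3 : fstar y b' ≤ fstar y b := by
      by_cases hbb : b' = b
      · rw [hbb]
      · simpa using hb b' hbb
    linarith
  rw [unifProb, if_pos hmem]
  have hpos : (0 : ℝ) < (plausible G y).card := by exact_mod_cast Finset.card_pos.2 ⟨b, hmem⟩
  refine one_div_le_one_div_of_le hpos ?_
  exact_mod_cast (Finset.card_le_univ _).trans (by simp)

/-- The explored error of a round is at most its conditional error when the version space
contains `fstar`. -/
lemma IsRegular.exploredSq_le_condError {β : ℕ → ℝ} (h : IsRegular μ F β T x r a ω)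
    (hF : IsPredictorClass F) {m : ℕ} (hm : m ∈ Set.Icc 1 (numEpochs T)) {s : ℕ}
    (hs : s ∈ Set.Ico (epochStart m) (epochStart (m + 1))) (hsT : s ≤ T)
    (hmem : fstar ∈ runSpace F x r a β m ω) (f : Predictor X K) :
    exploredSq fstar f (x s ω) ≤ condError (history x r a s) μ fstar f (x s) (a s) ω := by
  rw [exploredSq, Finset.mul_sum]
  refine Finset.sum_le_sum fun b _ => ?_
  have hs1 : s ∈ Set.Icc 1 T := ⟨(one_le_epochStart m).trans hs.1, hsT⟩
  unfold regionError
  by_cases hb : x s ω ∈ bestRegion fstar 0 b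
  · rw [Set.indicator_of_mem hb, h.actionProb_eq m hm s hs hsT b]
    exact mul_le_mul_of_nonneg_right (one_div_le_unifProb versionSpace_subset hF hmem hb)
      (sq_nonneg _)
  · rw [Set.indicator_of_notMem hb, mul_zero]
    exact mul_nonneg (h.actionProb_nonneg s hs1 b) (sq_nonneg _)

lemma IsRegular.condError_nonneg {β : ℕ → ℝ} (h : IsRegular μ F β T x r a ω) {s : ℕ}
    (hs : s ∈ Set.Icc 1 T) (f : Predictor X K) :
    0 ≤ condError (history x r a s) μ fstar f (x s) (a s) ω :=
  Finset.sum_nonneg fun b _ => mul_nonneg (h.actionProb_nonneg s hs b) (sq_nonneg _)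

lemma two_le_epochStart {m : ℕ} (hm : 2 ≤ m) : 2 ≤ epochStart m := by
  rw [← two_mul_epochStart_pred hm]
  have := one_le_epochStart (m - 1)
  omega

/-- `fstar` is never eliminated. -/
lemma IsRegular.fstar_mem (h : IsRegular μ F (tolerance T c) T x r a ω) (hs : fstar ∈ F)
    (hT : 1 ≤ T) (hc : 0 ≤ c) (hloss : LossesConcentrate μ F fstar T x r a c ω) {m : ℕ}
    (hm : m ∈ Set.Icc 1 (numEpochs T)) : fstar ∈ runSpace F x r a (tolerance T c) m ω := by
  unfold runSpace versionSpace
  split_ifs with hm1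
  · exact hs
  have hm2 : 2 ≤ m := by omega
  refine ⟨hs, ?_⟩
  have hτ : (2 : ℝ) ≤ epochStart m := by exact_mod_cast two_le_epochStart hm2
  have hτT := epochStart_le hT hm.2
  have hinf : empRisk (fun s => x s ω) (fun s => r s ω) (fun s => a s ω) m fstar -
      1 / ((epochStart m : ℝ) - 1) * c ≤
      sInf (empRisk (fun s => x s ω) (fun s => r s ω) (fun s => a s ω) m '' F) := by
    refine le_csInf ⟨_, fstar, hs, rfl⟩ ?_
    rintro _ ⟨f, hf, rfl⟩
    have h1 := empRisk_sub_empRisk (x := x) (r := r) (a := a) (ω := ω) (fstar := fstar) m f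
    have h2 := hloss f hf m (Finset.mem_Icc.2 hm)
    -- The conditional errors are nonnegative and can be dropped: no predictor beats `fstar` by more
    -- than `c` in cumulative loss. No induction over epochs is required.
    have h3 : -∑ s ∈ Finset.Ico 1 (epochStart m), excess fstar f (x s ω, r s ω) (a s ω) ≤ c := by
      refine le_trans ?_ h2
      rw [← Finset.sum_neg_distrib]
      refine Finset.sum_le_sum fun s hs' => ?_
      rw [Finset.mem_Ico] at hs'
      have := h.condError_nonneg (fstar := fstar) (s := s) ⟨hs'.1, by omega⟩ f
      unfold deviation
      linarith
    have h4 : 0 ≤ 1 / ((epochStart m : ℝ) - 1) := one_div_nonneg.2 (by linarith)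
    nlinarith [mul_le_mul_of_nonneg_left h3 h4]
  -- The factor `M - m + 1` is at least 1 up to the last epoch.
  have htol : 1 / ((epochStart m : ℝ) - 1) * c ≤ tolerance T c m := by
    unfold tolerance
    rw [one_div, inv_mul_eq_div]
    refine div_le_div_of_nonneg_right ?_ (by linarith)
    have : (m : ℝ) ≤ numEpochs T := by exact_mod_cast hm.2
    nlinarith
  linarith

/-- All predictors of the version space are uniformly close to `fstar`. -/
lemma IsRegular.sq_sub_le (h : IsRegular μ F (tolerance T c) T x r a ω)
    (hF : IsPredictorClass F) (hs : fstar ∈ F)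
    (hT : 1 ≤ T) (hc : 0 ≤ c) (hloss : LossesConcentrate μ F fstar T x r a c ω)
    {ν : Measure X} (herr : ErrorsConcentrate ν F fstar T x c ω) {L : ℝ}
    (hL : IsIEC ν F fstar 0 L) {m : ℕ} (hm : m ∈ Set.Icc 2 (numEpochs T))
    {f : Predictor X K} (hf : f ∈ runSpace F x r a (tolerance T c) m ω) (y : X) (b : Fin K) :
    (f y b - fstar y b) ^ 2 ≤ 36 * L * numEpochs T * c / epochStart m := by
  have hfF : f ∈ F := versionSpace_subset hf
  have hτ : (2 : ℝ) ≤ epochStart m := by exact_mod_cast two_le_epochStart hm.1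
  have hM : (1 : ℝ) ≤ numEpochs T := by exact_mod_cast one_le_numEpochs
  have hm2 : (2 : ℝ) ≤ m := by exact_mod_cast hm.1
  have hτT := epochStart_le hT hm.2
  have hexc : ∑ s ∈ Finset.Ico 1 (epochStart m), excess fstar f (x s ω, r s ω) (a s ω) ≤
      numEpochs T * c := by
    unfold runSpace versionSpace at hf
    rw [if_neg (by have := hm.1; omega)] at hf
    have h1 := empRisk_sub_empRisk (x := x) (r := r) (a := a) (ω := ω) (fstar := fstar) m f
    have h2 := csInf_le (bddBelow_empRisk (F := F) (m := m) (y := fun s => x s ω)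
      (ρ := fun s => r s ω) (α := fun s => a s ω)) ⟨fstar, hs, rfl⟩
    have h3 := hf.2
    have h4 : 1 / ((epochStart m : ℝ) - 1) * ∑ s ∈ Finset.Ico 1 (epochStart m),
        excess fstar f (x s ω, r s ω) (a s ω) ≤ tolerance T c m := by linarith
    unfold tolerance at h4
    rw [one_div, inv_mul_eq_div, div_le_div_iff_of_pos_right (by linarith)] at h4
    nlinarith
  have hcond : ∑ s ∈ Finset.Ico 1 (epochStart m), exploredSq fstar f (x s ω) ≤
      4 * (c + numEpochs T * c) := by
    have h1 := hloss f hfF m (Finset.mem_Icc.2 ⟨by have := hm.1; omega, hm.2⟩)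
    unfold deviation at h1
    rw [Finset.sum_add_distrib, Finset.sum_neg_distrib, ← Finset.sum_div] at h1
    have h2 : ∑ s ∈ Finset.Ico 1 (epochStart m), exploredSq fstar f (x s ω) ≤
        ∑ s ∈ Finset.Ico 1 (epochStart m),
          condError (history x r a s) μ fstar f (x s) (a s) ω := by
      refine Finset.sum_le_sum fun s hs' => ?_
      rw [Finset.mem_Ico] at hs'
      obtain ⟨m', hm', hsm'⟩ := exists_epoch (T := T) (t := s) ⟨hs'.1, by omega⟩
      exact h.exploredSq_le_condError hF hm' hsm' (by omega) (h.fstar_mem hs hT hc hloss hm') f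
    linarith
  have hexp := herr f hfF m (Finset.mem_Icc.2 hm)
  have hτ' : (2 : ℝ) * epochStart (m - 1) = epochStart m := by
    exact_mod_cast two_mul_epochStart_pred hm.1
  -- The bound `2 * 4 (c + M c) + 2 c` is at most `18 M c`; dividing by `τ_{m-1} = τ_m / 2` doubles
  -- it to 36.
  have hE : exploredError ν fstar 0 f ≤ 36 * numEpochs T * c / epochStart m := by
    rw [le_div_iff₀ (by linarith), ← hτ']
    have : c ≤ numEpochs T * c := le_mul_of_one_le_left hc hM
    linarith
  calc _ ≤ L * exploredError ν fstar 0 f := hL.1.2 f hfF y b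
    _ ≤ L * (36 * numEpochs T * c / epochStart m) := mul_le_mul_of_nonneg_left hE hL.1.1.le
    _ = _ := by ring

lemma IsRegular.sq_actionGap_le (h : IsRegular μ F (tolerance T c) T x r a ω)
    (hF : IsPredictorClass F) (hs : fstar ∈ F) {π : X → Fin K} (hπ : IsGreedyPolicy fstar π)
    (hT : 1 ≤ T) (hc : 1 ≤ c) (hloss : LossesConcentrate μ F fstar T x r a c ω)
    {ν : Measure X} (herr : ErrorsConcentrate ν F fstar T x c ω) {L : ℝ}
    (hL : IsIEC ν F fstar 0 L) (hL1 : 1 ≤ L) {t : ℕ} (ht : t ∈ Set.Icc 1 T) :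
    actionGap fstar π x a t ω ^ 2 ≤ 288 * L * numEpochs T * c / t := by
  have ht0 : (0 : ℝ) < t := by exact_mod_cast ht.1
  have hM : (1 : ℝ) ≤ numEpochs T := by exact_mod_cast one_le_numEpochs
  obtain ⟨m, hm, htm⟩ := exists_epoch ht
  have hg := actionGap_mem_Icc (x := x) (a := a) hF hs hπ t ω
  -- Round 1 has no data, and its gap is covered by the trivial bound 1.
  have hLM : 1 ≤ L * numEpochs T * c :=
    one_le_mul_of_one_le_of_one_le (one_le_mul_of_one_le_of_one_le hL1 hM) hc
  rcases Nat.lt_or_ge m 2 with hm1 | hm2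
  · have hmm : m = 1 := by have := hm.1; omega
    subst hmm
    have ht1 : t = 1 := by
      have h1 := htm.2
      have h2 := ht.1
      simp only [epochStart] at h1
      norm_num at h1
      omega
    subst ht1
    rw [Nat.cast_one, div_one]
    nlinarith [hg.1, hg.2]
  · have hcl := fun f (hf : f ∈ runSpace F x r a (tolerance T c) m ω) y b =>
      h.sq_sub_le hF hs hT (by linarith) hloss herr hL ⟨hm2, hm.2⟩ hf y b
    set w := 36 * L * numEpochs T * c / epochStart m with hw
    have habs := fun f hf y b => abs_le.1 (Real.abs_le_sqrt (hcl f hf y b))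
    have hmemS := h.fstar_mem hs hT (by linarith) hloss hm
    have hplaus : a t ω ∈ plausible (runSpace F x r a (tolerance T c) m ω) (x t ω) := by
      by_contra hcon
      refine h.actionProb_ne_zero t ht ?_
      rw [h.actionProb_eq m hm t htm ht.2, unifProb, if_neg hcon]
    simp only [plausible, Finset.mem_filter, Finset.mem_univ, true_and] at hplaus
    have h1 := hplaus (π (x t ω))
    have h2 : high (runSpace F x r a (tolerance T c) m ω) (x t ω) (a t ω) ≤
        fstar (x t ω) (a t ω) + Real.sqrt w := by
      refine csSup_le ⟨_, fstar, hmemS, rfl⟩ ?_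
      rintro _ ⟨f, hf, rfl⟩
      have := (habs f hf (x t ω) (a t ω)).2
      dsimp only
      linarith
    have h3 : fstar (x t ω) (π (x t ω)) - Real.sqrt w ≤
        low (runSpace F x r a (tolerance T c) m ω) (x t ω) (π (x t ω)) := by
      refine le_csInf ⟨_, fstar, hmemS, rfl⟩ ?_
      rintro _ ⟨f, hf, rfl⟩
      have := (habs f hf (x t ω) (π (x t ω))).1
      dsimp only
      linarith
    -- The upper bound of the played action reaches the lower bound of the optimal one, and each is
    -- within `√w` of its true value. Together with `t ≤ 2 τ_m` this gives `4 * 2 * 36 = 288`.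
    have h4 : actionGap fstar π x a t ω ≤ 2 * Real.sqrt w := by unfold actionGap; linarith
    have hτ : (2 : ℝ) ≤ epochStart m := by exact_mod_cast two_le_epochStart hm2
    have hw0 : 0 ≤ w := by
      rw [hw]
      exact div_nonneg (by nlinarith) (by linarith)
    have h5 : actionGap fstar π x a t ω ^ 2 ≤ 4 * w := by
      calc _ ≤ (2 * Real.sqrt w) ^ 2 := pow_le_pow_left₀ hg.1 h4 2
        _ = 4 * w := by rw [mul_pow, Real.sq_sqrt hw0]; norm_num
    refine h5.trans ?_
    have htτ : (t : ℝ) ≤ 2 * epochStart m := by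
      have := htm.2
      rw [epochStart_succ hm.1] at this
      exact_mod_cast this.le
    rw [hw, mul_div_assoc', div_le_div_iff₀ (by linarith) ht0]
    nlinarith

end Deterministic

/-! ### The regret -/

lemma sum_one_div_sqrt_le (T : ℕ) :
    ∑ t ∈ Finset.Icc 1 T, 1 / Real.sqrt t ≤ 2 * Real.sqrt T := by
  induction T with
  | zero => simp
  | succ n ih =>
    rw [Finset.sum_Icc_succ_top (by omega)]
    have h1 : (0 : ℝ) < Real.sqrt ((n + 1 : ℕ) : ℝ) := Real.sqrt_pos.2 (by positivity)
    have h2 : (0 : ℝ) ≤ Real.sqrt n := Real.sqrt_nonneg _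
    have h3 := Real.sq_sqrt (Nat.cast_nonneg (α := ℝ) n)
    have h4 := Real.sq_sqrt (Nat.cast_nonneg (α := ℝ) (n + 1))
    have h5 : 1 / Real.sqrt ((n + 1 : ℕ) : ℝ) ≤
        2 * (Real.sqrt ((n + 1 : ℕ) : ℝ) - Real.sqrt n) := by
      rw [div_le_iff₀ h1]
      push_cast at h4 ⊢
      nlinarith [sq_nonneg (Real.sqrt ((n : ℝ) + 1) - Real.sqrt n)]
    linarith

lemma sum_one_div_le (T : ℕ) : ∑ t ∈ Finset.Icc 1 T, 1 / (t : ℝ) ≤ 1 + Real.log T := by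
  have h := harmonic_le_one_add_log T
  rw [harmonic_eq_sum_Icc] at h
  push_cast at h
  simpa using h

lemma numEpochs_le_log {T : ℕ} (hT : 2 ≤ T) : (numEpochs T : ℝ) ≤ 4 * Real.log T := by
  have h1 := Real.natLog_le_logb T 2
  have h2 : Real.log 2 ≤ Real.log T :=
    Real.log_le_log (by norm_num) (by exact_mod_cast hT)
  have h3 := half_lt_log_two
  have h4 : Real.logb 2 T ≤ 4 * Real.log T - 1 := by
    rw [Real.logb, div_le_iff₀ (by linarith)]
    nlinarith
  push_cast at h1
  simp only [numEpochs]
  push_cast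
  linarith

section Regret

variable {Ω X : Type*} [m0 : MeasurableSpace Ω] [mX : MeasurableSpace X] {K : ℕ}
  {μ : Measure Ω} [IsProbabilityMeasure μ] {D : Measure (X × (Fin K → ℝ))}
  [IsProbabilityMeasure D] {F : Set (Predictor X K)} {T : ℕ}
  {x : ℕ → Ω → X} {r : ℕ → Ω → Fin K → ℝ} {a : ℕ → Ω → Fin K} {fstar : Predictor X K}
  {π : X → Fin K} {β : ℕ → ℝ}

lemma measurable_apply_policy (hF : IsPredictorClass F) (hs : fstar ∈ F)
    {Ω' : Type*} [MeasurableSpace Ω'] {y : Ω' → X} {α : Ω' → Fin K} (hy : Measurable y)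
    (hα : Measurable α) : Measurable fun ω => fstar (y ω) (α ω) :=
  (measurable_from_prod_countable_left fun b => (hF _ hs b).1 :
    Measurable fun p : X × Fin K => fstar p.1 p.2).comp (hy.prodMk hα)

lemma measurable_apply_action {Ω' : Type*} [MeasurableSpace Ω'] {ρ : Ω' → Fin K → ℝ}
    {α : Ω' → Fin K} (hρ : Measurable ρ) (hα : Measurable α) : Measurable fun ω => ρ ω (α ω) :=
  (measurable_from_prod_countable_left fun b => measurable_pi_apply b :
    Measurable fun p : (Fin K → ℝ) × Fin K => p.1 p.2).comp (hρ.prodMk hα)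

/-- The regret exceeds the sum of the gaps by at most a martingale fluctuation. -/
lemma IsEliminationRun.measure_regret_sub_le (h : IsEliminationRun μ D F β T x r a)
    (hT : 1 ≤ T) (hu : HasUnitRewards D) (hr : IsRealizedBy D F fstar) (hF : IsPredictorClass F)
    (hπ : Measurable π) {u : ℝ} (hu0 : 0 < u) :
    μ {ω | Real.sqrt (2 * u * T) ≤
      regret π T x r a ω - ∑ t ∈ Finset.Icc 1 T, actionGap fstar π x a t ω} ≤
      ENNReal.ofReal (Real.exp (-u)) := by
  have hν : IsProbabilityMeasure (D.map Prod.fst) :=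
    Measure.isProbabilityMeasure_map measurable_fst.aemeasurable
  have hT0 : (0 : ℝ) < T := by exact_mod_cast hT
  -- The Chernoff parameter for which the compensator `T l² / 2` equals `u`, while the threshold
  -- contributes `2 u`.
  set l := Real.sqrt (2 * u / T) with hl
  have hl2 : l ^ 2 = 2 * u / T := Real.sq_sqrt (by positivity)
  set Y : ℕ → Ω → ℝ := fun t ω => l * (r t ω (π (x t ω)) - r t ω (a t ω) -
    (fstar (x t ω) (π (x t ω)) - fstar (x t ω) (a t ω))) - l ^ 2 / 2 with hY
  have hYm : ∀ n ∈ Set.Icc 1 T, Measurable[history x r a (n + 1)] (Y n) := by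
    intro n hn
    have hm : Measurable fun p : X × (Fin K → ℝ) × Fin K =>
        l * (p.2.1 (π p.1) - p.2.1 p.2.2 - (fstar p.1 (π p.1) - fstar p.1 p.2.2)) - l ^ 2 / 2 := by
      have h1 := measurable_apply_action (K := K) (measurable_fst.comp measurable_snd)
        (hπ.comp measurable_fst : Measurable fun p : X × (Fin K → ℝ) × Fin K => π p.1)
      have h2 : Measurable fun p : X × (Fin K → ℝ) × Fin K => p.2.1 p.2.2 :=
        measurable_apply_action (measurable_fst.comp measurable_snd)
          (measurable_snd.comp measurable_snd)
      have h3 : Measurable fun p : X × (Fin K → ℝ) × Fin K => fstar p.1 (π p.1) :=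
        measurable_apply_policy hF hr.1 measurable_fst (hπ.comp measurable_fst)
      have h4 : Measurable fun p : X × (Fin K → ℝ) × Fin K => fstar p.1 p.2.2 :=
        measurable_apply_policy hF hr.1 measurable_fst (measurable_snd.comp measurable_snd)
      exact (((h1.sub h2).sub (h3.sub h4)).const_mul l).sub_const _
    exact hm.comp (measurable_history hn.1)
  have key := h.isIidContexts.measure_inter_le hYm (fun n hn Φ hΦ =>
    (h.isRound hn).lintegral_exp_gap_le hu hr hF hπ l hΦ) le_rfl MeasurableSet.univ u
  simp only [Set.mem_univ, true_and] at key
  refine (measure_mono fun ω hω => ?_).trans (key.trans (mul_le_of_le_one_right' prob_le_one))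
  simp only [Set.mem_ofPred_eq] at hω ⊢
  have hsum : ∑ s ∈ Finset.Icc 1 T, Y s ω = l * (regret π T x r a ω -
      ∑ t ∈ Finset.Icc 1 T, actionGap fstar π x a t ω) - u := by
    simp only [hY, regret, actionGap, Finset.sum_sub_distrib, ← Finset.mul_sum, hl2,
      Finset.sum_const, Nat.card_Icc, nsmul_eq_mul]
    rw [Nat.add_sub_cancel]
    field_simp
  have hmul : l * Real.sqrt (2 * u * T) = 2 * u := by
    rw [hl, ← Real.sqrt_mul (by positivity)]
    rw [show 2 * u / T * (2 * u * T) = (2 * u) ^ 2 by field_simp]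
    exact Real.sqrt_sq (by positivity)
  have := mul_le_mul_of_nonneg_left hω (Real.sqrt_nonneg (2 * u / T))
  rw [hsum]
  linarith

/-- Runs on which the square gaps decay like `1 / t`. -/
lemma IsEliminationRun.measure_not_sq_actionGap_le {c L δ : ℝ}
    (h : IsEliminationRun μ D F (tolerance T c) T x r a) (hT : 2 ≤ T) (hu : HasUnitRewards D)
    (hr : IsRealizedBy D F fstar) (hF : IsPredictorClass F) (hp : IsPointwiseMeasurable F)
    (hπ : IsGreedyPolicy fstar π) (hL : IsIEC (D.map Prod.fst) F fstar 0 L) (hK : 1 ≤ K)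
    (hδ : 0 < δ) (hδ1 : δ < 1) (hc : IsConfidenceConst (D.map Prod.fst) F T δ c) :
    μ {ω | ¬ ∀ t ∈ Set.Icc 1 T,
      actionGap fstar π x a t ω ^ 2 ≤ 1152 * L * c * Real.log T / t} ≤
      ENNReal.ofReal (δ / 2) := by
  have hν : IsProbabilityMeasure (D.map Prod.fst) :=
    Measure.isProbabilityMeasure_map measurable_fst.aemeasurable
  have hc4 := (hc.log_le hT hF ⟨_, hr.1⟩ hK hδ hδ1).2
  have hL1 := hL.one_le hF hr.1 hK
  refine le_trans (measure_mono_ae ?_)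
    (h.measure_not_concentrate_le hT hu hr hF hp hK hδ hδ1 hc)
  filter_upwards [h.ae_isRegular hu] with ω hreg hω hgood
  refine hω fun t ht => (hreg.sq_actionGap_le hF hr.1 hπ (by omega) (by linarith) hgood.1 hgood.2
    hL hL1 ht).trans ?_
  refine div_le_div_of_nonneg_right ?_ (Nat.cast_nonneg t)
  nlinarith [mul_le_mul_of_nonneg_left (numEpochs_le_log hT)
    (by positivity : 0 ≤ 288 * L * c)]

lemma sum_le_of_sq_le {g : ℕ → ℝ} {B : ℝ} (hB : 0 ≤ B)
    (hg : ∀ t ∈ Set.Icc 1 T, g t ^ 2 ≤ B / t) :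
    ∑ t ∈ Finset.Icc 1 T, g t ≤ 2 * Real.sqrt (B * T) := by
  calc _ ≤ ∑ t ∈ Finset.Icc 1 T, Real.sqrt B * (1 / Real.sqrt t) := by
        refine Finset.sum_le_sum fun t ht => ?_
        rw [mul_one_div, ← Real.sqrt_div hB]
        exact Real.le_sqrt_of_sq_le (hg t (Finset.mem_Icc.1 ht))
    _ ≤ Real.sqrt B * (2 * Real.sqrt T) := by
        rw [← Finset.mul_sum]
        exact mul_le_mul_of_nonneg_left (sum_one_div_sqrt_le T) (Real.sqrt_nonneg _)
    _ = _ := by rw [Real.sqrt_mul hB]; ring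

/-- Each term satisfies `g t ≤ g t ^ 2 / γ`, so the sum is harmonic rather than of order `√T`. -/
lemma sum_le_of_sq_le_of_margin {g : ℕ → ℝ} {B γ : ℝ} (hγ : 0 < γ) (hB : 0 ≤ B)
    (hg : ∀ t ∈ Set.Icc 1 T, g t ^ 2 ≤ B / t) (hgap : ∀ t ∈ Set.Icc 1 T, g t = 0 ∨ γ ≤ g t) :
    ∑ t ∈ Finset.Icc 1 T, g t ≤ B / γ * (1 + Real.log T) := by
  calc _ ≤ ∑ t ∈ Finset.Icc 1 T, B / γ * (1 / t) := by
        refine Finset.sum_le_sum fun t ht => ?_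
        rcases hgap t (Finset.mem_Icc.1 ht) with h0 | h0
        · rw [h0]
          positivity
        · rw [div_mul_div_comm, mul_one, mul_comm γ, ← div_div, le_div_iff₀ hγ]
          nlinarith [hg t (Finset.mem_Icc.1 ht)]
    _ ≤ _ := by
        rw [← Finset.mul_sum]
        exact mul_le_mul_of_nonneg_left (sum_one_div_le T) (by positivity)

/-- High-probability regret bound. -/
lemma IsEliminationRun.measure_lt_regret_le {c L δ : ℝ}
    (h : IsEliminationRun μ D F (tolerance T c) T x r a) (hT : 2 ≤ T) (hu : HasUnitRewards D)
    (hr : IsRealizedBy D F fstar) (hF : IsPredictorClass F) (hp : IsPointwiseMeasurable F)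
    (hπ : IsGreedyPolicy fstar π) (hL : IsIEC (D.map Prod.fst) F fstar 0 L) (hK : 1 ≤ K)
    (hδ : 0 < δ) (hδ1 : δ < 1) (hc : IsConfidenceConst (D.map Prod.fst) F T δ c) :
    μ {ω | 98 * Real.sqrt (T * L * c) * Real.log T < regret π T x r a ω} ≤
      ENNReal.ofReal δ := by
  have hν : IsProbabilityMeasure (D.map Prod.fst) :=
    Measure.isProbabilityMeasure_map measurable_fst.aemeasurable
  obtain ⟨hc1, hc4⟩ := hc.log_le hT hF ⟨_, hr.1⟩ hK hδ hδ1
  have hL1 := hL.one_le hF hr.1 hK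
  have hT0 : (0 : ℝ) < T := by positivity
  have hl := half_lt_log hT
  set u := Real.log (2 / δ) with hu'
  have hu0 : 0 < u := Real.log_pos (by rw [lt_div_iff₀ hδ]; linarith)
  have hexp : Real.exp (-u) = δ / 2 := by
    rw [Real.exp_neg, hu', Real.exp_log (by positivity), inv_div]
  have hsub : {ω | 98 * Real.sqrt (T * L * c) * Real.log T < regret π T x r a ω} ⊆
      {ω | ¬ ∀ t ∈ Set.Icc 1 T,
        actionGap fstar π x a t ω ^ 2 ≤ 1152 * L * c * Real.log T / t} ∪
      {ω | Real.sqrt (2 * u * T) ≤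
        regret π T x r a ω - ∑ t ∈ Finset.Icc 1 T, actionGap fstar π x a t ω} := by
    intro ω hω
    by_contra hcon
    simp only [Set.mem_union, Set.mem_ofPred_eq, not_or, not_not, not_le] at hcon hω
    have h1 := sum_le_of_sq_le (by positivity) hcon.1
    -- Since `log T > 1/2`, `1152 log T ≤ (48 log T)²`. The gaps contribute `2 * 48`, and the
    -- fluctuation at most `2 log T` times the root: in all 98.
    have h2 : Real.sqrt (1152 * L * c * Real.log T * T) ≤
        48 * Real.log T * Real.sqrt (T * L * c) := by
      refine Real.sqrt_le_iff.2 ⟨by positivity, ?_⟩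
      rw [mul_pow, Real.sq_sqrt (by positivity)]
      have : 0 ≤ L * c * T * Real.log T := by positivity
      nlinarith
    have h3 : Real.sqrt (2 * u * T) ≤ Real.sqrt (T * L * c) := by
      refine Real.sqrt_le_sqrt ?_
      have : c ≤ L * c := le_mul_of_one_le_left (by linarith) hL1
      nlinarith
    have h4 := Real.sqrt_nonneg (T * L * c)
    nlinarith [hcon.2]
  refine (measure_mono hsub).trans ((measure_union_le _ _).trans ((add_le_add
    (h.measure_not_sq_actionGap_le hT hu hr hF hp hπ hL hK hδ hδ1 hc)
    (h.measure_regret_sub_le (by omega) hu hr hF hπ.1 hu0)).trans (le_of_eq ?_)))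
  rw [hexp, ← ENNReal.ofReal_add (by positivity) (by positivity), add_halves]

lemma one_sub_le_measureReal {P : Ω → Prop} {δ : ℝ} (hδ : 0 ≤ δ)
    (h : μ {ω | ¬ P ω} ≤ ENNReal.ofReal δ) : 1 - δ ≤ μ.real {ω | P ω} := by
  have h1 : μ.real {ω | ¬ P ω} ≤ δ := by
    rw [measureReal_def]
    exact ENNReal.toReal_le_of_le_ofReal hδ h
  have h2 := measureReal_union_le (μ := μ) {ω | P ω} {ω | ¬ P ω}
  have h3 : {ω | P ω} ∪ {ω | ¬ P ω} = Set.univ := Set.union_compl_self {ω | P ω}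
  rw [h3, probReal_univ] at h2
  linarith

/-- The mean regret is the mean of the sum of the gaps. -/
lemma IsEliminationRun.integral_regret (h : IsEliminationRun μ D F β T x r a)
    (hu : HasUnitRewards D) (hr : IsRealizedBy D F fstar) (hF : IsPredictorClass F)
    (hπ : IsGreedyPolicy fstar π) :
    Integrable (regret π T x r a) μ ∧ ∫ ω, regret π T x r a ω ∂μ =
      ∫ ω, ∑ t ∈ Finset.Icc 1 T, actionGap fstar π x a t ω ∂μ := by
  have hreg := h.ae_regular hu
  have hπx : ∀ t, Measurable fun ω => π (x t ω) := fun t => hπ.1.comp (h.measurable_context t)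
  have hm : ∀ {α : ℕ → Ω → Fin K}, (∀ t, Measurable (α t)) → ∀ t ∈ Finset.Icc 1 T,
      Integrable (fun ω => r t ω (α t ω)) μ := fun hα t ht =>
    Integrable.of_mem_Icc 0 1 (measurable_apply_action (h.measurable_reward t) (hα t)).aemeasurable
      (hreg.mono fun ω hω => (hω t (Finset.mem_Icc.1 ht)).1 _)
  have hf : ∀ {α : ℕ → Ω → Fin K}, (∀ t, Measurable (α t)) → ∀ t ∈ Finset.Icc 1 T,
      Integrable (fun ω => fstar (x t ω) (α t ω)) μ := fun hα t ht =>
    Integrable.of_mem_Icc 0 1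
      (measurable_apply_policy hF hr.1 (h.measurable_context t) (hα t)).aemeasurable
      (ae_of_all _ fun ω => (hF _ hr.1 _).2 _)
  have heq : ∀ {α : ℕ → Ω → Fin K}, (∀ t, Measurable (α t)) → ∀ t ∈ Finset.Icc 1 T,
      ∫⁻ ω, ENNReal.ofReal (r t ω (α t ω)) ∂μ = ∫⁻ ω, ENNReal.ofReal (fstar (x t ω) (α t ω)) ∂μ →
      ∫ ω, r t ω (α t ω) ∂μ = ∫ ω, fstar (x t ω) (α t ω) ∂μ := by
    intro α hα t ht he
    rw [integral_eq_lintegral_of_nonneg_ae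
        (hreg.mono fun ω hω => ((hω t (Finset.mem_Icc.1 ht)).1 _).1)
        (hm hα t ht).aestronglyMeasurable,
      integral_eq_lintegral_of_nonneg_ae (ae_of_all _ fun ω => ((hF _ hr.1 _).2 _).1)
        (hf hα t ht).aestronglyMeasurable, he]
  have hi1 := integrable_finsetSum (Finset.Icc 1 T) (hm hπx)
  have hi2 := integrable_finsetSum (Finset.Icc 1 T) (hm h.measurable_action)
  have hfg : ∀ t ∈ Finset.Icc 1 T,
      Integrable (fun ω => fstar (x t ω) (π (x t ω)) - fstar (x t ω) (a t ω)) μ := fun t ht =>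
    (hf hπx t ht).sub (hf h.measurable_action t ht)
  refine ⟨hi1.sub hi2, ?_⟩
  unfold regret actionGap
  rw [integral_sub hi1 hi2, integral_finsetSum _ (hm hπx),
    integral_finsetSum _ (hm h.measurable_action), integral_finsetSum _ hfg,
    ← Finset.sum_sub_distrib]
  refine Finset.sum_congr rfl fun t ht => ?_
  rw [integral_sub (hf hπx t ht) (hf h.measurable_action t ht),
    heq hπx t ht ((h.isRound (Finset.mem_Icc.1 ht)).lintegral_reward_policy_eq hu hr hF hπ.1),
    heq h.measurable_action t ht ((h.isRound (Finset.mem_Icc.1 ht)).lintegral_reward_eq hu hr hF)]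

lemma integral_le_add_of_measure_le {g : Ω → ℝ} {b B δ : ℝ} (hb : 0 ≤ b) (hB : 0 ≤ B)
    (hδ : 0 ≤ δ) (hg : Measurable g) (h0 : ∀ ω, 0 ≤ g ω) (h1 : ∀ ω, g ω ≤ B)
    (h : μ {ω | ¬ g ω ≤ b} ≤ ENNReal.ofReal δ) : ∫ ω, g ω ∂μ ≤ b + B * δ := by
  have hS : MeasurableSet {ω | ¬ g ω ≤ b} := (measurableSet_le hg measurable_const).compl
  have hi : Integrable ({ω | ¬ g ω ≤ b}.indicator fun _ => B) μ :=
    (integrable_const B).indicator hS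
  calc ∫ ω, g ω ∂μ ≤ ∫ ω, (b + {ω | ¬ g ω ≤ b}.indicator (fun _ => B) ω) ∂μ := by
        refine integral_mono (Integrable.of_mem_Icc 0 B hg.aemeasurable
          (ae_of_all _ fun ω => ⟨h0 ω, h1 ω⟩)) ((integrable_const b).add hi) fun ω => ?_
        by_cases hω : g ω ≤ b
        · rw [Set.indicator_of_notMem (by simpa using hω)]
          simpa using hω
        · rw [Set.indicator_of_mem hω]
          linarith [h1 ω]
    _ = b + B * μ.real {ω | ¬ g ω ≤ b} := by
        rw [integral_add (integrable_const b) hi, integral_indicator_const _ hS]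
        simp [mul_comm]
    _ ≤ b + B * δ := by
        gcongr
        rw [measureReal_def]
        exact ENNReal.toReal_le_of_le_ofReal hδ h

/-- Expected regret bound under the Massart condition. -/
lemma IsEliminationRun.integral_regret_le {c L γ : ℝ}
    (h : IsEliminationRun μ D F (tolerance T c) T x r a) (hT : 2 ≤ T) (hu : HasUnitRewards D)
    (hr : IsRealizedBy D F fstar) (hF : IsPredictorClass F) (hp : IsPointwiseMeasurable F)
    (hπ : IsGreedyPolicy fstar π) (hL : IsIEC (D.map Prod.fst) F fstar 0 L) (hK : 1 ≤ K)
    (hγ : Massart fstar π γ) (hc : IsConfidenceConst (D.map Prod.fst) F T (1 / (T : ℝ)) c) :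
    ∫ ω, regret π T x r a ω ∂μ ≤ 3457 * (L * c * Real.log T ^ 2 / γ) := by
  have hν : IsProbabilityMeasure (D.map Prod.fst) :=
    Measure.isProbabilityMeasure_map measurable_fst.aemeasurable
  have hT2 : (2 : ℝ) ≤ T := by exact_mod_cast hT
  have hδ : (0 : ℝ) < 1 / T := by positivity
  have hδ1 : (1 : ℝ) / T < 1 := by
    rw [div_lt_one (by linarith)]
    linarith
  have hc4 := (hc.log_le hT hF ⟨_, hr.1⟩ hK hδ hδ1).2
  have hL1 := hL.one_le hF hr.1 hK
  have hl := half_lt_log hT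
  have hγ0 := hγ.1
  rw [(h.integral_regret hu hr hF hπ).2]
  have hg := fun t ω => actionGap_mem_Icc (x := x) (a := a) hF hr.1 hπ t ω
  have hgap : ∀ t ω, actionGap fstar π x a t ω = 0 ∨ γ ≤ actionGap fstar π x a t ω := by
    intro t ω
    unfold actionGap
    by_cases heq : a t ω = π (x t ω)
    · simp [heq]
    · have := hγ.2 _ _ heq
      exact Or.inr (by linarith)
  -- Gaps are at most 1, so a larger margin leaves only zero gaps; otherwise `γ ≤ 1` makes the
  -- target at least 1, which absorbs the contribution `1/2` of the bad event.
  rcases lt_or_ge 1 γ with hγ1 | hγ1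
  · have hz : ∀ t ω, actionGap fstar π x a t ω = 0 := fun t ω =>
      (hgap t ω).resolve_right (by linarith [(hg t ω).2])
    simp only [hz, Finset.sum_const_zero, integral_zero]
    positivity
  set B := 1152 * L * c * Real.log T with hB
  have hB0 : 0 ≤ B := by positivity
  have hmeas : Measurable fun ω => ∑ t ∈ Finset.Icc 1 T, actionGap fstar π x a t ω :=
    Finset.measurable_sum _ fun t _ =>
      (measurable_apply_policy hF hr.1 (h.measurable_context t)
        (hπ.1.comp (h.measurable_context t))).sub
      (measurable_apply_policy hF hr.1 (h.measurable_context t) (h.measurable_action t))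
  have hbad : μ {ω | ¬ ∑ t ∈ Finset.Icc 1 T, actionGap fstar π x a t ω ≤
      B / γ * (1 + Real.log T)} ≤ ENNReal.ofReal (1 / (T : ℝ) / 2) := by
    refine (measure_mono fun ω hω hcon => ?_).trans
      (h.measure_not_sq_actionGap_le hT hu hr hF hp hπ hL hK hδ hδ1 hc)
    exact hω (sum_le_of_sq_le_of_margin hγ0 hB0 hcon fun t _ => hgap t ω)
  have key := integral_le_add_of_measure_le (μ := μ) (B := T) (by positivity) (by positivity)
    (by positivity) hmeas (fun ω => Finset.sum_nonneg fun t _ => (hg t ω).1)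
    (fun ω => (Finset.sum_le_sum fun t _ => (hg t ω).2).trans (by simp)) hbad
  refine key.trans ?_
  have h1 : (T : ℝ) * (1 / (T : ℝ) / 2) = 1 / 2 := by field_simp
  have hLc : 4 ≤ L * c := by nlinarith
  have h2 : 1 ≤ L * c * Real.log T ^ 2 / γ := by
    rw [le_div_iff₀ hγ0]
    have : (1 : ℝ) / 4 ≤ Real.log T ^ 2 := by nlinarith
    nlinarith
  have h3 : B / γ * (1 + Real.log T) ≤ 3456 * (L * c * Real.log T ^ 2 / γ) := by
    rw [div_mul_eq_mul_div, mul_div_assoc', div_le_div_iff_of_pos_right hγ0, hB]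
    have : 0 ≤ L * c * Real.log T := by positivity
    nlinarith
  linarith

end Regret

/-! ### Finite classes -/

/-- A finite class with an exploration coefficient has at least two elements, so `log |F|` can
absorb constants. -/
lemma IsIEC.log_two_le {X : Type*} [MeasurableSpace X] {K : ℕ} {F : Set (Predictor X K)}
    {fstar : Predictor X K} {ν : Measure X} {lam L : ℝ} (h : IsIEC ν F fstar lam L)
    (hs : fstar ∈ F) (hfin : F.Finite) : Real.log 2 ≤ Real.log F.ncard := by
  obtain ⟨f, hf, hne⟩ := h.exists_ne
  have : 1 < F.ncard := (Set.one_lt_ncard hfin).2 ⟨f, hf, fstar, hs, hne⟩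
  exact Real.log_le_log (by norm_num) (by exact_mod_cast this)

lemma finiteConst_le {X : Type*} {K T : ℕ} {F : Set (Predictor X K)} {δ : ℝ} (hT : 2 ≤ T)
    (hlog : Real.log 2 ≤ Real.log F.ncard) (hδ : 0 < δ) (hδ1 : δ < 1) :
    finiteConst F T δ ≤
      64 * Real.log F.ncard * (1 + Real.log T + Real.log (1 / δ)) := by
  have h2 := half_lt_log_two
  have hT' : (2 : ℝ) ≤ T := by exact_mod_cast hT
  have hl := half_lt_log hT
  have hd : 0 ≤ Real.log (1 / δ) := Real.log_nonneg (by rw [le_div_iff₀ hδ]; linarith)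
  have hn : (F.ncard : ℝ) ≠ 0 := by
    intro h0
    rw [h0, Real.log_zero] at hlog
    linarith
  have e : Real.log (2 * F.ncard * (T : ℝ) ^ 2 / δ) =
      Real.log 2 + Real.log F.ncard + 2 * Real.log T + Real.log (1 / δ) := by
    rw [mul_div_assoc, div_eq_mul_one_div, Real.log_mul (by positivity) (by positivity),
      Real.log_mul (by norm_num) hn, Real.log_mul (by positivity) (by positivity), Real.log_pow]
    push_cast
    ring
  rw [finiteConst, e]
  nlinarith

end RegCB

end

/-! ### Assembling the bounds with explicit constants. -/

theorem theorem3 :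
    ∃ (C : ℝ) (k : ℕ), 0 < C ∧
      ∀ {X : Type*} {Ω : Type*} [MeasurableSpace X] [MeasurableSpace Ω]
        (μ : Measure Ω) [IsProbabilityMeasure μ] (K T : ℕ) (_ : 2 ≤ T)
        (D : Measure (X × (Fin K → ℝ))) [IsProbabilityMeasure D]
        (F : Set (RegCB.Predictor X K)) (fstar : RegCB.Predictor X K) (pistar : X → Fin K)
        (L : ℝ),
        RegCB.IsPredictorClass F → RegCB.IsPointwiseMeasurable F →
        RegCB.HasUnitRewards D → RegCB.IsRealizedBy D F fstar →
        RegCB.IsGreedyPolicy fstar pistar →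
        RegCB.IsIEC (D.map Prod.fst) F fstar 0 L →
        -- high-probability bound
        (∀ (δ c : ℝ), 0 < δ → δ < 1 → RegCB.IsConfidenceConst (D.map Prod.fst) F T δ c →
          ∀ (x : ℕ → Ω → X) (r : ℕ → Ω → Fin K → ℝ) (a : ℕ → Ω → Fin K),
            RegCB.IsEliminationRun μ D F (RegCB.tolerance T c) T x r a →
            1 - δ ≤ μ.real {ω | RegCB.regret pistar T x r a ω ≤
              C * (Real.sqrt (T * L * c) * Real.log T + Real.log (1 / δ))} ∧
            (F.Finite →
              1 - δ ≤ μ.real {ω | RegCB.regret pistar T x r a ω ≤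
                C * Real.sqrt (T * L * Real.log F.ncard) *
                  (1 + Real.log T + Real.log K + Real.log (1 / δ)) ^ k})) ∧
        -- expected regret under the Massart condition, with failure probability `1 / T`
        (∀ (γ c : ℝ), RegCB.Massart fstar pistar γ →
          RegCB.IsConfidenceConst (D.map Prod.fst) F T (1 / (T : ℝ)) c →
          ∀ (x : ℕ → Ω → X) (r : ℕ → Ω → Fin K → ℝ) (a : ℕ → Ω → Fin K),
            RegCB.IsEliminationRun μ D F (RegCB.tolerance T c) T x r a →
            Integrable (RegCB.regret pistar T x r a) μ ∧
            ∫ ω, RegCB.regret pistar T x r a ω ∂μ ≤ C * (L * c * Real.log T ^ 2 / γ) ∧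
            (F.Finite →
              ∫ ω, RegCB.regret pistar T x r a ω ∂μ ≤
                C * (L * Real.log F.ncard / γ) * (1 + Real.log T + Real.log K) ^ k)) := by
  -- The largest demand is `3457 * 128 = 442496`, from the finite-class bound under the Massart
  -- condition, with two powers from `log² T` and one from `c`.
  refine ⟨500000, 3, by norm_num, ?_⟩
  intro X Ω _ _ μ _ K T hT D _ F fstar pistar L hF hp hu hr hπ hL
  obtain ⟨x₀, -⟩ := nonempty_of_isProbabilityMeasure D
  have hK : 1 ≤ K := (pistar x₀).pos
  have hν : IsProbabilityMeasure (D.map Prod.fst) :=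
    Measure.isProbabilityMeasure_map measurable_fst.aemeasurable
  have hL1 := hL.one_le hF hr.1 hK
  have hl := RegCB.half_lt_log hT
  have hlogK : 0 ≤ Real.log K := Real.log_natCast_nonneg K
  have h2 := RegCB.half_lt_log_two
  refine ⟨fun δ c hδ hδ1 hc x r a h => ?_, fun γ c hγ hc x r a h => ?_⟩
  · have hd : 0 ≤ Real.log (1 / δ) := Real.log_nonneg (by rw [le_div_iff₀ hδ]; linarith)
    have hmain := h.measure_lt_regret_le hT hu hr hF hp hπ hL hK hδ hδ1 hc
    refine ⟨RegCB.one_sub_le_measureReal hδ.le ((measure_mono fun ω hω => ?_).trans hmain),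
      fun hfin => RegCB.one_sub_le_measureReal hδ.le
        ((measure_mono fun ω hω => ?_).trans hmain)⟩
    · simp only [Set.mem_ofPred_eq, not_le] at hω ⊢
      refine lt_of_le_of_lt ?_ hω
      have : 0 ≤ Real.sqrt (T * L * c) * Real.log T := by positivity
      nlinarith
    · simp only [Set.mem_ofPred_eq, not_le] at hω ⊢
      refine lt_of_le_of_lt ?_ hω
      have hlog := hL.log_two_le hr.1 hfin
      have hcle := (hc.le_finiteConst hfin).trans (RegCB.finiteConst_le hT hlog hδ hδ1)
      set P := 1 + Real.log T + Real.log K + Real.log (1 / δ) with hP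
      have hP1 : 1 ≤ P := by linarith
      have hlT : Real.log T ≤ P := by linarith
      have hsq : Real.sqrt (T * L * c) ≤
          8 * P * Real.sqrt (T * L * Real.log F.ncard) := by
        refine Real.sqrt_le_iff.2 ⟨by positivity, ?_⟩
        rw [mul_pow, Real.sq_sqrt (by positivity)]
        have h3 : c ≤ 64 * Real.log F.ncard * P ^ 2 := hcle.trans (by
          refine mul_le_mul_of_nonneg_left ?_ (by linarith)
          nlinarith)
        have := mul_le_mul_of_nonneg_left h3 (by positivity : 0 ≤ T * L)
        nlinarith
      have hw := Real.sqrt_nonneg (T * L * Real.log F.ncard)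
      calc 98 * Real.sqrt (T * L * c) * Real.log T
          ≤ 98 * (8 * P * Real.sqrt (T * L * Real.log F.ncard)) * P := by gcongr
        _ = 784 * Real.sqrt (T * L * Real.log F.ncard) * P ^ 2 := by ring
        _ ≤ 500000 * Real.sqrt (T * L * Real.log F.ncard) * P ^ 3 := by
            gcongr
            · norm_num
            · norm_num
  · have hmain := h.integral_regret_le hT hu hr hF hp hπ hL hK hγ hc
    have hT2 : (2 : ℝ) ≤ T := by exact_mod_cast hT
    have hδ : (0 : ℝ) < 1 / T := by positivity
    have hδ1 : (1 : ℝ) / T < 1 := by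
      rw [div_lt_one (by linarith)]
      linarith
    have hc4 := (hc.log_le hT hF ⟨_, hr.1⟩ hK hδ hδ1).2
    have hγ0 := hγ.1
    refine ⟨(h.integral_regret hu hr hF hπ).1, hmain.trans ?_, fun hfin => hmain.trans ?_⟩
    · gcongr
      norm_num
    · have hlog := hL.log_two_le hr.1 hfin
      have hcle := (hc.le_finiteConst hfin).trans (RegCB.finiteConst_le hT hlog hδ hδ1)
      rw [one_div_one_div] at hcle
      set P := 1 + Real.log T + Real.log K with hP
      have hlT : Real.log T ≤ P := by linarith
      have hc' : c ≤ 128 * Real.log F.ncard * P := hcle.trans (by nlinarith)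
      calc 3457 * (L * c * Real.log T ^ 2 / γ)
          ≤ 3457 * (L * (128 * Real.log F.ncard * P) * P ^ 2 / γ) := by gcongr
        _ = 442496 * (L * Real.log F.ncard / γ) * P ^ 3 := by ring
        _ ≤ 500000 * (L * Real.log F.ncard / γ) * P ^ 3 := by
            have : 0 ≤ L * Real.log F.ncard / γ := by
              have : 0 ≤ Real.log F.ncard := by linarith
              positivity
            gcongr
            norm_num
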